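/- Let $G=(V,\to)$ be a finite directed graph (self-loops allowed, not necessarily connected) and let $D$ be a depth-first forest of $G$ with its parents, depth-first numbering (DFN) and post depth-first numbering; $D$ is produced by some complete depth-first search of $G$. Edges of $G$ are classified by $D$ as back edges ($B$: the target is an ancestor of the source or equal to it), tree edges, and cross/forward edges. Consider the following algorithm $\mathtt{ConstructWTO}^{BU}(G,D)$, which computes a set $X$ of new elements (exits), a set $\rightharpoonup$ of scheduling constraints on $V\cup X$, and a set $\dashrightarrow\ \subseteq X\times V$ of stabilization constraints. *Phase 1 ($\mathtt{ConstructWPO}^{BU}(G,D,\mathit{true})$).* A disjoint-set structure (union by rank, path compression) maintains a partition of $V$ into sets with representatives; initially $\mathrm{rep}(v)=\mathrm{exit}[v]=v$, and $\mathrm{merge}(v,h)$ unites the sets of $v$ and $h$ and makes $h$ the representative. All cross/forward edges $(u,v)$ are removed and stored in $R[\mathrm{lca}_D(u,v)]$ (lowest common ancestors are computed off-line with disjoint sets; a virtual root above all trees of $D$ serves vertices of different trees). For each vertex $v$, $O[v]$ is the set of the original non-back edges that currently target $v$. For each $h\in V$ in descending DFN: every $(u,v)\in R[h]$ is restored as an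 edge $(u,\mathrm{rep}(v))$ and $(u,v)$ is added to $O[\mathrm{rep}(v)]$; $P_h=\{\mathrm{rep}(p):(p,h)\in B\}$; $N_h$ is the set of all vertices found by a backward worklist search that starts from $P_h\setminus\{h\}$, follows the current non-back edges, replaces every predecessor $p$ by $\mathrm{rep}(p)$, and does not enter $h$; if $P_h\neq\emptyset$, then for every $v\in N_h$ the constraints $(\mathrm{exit}[\mathrm{rep}(u)],v')$ for $(u,v')\in O[v]$ and $(\mathrm{exit}[\mathrm{rep}(u)],v)$ for the current non-back edges $(u,v)$ are added to $\rightharpoonup$, a new exit $x_h$ is created, $(\mathrm{exit}[\mathrm{rep}(p)],x_h)$ for $p\in P_h$ is added to $\rightharpoonup$, $(x_h,h)$ is added to $\dashrightarrow$, $\mathrm{exit}[h]:=x_h$, and every $v\in N_h$ is merged into $h$. After the loop the edges stored at the virtual root are restored in the same way, and the same two kinds of constraints as for $v\in N_h$ are added for every $v\in V$ with $\mathrm{rep}(v)=v$. *Phase 2.* The elements of $V\cup X$ without predecessor in $\rightharpoonup$ are pushed on a stack and all counters $\mathrm{count}[w]$ are set to $0$. While the stack is non-empty, an element $v$ is popped,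 $(\mathit{prev},v)$ is added to $\rightharpoonup$ if there is a previously popped element $\mathit{prev}$, and for each $v\rightharpoonup w$ the counter $\mathrm{count}[w]$ is increased by one and $w$ is pushed when it reaches the number of predecessors of $w$ in $\rightharpoonup$. The result is $(V,X,\rightharpoonup,\dashrightarrow)$. **Theorem.** The running time of $\mathtt{ConstructWTO}^{BU}(G,D)$ is almost linear. Precisely, implement the algorithm on a unit-cost random access machine (registers, arrays, constants, successor, predecessor, comparisons; every evaluated expression node, assignment and test costs one step), with the edges of $G$ given as an array in arbitrary order without repetition, $D$ given by the arrays of parents, DFN and post-DFN, sets of edges and constraints stored as linked lists or arrays, and disjoint sets stored as rooted trees with union by rank and path compression. Then there is a constant $C$ such that for every $G$ and every depth-first forest $D$ of $G$ the program halts after at most $$C\,\bigl(|V|+|{\to}|+1\bigr)\,\bigl(\alpha(|V|)+1\bigr)$$ steps, where $\alpha(n)=\min\{k: n\le A(k,k)\}$ is the inverse of the (Ackermann–Péter) function $A$. -/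

import Mathlib

namespace WTO

/-! ### A unit-cost random access machine

Memory consists of finitely many registers and finitely many unbounded arrays of natural numbers.
The arithmetic of the machine is restricted to constants, successor, (truncated) predecessor and
comparison, so that `t` steps can increase the numbers in memory by at most `O(t)`.  Every
node of an expression that is evaluated, every assignment and every test costs one step. -/

/-- The registers. -/
inductive Reg
  -- input: number of vertices, number of edges, and the Boolean parameter `lift`
  | n | m | lift
  -- counters: number of elements of `V ∪ X`, number of scheduling constraints
  | xc | fc
  -- local variables
  | i | j | k | e | p | q | u | v | w | h | x | np | nw | sp | prev
  -- local variables of the disjoint-set operations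
  | fx | fy | fr | ra | rb
  deriving DecidableEq

/-- The arrays. -/
inductive Arr
  -- input: the edge `e` goes from `src e` to `tgt e`; the depth-first forest
  | src | tgt | par | dfn | post
  -- the inverses of `dfn` and `post`
  | ord | pord
  -- linked lists of edges: back edges by target, cross/forward edges by source,
  -- the map `R`, and current non-back edges by current target
  | bHd | bNxt | cHd | cNxt | rHd | rNxt | inHd | inNxt
  -- disjoint sets: parent pointers, ranks, representative of the set with a given root
  | uf | rank | name
  -- the map `exit`, the stabilization constraints, and membership marks
  | ex | nest | mark | pmark
  -- the sequences `P_h` and `N_h` followed by `W_h`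
  | pl | wl
  -- scheduling constraints: sources, targets, linked lists by source, number of predecessors
  | fsrc | ftgt | fHd | fNxt | npred
  -- the arrays of the final topological traversal
  | count | stack
  deriving DecidableEq

inductive Exp
  | lit (c : ℕ)
  | reg (z : Reg)
  | get (a : Arr) (i : Exp)
  | succ (e : Exp)
  | pred (e : Exp)

inductive Test
  | eq (e f : Exp)
  | lt (e f : Exp)
  | not (b : Test)
  | and (b c : Test)

inductive Cmd
  | skip
  | set (z : Reg) (e : Exp)
  | store (a : Arr) (i e : Exp)
  | seq (c d : Cmd)
  | ite (b : Test) (c d : Cmd)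
  | loop (b : Test) (c : Cmd)

structure Mem where
  reg : Reg → ℕ
  arr : Arr → ℕ → ℕ

def Mem.setReg (s : Mem) (z : Reg) (c : ℕ) : Mem :=
  { s with reg := Function.update s.reg z c }

def Mem.setArr (s : Mem) (a : Arr) (i c : ℕ) : Mem :=
  { s with arr := Function.update s.arr a (Function.update (s.arr a) i c) }

def Exp.eval (s : Mem) : Exp → ℕ
  | .lit c => c
  | .reg z => s.reg z
  | .get a i => s.arr a (i.eval s)
  | .succ e => e.eval s + 1
  | .pred e => e.eval s - 1

def Exp.cost : Exp → ℕ
  | .lit _ => 1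
  | .reg _ => 1
  | .get _ i => i.cost + 1
  | .succ e => e.cost + 1
  | .pred e => e.cost + 1

def Test.Holds (s : Mem) : Test → Prop
  | .eq e f => e.eval s = f.eval s
  | .lt e f => e.eval s < f.eval s
  | .not b => ¬ b.Holds s
  | .and b c => b.Holds s ∧ c.Holds s

def Test.cost : Test → ℕ
  | .eq e f => e.cost + f.cost + 1
  | .lt e f => e.cost + f.cost + 1
  | .not b => b.cost + 1
  | .and b c => b.cost + c.cost + 1

/-- `Exec c s t s'`: started in memory `s`, the program `c` halts after exactly `t` steps in
memory `s'`. -/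
inductive Exec : Cmd → Mem → ℕ → Mem → Prop
  | skip (s : Mem) : Exec .skip s 1 s
  | set (z : Reg) (e : Exp) (s : Mem) :
      Exec (.set z e) s (e.cost + 1) (s.setReg z (e.eval s))
  | store (a : Arr) (i e : Exp) (s : Mem) :
      Exec (.store a i e) s (i.cost + e.cost + 1) (s.setArr a (i.eval s) (e.eval s))
  | seq {c d : Cmd} {s s' s'' : Mem} {t t' : ℕ} (h₁ : Exec c s t s') (h₂ : Exec d s' t' s'') :
      Exec (.seq c d) s (t + t') s''
  | ite_true {b : Test} {c d : Cmd} {s s' : Mem} {t : ℕ} (hb : b.Holds s) (h₁ : Exec c s t s') :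
      Exec (.ite b c d) s (b.cost + 1 + t) s'
  | ite_false {b : Test} {c d : Cmd} {s s' : Mem} {t : ℕ} (hb : ¬ b.Holds s)
      (h₁ : Exec d s t s') : Exec (.ite b c d) s (b.cost + 1 + t) s'
  | loop_false {b : Test} {c : Cmd} {s : Mem} (hb : ¬ b.Holds s) :
      Exec (.loop b c) s (b.cost + 1) s
  | loop_true {b : Test} {c : Cmd} {s s' s'' : Mem} {t t' : ℕ} (hb : b.Holds s)
      (h₁ : Exec c s t s') (h₂ : Exec (.loop b c) s' t' s'') :
      Exec (.loop b c) s (b.cost + 1 + t + t') s''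

/-- The machine is deterministic: a program has at most one running time and one result. -/
theorem Exec.deterministic {c : Cmd} {s s₁ s₂ : Mem} {t₁ t₂ : ℕ} (h₁ : Exec c s t₁ s₁)
    (h₂ : Exec c s t₂ s₂) : t₁ = t₂ ∧ s₁ = s₂ := by
  induction h₁ generalizing t₂ s₂ with
  | skip | set | store => cases h₂; exact ⟨rfl, rfl⟩
  | seq _ _ ih₁ ih₂ =>
    cases h₂ with
    | seq k₁ k₂ =>
      obtain ⟨rfl, rfl⟩ := ih₁ k₁
      obtain ⟨rfl, rfl⟩ := ih₂ k₂
      exact ⟨rfl, rfl⟩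
  | ite_true hb _ ih =>
    cases h₂ with
    | ite_true _ k => obtain ⟨rfl, rfl⟩ := ih k; exact ⟨rfl, rfl⟩
    | ite_false hb' _ => exact absurd hb hb'
  | ite_false hb _ ih =>
    cases h₂ with
    | ite_true hb' _ => exact absurd hb' hb
    | ite_false _ k => obtain ⟨rfl, rfl⟩ := ih k; exact ⟨rfl, rfl⟩
  | loop_false hb =>
    cases h₂ with
    | loop_false _ => exact ⟨rfl, rfl⟩
    | loop_true hb' _ _ => exact absurd hb' hb
  | loop_true hb _ _ ih₁ ih₂ =>
    cases h₂ with
    | loop_false hb' => exact absurd hb hb'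
    | loop_true _ k₁ k₂ =>
      obtain ⟨rfl, rfl⟩ := ih₁ k₁
      obtain ⟨rfl, rfl⟩ := ih₂ k₂
      exact ⟨rfl, rfl⟩

instance : Coe Reg Exp := ⟨Exp.reg⟩

instance : CoeFun Arr (fun _ => Exp → Exp) := ⟨Exp.get⟩

/-! ### The program -/

section Program

open Reg Arr Exp

local infixr:30 " ;; " => Cmd.seq
local infix:40 " ≔ " => Cmd.set
local notation:40 a:max "⟦" i "⟧" " ≔ " e:41 => Cmd.store a i e
local infix:50 " ≐ " => Test.eq
local infix:50 " ≺ " => Test.lt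

/-- `if b then c`. -/
def onlyIf (b : Test) (c : Cmd) : Cmd := .ite b c .skip

/-- `for z = 0, …, bound - 1 do body`. -/
def forRange (z : Reg) (bound : Exp) (body : Cmd) : Cmd :=
  z ≔ lit 0 ;;
  .loop (z ≺ bound) (
    body ;;
    z ≔ succ z)

/-- Insert the edge with number `e` into the linked list number `a` of the family `(hd, nxt)`:
`hd a` is one more than the number of the first edge of the list, and `0` if it is empty. -/
def insertInto (hd nxt : Arr) (a : Exp) : Cmd :=
  nxt⟦e⟧ ≔ hd a ;;
  hd⟦a⟧ ≔ succ e

/-- For every edge number `e` in the linked list number `a` of the family `(hd, nxt)`. -/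
def forList (hd nxt : Arr) (a : Exp) (body : Cmd) : Cmd :=
  p ≔ hd a ;;
  .loop (.not (p ≐ lit 0)) (
    e ≔ pred p ;;
    p ≔ nxt e ;;
    body)

/-! Disjoint sets: union by rank and path compression.  The array `name` keeps the prescribed
representative of each set at the root of its tree. -/

/-- `rep(z) := z` for every vertex `z`, and for the virtual root `n`. -/
def makeSets : Cmd :=
  forRange i (succ n) (
    uf⟦i⟧ ≔ i ;;
    rank⟦i⟧ ≔ lit 0 ;;
    name⟦i⟧ ≔ i)

/-- Compute in `fr` the root of the tree that contains `fx`, with path compression. -/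
def findRoot : Cmd :=
  fr ≔ fx ;;
  .loop (.not (uf fr ≐ fr)) (fr ≔ uf fr) ;;
  .loop (.not (uf fx ≐ fr)) (
    fy ≔ uf fx ;;
    uf⟦fx⟧ ≔ fr ;;
    fx ≔ fy)

/-- `z := rep(a)`. -/
def rep (z : Reg) (a : Exp) : Cmd :=
  fx ≔ a ;;
  findRoot ;;
  z ≔ name fr

/-- `merge(a, b)`: unite the sets of `a` and `b`; the representative becomes `b`. -/
def merge (a b : Exp) : Cmd :=
  fx ≔ a ;; findRoot ;; ra ≔ fr ;;
  fx ≔ b ;; findRoot ;; rb ≔ fr ;;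
  onlyIf (.not (ra ≐ rb)) (
    .ite (rank ra ≺ rank rb)
      (uf⟦ra⟧ ≔ rb)
      (uf⟦rb⟧ ≔ ra ;;
       onlyIf (rank ra ≐ rank rb) (rank⟦ra⟧ ≔ succ (rank ra)) ;;
       rb ≔ ra)) ;;
  name⟦rb⟧ ≔ b

/-- Add the scheduling constraint from `a` to `b`. -/
def addConstraint (a b : Exp) : Cmd :=
  fsrc⟦fc⟧ ≔ a ;;
  ftgt⟦fc⟧ ≔ b ;;
  fNxt⟦fc⟧ ≔ fHd a ;;
  fc ≔ succ fc ;;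
  fHd⟦a⟧ ≔ fc ;;
  npred⟦b⟧ ≔ succ (npred b)

/-- Initialization: no exits and no constraints, `exit[z] := z`, `R[z] := ∅`; vertices are
listed by DFN and post-DFN; edges are classified as back edges (the target is an ancestor of the
source), tree edges, and cross/forward edges.  The lists `inHd` and `inNxt` receive the tree edges:
these are the edges of the graph without back edges after the removal of the cross/forward
edges. -/
def setUp : Cmd :=
  xc ≔ n ;;
  fc ≔ lit 0 ;;
  forRange v n (
    ex⟦v⟧ ≔ v ;;
    bHd⟦v⟧ ≔ lit 0 ;; cHd⟦v⟧ ≔ lit 0 ;; rHd⟦v⟧ ≔ lit 0 ;; inHd⟦v⟧ ≔ lit 0 ;;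
    fHd⟦v⟧ ≔ lit 0 ;; npred⟦v⟧ ≔ lit 0 ;;
    mark⟦v⟧ ≔ n ;; pmark⟦v⟧ ≔ n ;;
    ord⟦dfn v⟧ ≔ v ;;
    pord⟦post v⟧ ≔ v) ;;
  rHd⟦n⟧ ≔ lit 0 ;;
  forRange e m (
    u ≔ src e ;;
    v ≔ tgt e ;;
    .ite (.and (.not (dfn u ≺ dfn v)) (.not (post v ≺ post u)))
      (insertInto bHd bNxt v)
      (.ite (par v ≐ u)
        (insertInto inHd inNxt v)
        (insertInto cHd cNxt u)))

/-- `removeAllCrossForwardEdges()`: every cross/forward edge `(w, z)` is put into `R[lca(w, z)]`.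
All lowest common ancestors are found off-line with disjoint sets: the vertices `w` are visited in
order of increasing post-DFN, and a visited vertex is merged into its parent; as `z` is finished
before `w`, the current representative of `z`, its first unvisited ancestor, is
`lca(w, z)`.  The number `n` is a virtual root, the parent of the roots of all trees of the forest:
it is the lowest common ancestor of two vertices of different trees. -/
def removeAllCrossForwardEdges : Cmd :=
  makeSets ;;
  forRange j n (
    w ≔ pord j ;;
    forList cHd cNxt w (
      rep q (tgt e) ;;
      insertInto rHd rNxt q) ;;
    merge w (par w))

/-- `restoreCrossForwardEdges(h)`: every edge `(y, z)` in `R[h]` is restored as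
`(y, rep(z))`.  Since an edge keeps its number, this records in `O[rep(z)]` also the original
edge: the list of `z` in `inHd`, `inNxt` holds the numbers of the edges that currently target
`z`, while `src` and `tgt` of these numbers are the original edges, i.e. `O[z]`. -/
def restoreCrossForwardEdges : Cmd :=
  forList rHd rNxt h (
    rep q (tgt e) ;;
    insertInto inHd inNxt q)

/-- `findNestedSCCs(h)`: on exit `pl 0, …, pl (np - 1)` is `P_h` and `wl 0, …, wl (nw - 1)` is
`N_h`.  During the search `N_h` is `wl 0, …, wl (k - 1)` and the worklist `W_h` is
`wl k, …, wl (nw - 1)`; `mark z = h` means that `z` belongs to one of the two. -/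
def findNestedSCCs : Cmd :=
  np ≔ lit 0 ;;
  forList bHd bNxt h (
    rep q (src e) ;;
    onlyIf (.not (pmark q ≐ h)) (
      pmark⟦q⟧ ≔ h ;;
      pl⟦np⟧ ≔ q ;;
      np ≔ succ np)) ;;
  nw ≔ lit 0 ;;
  forRange j np (
    q ≔ pl j ;;
    onlyIf (.not (q ≐ h)) (
      mark⟦q⟧ ≔ h ;;
      wl⟦nw⟧ ≔ q ;;
      nw ≔ succ nw)) ;;
  k ≔ lit 0 ;;
  .loop (k ≺ nw) (
    v ≔ wl k ;;
    k ≔ succ k ;;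
    forList inHd inNxt v (
      rep q (src e) ;;
      onlyIf (.and (.not (mark q ≐ h)) (.not (q ≐ h))) (
        mark⟦q⟧ ≔ h ;;
        wl⟦nw⟧ ≔ q ;;
        nw ≔ succ nw)))

/-- Add the scheduling constraints `(exit[rep(y)], z)` for `(y, z)` in `O[v]`; if `lift` is true,
add also `(exit[rep(y)], v)` for the current non-back edges `(y, v)`. -/
def addConstraintsTo : Cmd :=
  forList inHd inNxt v (
    rep q (src e) ;;
    addConstraint (ex q) (tgt e)) ;;
  onlyIf (lift ≐ lit 1) (
    forList inHd inNxt v (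
      rep q (src e) ;;
      addConstraint (ex q) v))

/-- `constructWPOForSCC(h)`. -/
def constructWPOForSCC : Cmd :=
  findNestedSCCs ;;
  onlyIf (.not (np ≐ lit 0)) (
    forRange k nw (
      v ≔ wl k ;;
      addConstraintsTo) ;;
    -- a new exit
    x ≔ xc ;;
    xc ≔ succ xc ;;
    fHd⟦x⟧ ≔ lit 0 ;;
    npred⟦x⟧ ≔ lit 0 ;;
    forRange j np (
      rep q (pl j) ;;
      addConstraint (ex q) x) ;;
    nest⟦x⟧ ≔ h ;;
    ex⟦h⟧ ≔ x ;;
    forRange k nw (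
      merge (wl k) h))

/-- `connectWPOsOfMaximalSCCs()`. -/
def connectWPOsOfMaximalSCCs : Cmd :=
  forRange v n (
    rep q v ;;
    onlyIf (q ≐ v) addConstraintsTo)

/-- `ConstructWPO^BU(G, D, lift)`.  The vertices are the numbers below `n`, and the exits are the
numbers from `n` to `xc - 1`.  The edges between different trees of the forest, which are stored
at the virtual root, are restored after the loop. -/
def constructWPOBU : Cmd :=
  setUp ;;
  removeAllCrossForwardEdges ;;
  makeSets ;;
  i ≔ n ;;
  .loop (lit 0 ≺ i) (
    i ≔ pred i ;;
    h ≔ ord i ;;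
    restoreCrossForwardEdges ;;
    constructWPOForSCC) ;;
  h ≔ n ;;
  restoreCrossForwardEdges ;;
  connectWPOsOfMaximalSCCs

/-- `ConstructWTO^BU(G, D)`.  On exit `V ∪ X` consists of the numbers below `xc`; the scheduling
constraints are the pairs `(fsrc c, ftgt c)` with `c < fc` (a pair may be repeated, and is then
counted as often in `count` as in `npred`); the stabilization constraints are
`(z, nest z)` for `n ≤ z < xc`.  The register `prev` holds `0` for nil, and otherwise one more
than the previous element. -/
def constructWTOBU : Cmd :=
  lift ≔ lit 1 ;;
  constructWPOBU ;;
  sp ≔ lit 0 ;;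
  forRange v xc (
    count⟦v⟧ ≔ lit 0 ;;
    onlyIf (npred v ≐ lit 0) (
      stack⟦sp⟧ ≔ v ;;
      sp ≔ succ sp)) ;;
  prev ≔ lit 0 ;;
  .loop (lit 0 ≺ sp) (
    sp ≔ pred sp ;;
    v ≔ stack sp ;;
    onlyIf (.not (prev ≐ lit 0)) (addConstraint (pred prev) v) ;;
    prev ≔ succ v ;;
    forList fHd fNxt v (
      w ≔ ftgt e ;;
      count⟦w⟧ ≔ succ (count w) ;;
      onlyIf (count w ≐ npred w) (
        stack⟦sp⟧ ≔ w ;;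
        sp ≔ succ sp)))

end Program

/-! ### Depth-first forests -/

/-- A state of a depth-first search: the stack of open vertices, the vertices in order of
discovery, the vertices in order of finishing, and the parents. -/
structure DFSState (V : Type) where
  stack : List V
  discovered : List V
  finished : List V
  parent : V → Option V

/-- The steps of a (nondeterministic) depth-first search of a directed graph. -/
inductive DFSStep {V : Type} [DecidableEq V] (G : Digraph V) : DFSState V → DFSState V → Prop
  | root (d f : List V) (p : V → Option V) (v : V) (hv : v ∉ d) :
      DFSStep G ⟨[], d, f, p⟩ ⟨[v], d ++ [v], f, Function.update p v none⟩
  | discover (st d f : List V) (p : V → Option V) (u v : V) (huv : G.Adj u v) (hv : v ∉ d) :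
      DFSStep G ⟨u :: st, d, f, p⟩ ⟨v :: u :: st, d ++ [v], f, Function.update p v (some u)⟩
  | finish (st d f : List V) (p : V → Option V) (u : V) (hu : ∀ v, G.Adj u v → v ∈ d) :
      DFSStep G ⟨u :: st, d, f, p⟩ ⟨st, d, f ++ [u], p⟩

/-- A rooted forest on `{0, …, n - 1}` with a numbering and a post-numbering of its vertices. -/
structure NumberedForest (n : ℕ) where
  parent : Fin n → Option (Fin n)
  dfn : Fin n → ℕ
  post : Fin n → ℕ

/-- `D` is a depth-first forest of `G`: some complete depth-first search of `G` has the parents,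
the depth-first numbering and the post depth-first numbering of `D`. -/
def IsDepthFirstForest {n : ℕ} (G : Digraph (Fin n)) (D : NumberedForest n) : Prop :=
  ∃ d f : List (Fin n),
    Relation.ReflTransGen (DFSStep G) ⟨[], [], [], fun _ => none⟩ ⟨[], d, f, D.parent⟩ ∧
    (∀ v, v ∈ d) ∧
    (∀ v, D.dfn v = d.idxOf v) ∧
    (∀ v, D.post v = f.idxOf v)

/-- The list `edges` enumerates the edges of `G` without repetition. -/
def IsEdgeList {n : ℕ} (G : Digraph (Fin n)) (edges : List (Fin n × Fin n)) : Prop :=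
  edges.Nodup ∧ ∀ u v, (u, v) ∈ edges ↔ G.Adj u v

/-- The memory `s` contains the graph with edge list `edges` and the forest `D` as input; roots
have the parent `n`.  Nothing is assumed about the rest of the memory. -/
structure HoldsInput {n : ℕ} (s : Mem) (edges : List (Fin n × Fin n)) (D : NumberedForest n) :
    Prop where
  n_eq : s.reg .n = n
  m_eq : s.reg .m = edges.length
  src_eq : ∀ i : Fin edges.length, s.arr .src i = (edges.get i).1
  tgt_eq : ∀ i : Fin edges.length, s.arr .tgt i = (edges.get i).2
  par_eq : ∀ v : Fin n, s.arr .par v = ((D.parent v).map Fin.val).getD n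
  dfn_eq : ∀ v : Fin n, s.arr .dfn v = D.dfn v
  post_eq : ∀ v : Fin n, s.arr .post v = D.post v

/-- The inverse Ackermann function: the least `k` with `n ≤ ack k k`. -/
noncomputable def invAck (n : ℕ) : ℕ := sInf {k : ℕ | n ≤ ack k k}

end WTO

namespace WTO

/-! ### Frames -/

/-! The inverse Ackermann factor comes from the disjoint sets alone; everything else is a linear
count. `Run` is a total-correctness triple that measures amortized time in units of `100 * (invAck n
+ 5)` steps. One unit covers any elementary command and, amortized, one find with path compression
or one link. It remains to show that the program uses `O(n + m)` units.

Disjoint sets. Let `L = invAck n + 4`, so that `ack L 1` exceeds the number `n + 1` of nodes. A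
non-root with `a = rank + 1`, whose parent has `b = rank + 1`, holds one credit for each pair `(k,
i)` with `k < L`, `1 ≤ i ≤ a + 1` and `b < (ack k)^[i] a`. Its level is the largest `k < L` with
`ack k a ≤ b`. When a path is compressed, a node followed by another node of the same level loses a
pair (`nodePot_lt`). Hence all but one node per level pay for themselves, and a find has amortized
cost `O(L)` (`IsForest.compress_pot`). A link raises the potential by at most `L`
(`forestPot_link`).

Phase 1. A ghost function `loc` tells for every edge the one list that holds it, and `edgeWeight` is
what an edge in that list may still have to pay. A vertex of `N_h` is a representative before `h` is
processed and is none afterwards, so scanning its list is paid by a drop of `activity`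
(`activity_drop`, `sum_edgeWeight_drop`, `run_mainLoop`). Cross/forward edges pay a constant for
each of their two moves.

Phase 2. There are at most `n` exits, and the number of constraints is bounded by the units spent on
creating them. Every element is popped at most once and every constraint of phase 1 is counted at
most once. The constraints added during the traversal start at elements that have already been
popped, so they are never scanned (`run_traverse`). -/

@[simp] theorem Mem.setReg_reg (s : Mem) (z y : Reg) (c : ℕ) :
    (s.setReg z c).reg y = if y = z then c else s.reg y := by
  simp [Mem.setReg, Function.update_apply]

@[simp] theorem Mem.setReg_arr (s : Mem) (z : Reg) (c : ℕ) : (s.setReg z c).arr = s.arr := rfl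

@[simp] theorem Mem.setArr_reg (s : Mem) (a : Arr) (i c : ℕ) : (s.setArr a i c).reg = s.reg := rfl

@[simp] theorem Mem.setArr_arr (s : Mem) (a b : Arr) (i c : ℕ) :
    (s.setArr a i c).arr b = if b = a then Function.update (s.arr a) i c else s.arr b := by
  simp [Mem.setArr, Function.update_apply]

attribute [simp] Exp.eval Test.Holds

/-- The program may assign to the register. -/
def Cmd.modR : Cmd → Reg → Bool
  | .skip, _ => false
  | .set z _, y => z = y
  | .store _ _ _, _ => false
  | .seq c d, y => c.modR y || d.modR y
  | .ite _ c d, y => c.modR y || d.modR y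
  | .loop _ c, y => c.modR y

/-- The program may assign to the array. -/
def Cmd.modA : Cmd → Arr → Bool
  | .skip, _ => false
  | .set _ _, _ => false
  | .store a _ _, b => a = b
  | .seq c d, y => c.modA y || d.modA y
  | .ite _ c d, y => c.modA y || d.modA y
  | .loop _ c, y => c.modA y

/-- The memories agree outside the given registers and arrays. -/
structure Agree (R : Reg → Bool) (A : Arr → Bool) (s s' : Mem) : Prop where
  reg : ∀ z, R z = false → s'.reg z = s.reg z
  arr : ∀ a, A a = false → s'.arr a = s.arr a

theorem Agree.refl (R A) (s : Mem) : Agree R A s s := ⟨fun _ _ => rfl, fun _ _ => rfl⟩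

theorem Agree.trans {R A} {s s' s'' : Mem} (h : Agree R A s s') (h' : Agree R A s' s'') :
    Agree R A s s'' :=
  ⟨fun z hz => (h'.reg z hz).trans (h.reg z hz), fun a ha => (h'.arr a ha).trans (h.arr a ha)⟩

theorem Agree.weaken {R A R' A'} {s s' : Mem} (h : Agree R A s s')
    (hR : ∀ z, R' z = false → R z = false) (hA : ∀ a, A' a = false → A a = false) :
    Agree R' A' s s' :=
  ⟨fun z hz => h.reg z (hR z hz), fun a ha => h.arr a (hA a ha)⟩

theorem Agree.setReg {R A} {s s' : Mem} (h : Agree R A s s') {z : Reg} {c : ℕ} (hz : R z = true) :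
    Agree R A s (s'.setReg z c) := by
  refine ⟨fun y hy => ?_, fun a ha => by simpa using h.arr a ha⟩
  have : y ≠ z := by rintro rfl; simp [hz] at hy
  simpa [this] using h.reg y hy

theorem Agree.setArr {R A} {s s' : Mem} (h : Agree R A s s') {a : Arr} {i c : ℕ}
    (ha : A a = true) : Agree R A s (s'.setArr a i c) := by
  refine ⟨fun y hy => by simpa using h.reg y hy, fun b hb => ?_⟩
  have : b ≠ a := by rintro rfl; simp [ha] at hb
  simpa [this] using h.arr b hb

/-- The frame rule. Write sets are computed syntactically, so later side conditions on untouched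
registers and arrays hold by `rfl` or `decide`. -/
theorem Exec.agree {c : Cmd} {s s' : Mem} {t : ℕ} (h : Exec c s t s') :
    Agree c.modR c.modA s s' := by
  induction h with
  | skip => exact .refl _ _ _
  | set z e s => exact (Agree.refl _ _ s).setReg (by simp [Cmd.modR])
  | store a i e s => exact (Agree.refl _ _ s).setArr (by simp [Cmd.modA])
  | seq _ _ ih₁ ih₂ =>
    exact (ih₁.weaken (by simp +contextual [Cmd.modR]) (by simp +contextual [Cmd.modA])).trans
      (ih₂.weaken (by simp +contextual [Cmd.modR]) (by simp +contextual [Cmd.modA]))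
  | ite_true _ _ ih =>
    exact ih.weaken (by simp +contextual [Cmd.modR]) (by simp +contextual [Cmd.modA])
  | ite_false _ _ ih =>
    exact ih.weaken (by simp +contextual [Cmd.modR]) (by simp +contextual [Cmd.modA])
  | loop_false => exact .refl _ _ _
  | loop_true _ _ _ ih₁ ih₂ =>
    exact (ih₁.weaken (by simp [Cmd.modR]) (by simp [Cmd.modA])).trans ih₂

/-- The program changes nothing outside its write set. -/
abbrev Cmd.Frame (c : Cmd) (s s' : Mem) : Prop := Agree c.modR c.modA s s'

theorem Cmd.Frame.seq_left {c : Cmd} {s s' : Mem} (h : c.Frame s s') (d : Cmd) :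
    (Cmd.seq c d).Frame s s' :=
  h.weaken (by simp +contextual [Cmd.modR]) (by simp +contextual [Cmd.modA])

theorem Cmd.Frame.seq_right {d : Cmd} {s s' : Mem} (h : d.Frame s s') (c : Cmd) :
    (Cmd.seq c d).Frame s s' :=
  h.weaken (by simp +contextual [Cmd.modR]) (by simp +contextual [Cmd.modA])

theorem Cmd.Frame.forList {d : Cmd} {s s' : Mem} (h : d.Frame s s') (hd nxt : Arr) (a : Exp) :
    (forList hd nxt a d).Frame s s' :=
  h.weaken (by simp +contextual [WTO.forList, Cmd.modR])
    (by simp +contextual [WTO.forList, Cmd.modA])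

/-! ### Amortized execution -/

/-- A potential of the disjoint-set forest, and the number of steps in a unit of amortized time. -/
structure Amortization where
  pot : (ℕ → ℕ) → (ℕ → ℕ) → ℕ
  unit : ℕ
  le_unit : 20 ≤ unit

/-- The program `c` halts when started in `s`; its amortized time (in units) is at most some `u`
and its result is some `s'` with `Q u s'`. -/
def Run (A : Amortization) (c : Cmd) (s : Mem) (Q : ℕ → Mem → Prop) : Prop :=
  ∃ u s' t, Exec c s t s' ∧
    t + A.pot (s'.arr .uf) (s'.arr .rank) ≤ A.pot (s.arr .uf) (s.arr .rank) + A.unit * u ∧ Q u s'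

namespace Run

variable {A : Amortization} {c d : Cmd} {s : Mem} {Q Q' : ℕ → Mem → Prop}

theorem imp (h : Run A c s Q) (hQ : ∀ u s', Q u s' → c.Frame s s' → Q' u s') : Run A c s Q' := by
  obtain ⟨u, s', t, hx, ht, hq⟩ := h
  exact ⟨u, s', t, hx, ht, hQ u s' hq hx.agree⟩

/-- The potential in the intermediate memory cancels, so amortized times add up. -/
theorem seq (h : Run A c s fun u s' => Run A d s' fun u' => Q (u + u')) :
    Run A (.seq c d) s Q := by
  obtain ⟨u, s', t, hx, ht, u', s'', t', hx', ht', hq⟩ := h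
  exact ⟨u + u', s'', t + t', hx.seq hx', by rw [mul_add]; omega, hq⟩

theorem bind (h : Run A c s Q)
    (h' : ∀ u s', Q u s' → c.Frame s s' → Run A d s' fun u' => Q' (u + u')) :
    Run A (.seq c d) s Q' :=
  (h.imp h').seq

theorem skip (h : Q 1 s) : Run A .skip s Q :=
  ⟨1, s, 1, .skip s, by have := A.le_unit; omega, h⟩

theorem set {z : Reg} {e : Exp} (he : e.cost < 20) (h : Q 1 (s.setReg z (e.eval s))) :
    Run A (.set z e) s Q :=
  ⟨1, _, _, .set z e s, by have := A.le_unit; simp; omega, h⟩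

theorem set_seq {z : Reg} {e : Exp} (he : e.cost < 20)
    (h : Run A c (s.setReg z (e.eval s)) fun u => Q (1 + u)) :
    Run A (.seq (.set z e) c) s Q :=
  seq (set he h)

/-- The potential depends only on `uf` and `rank`, so a store elsewhere costs one unit. Stores into
these two arrays need the separate rules for disjoint sets. -/
theorem store {a : Arr} {i e : Exp} (ha : a ≠ .uf ∧ a ≠ .rank) (he : i.cost + e.cost < 20)
    (h : Q 1 (s.setArr a (i.eval s) (e.eval s))) : Run A (.store a i e) s Q :=
  ⟨1, _, _, .store a i e s, by have := A.le_unit; simp [ha.1.symm, ha.2.symm]; omega, h⟩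

theorem store_seq {a : Arr} {i e : Exp} (ha : a ≠ .uf ∧ a ≠ .rank) (he : i.cost + e.cost < 20)
    (h : Run A c (s.setArr a (i.eval s) (e.eval s)) fun u => Q (1 + u)) :
    Run A (.seq (.store a i e) c) s Q :=
  seq (store ha he h)

theorem ite {b : Test} (hb : b.cost < 20)
    (h₁ : b.Holds s → Run A c s fun u => Q (1 + u))
    (h₂ : ¬ b.Holds s → Run A d s fun u => Q (1 + u)) : Run A (.ite b c d) s Q := by
  have := A.le_unit
  by_cases h : b.Holds s
  · obtain ⟨u, s', t, hx, ht, hq⟩ := h₁ h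
    exact ⟨1 + u, s', _, .ite_true h hx, by rw [mul_add]; omega, hq⟩
  · obtain ⟨u, s', t, hx, ht, hq⟩ := h₂ h
    exact ⟨1 + u, s', _, .ite_false h hx, by rw [mul_add]; omega, hq⟩

theorem onlyIf {b : Test} (hb : b.cost < 20)
    (h₁ : b.Holds s → Run A c s fun u => Q (1 + u))
    (h₂ : ¬ b.Holds s → Q 2 s) : Run A (onlyIf b c) s Q :=
  ite hb h₁ fun h => skip (h₂ h)

/-- The invariant speaks of the time since the loop was entered, whereas a recursive call sees only
its own time. The equation `u + u' = u'' + 1` links the two; the `1` is the last, failing test. -/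
theorem loop_aux {b : Test} (hb : b.cost < 20) (I : ℕ → ℕ → Mem → Prop)
    (step : ∀ k u s, I k u s → b.Holds s →
      Run A c s fun u' s' => ∃ k' < k, I k' (u + (1 + u')) s') :
    ∀ k u s, I k u s →
      Run A (.loop b c) s fun u' s' => ∃ k' u'', I k' u'' s' ∧ ¬ b.Holds s' ∧ u + u' = u'' + 1 := by
  have := A.le_unit
  intro k
  induction k using Nat.strong_induction_on with
  | _ k ih =>
    intro u s hI
    by_cases h : b.Holds s
    · obtain ⟨u₁, s₁, t₁, hx₁, ht₁, k', hk', hI'⟩ := step k u s hI h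
      obtain ⟨u₂, s₂, t₂, hx₂, ht₂, k₂, u'', h₁, h₂, h₃⟩ := ih k' hk' _ _ hI'
      exact ⟨1 + u₁ + u₂, s₂, _, .loop_true h hx₁ hx₂, by rw [mul_add, mul_add]; omega,
        k₂, u'', h₁, h₂, by omega⟩
    · exact ⟨1, s, _, .loop_false h, by omega, k, u, hI, h, rfl⟩

/-- Total correctness of a loop with invariant `I`; the first argument of `I` decreases, and the
second is the amortized time so far. -/
theorem loop {b : Test} (hb : b.cost < 20) (I : ℕ → ℕ → Mem → Prop) {k₀ : ℕ} (h₀ : I k₀ 0 s)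
    (step : ∀ k u s, I k u s → b.Holds s →
      Run A c s fun u' s' => ∃ k' < k, I k' (u + (1 + u')) s')
    (final : ∀ k u s, I k u s → ¬ b.Holds s → Q (u + 1) s) : Run A (.loop b c) s Q :=
  (loop_aux hb I step k₀ 0 s h₀).imp fun u' s' ⟨k', u'', h₁, h₂, h₃⟩ _ => by
    rw [show u' = u'' + 1 by omega]; exact final k' u'' s' h₁ h₂

/-- The rule `Run.loop` with the frame of the loop. -/
theorem loop_frame {b : Test} (hb : b.cost < 20) (I : ℕ → ℕ → Mem → Prop) {k₀ : ℕ} (h₀ : I k₀ 0 s)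
    (step : ∀ k u s', (Cmd.loop b c).Frame s s' → I k u s' → b.Holds s' →
      Run A c s' fun u' s'' => ∃ k' < k, I k' (u + (1 + u')) s'')
    (final : ∀ k u s', (Cmd.loop b c).Frame s s' → I k u s' → ¬ b.Holds s' → Q (u + 1) s') :
    Run A (.loop b c) s Q :=
  loop hb (fun k u s' => (Cmd.loop b c).Frame s s' ∧ I k u s') ⟨.refl _ _ _, h₀⟩
    (fun k u s' ⟨hF, hI⟩ hb => (step k u s' hF hI hb).imp fun _ _ ⟨k', hk', hI'⟩ hf =>
      ⟨k', hk', hF.trans hf, hI'⟩)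
    fun k u s' ⟨hF, hI⟩ hb => final k u s' hF hI hb

/-- Total correctness of `forRange`: the invariant `I` is indexed by the value of the counter
and the amortized time so far. -/
theorem forRange {z : Reg} {bound : Exp} {body : Cmd} {s₀ : Mem} (B : ℕ)
    (I : ℕ → ℕ → Mem → Prop) (hb : bound.cost < 18) (hz : body.modR z = false)
    (hB : ∀ s, (WTO.forRange z bound body).Frame s₀ s → bound.eval s = B)
    (h₀ : I 0 1 (s₀.setReg z 0))
    -- The two extra units are the test and the increment of the counter.
    (step : ∀ k u s, (WTO.forRange z bound body).Frame s₀ s → I k u s → s.reg z = k → k < B →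
      Run A body s fun u' s' => I (k + 1) (u + u' + 2) (s'.setReg z (k + 1)))
    (final : ∀ u s, (WTO.forRange z bound body).Frame s₀ s → I B u s → s.reg z = B →
      Q (u + 1) s) : Run A (WTO.forRange z bound body) s₀ Q := by
  have hF : (WTO.forRange z bound body).Frame s₀ s₀ := .refl _ _ _
  refine set_seq (by decide) ?_
  refine loop (by simp [Test.cost, Exp.cost]; omega)
    (fun k u s => ∃ i ≤ B, (WTO.forRange z bound body).Frame s₀ s ∧ I i (u + 1) s ∧ k = B - i ∧
      s.reg z = i) (k₀ := B)
    ⟨0, by omega, hF.setReg (by simp [WTO.forRange, Cmd.modR]), h₀, by simp, by simp⟩ ?_ ?_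
  · rintro k u s ⟨i, hiB, hF, hI, rfl, hi⟩ hlt
    have := hB s hF
    simp only [Test.Holds, Exp.eval, hi, this] at hlt
    refine bind (step i _ s hF hI hi hlt) fun u' s' hI' hf => set (by simp [Exp.cost]) ?_
    have : s'.reg z = i := by rw [hf.reg z hz, hi]
    refine ⟨B - (i + 1), by omega, i + 1, hlt, ?_, ?_, rfl, by simp [this]⟩
    · exact (hF.trans (hf.weaken (by simp +contextual [WTO.forRange, Cmd.modR])
        (by simp +contextual [WTO.forRange, Cmd.modA]))).setReg
          (by simp [WTO.forRange, Cmd.modR])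
    · simp only [Exp.eval, this]
      convert hI' using 1
      omega
  · rintro k u s ⟨i, hiB, hF, hI, rfl, hi⟩ hlt
    have := hB s hF
    simp only [Test.Holds, Exp.eval, hi, this] at hlt
    obtain rfl : i = B := by omega
    rw [add_comm 1]
    exact final _ _ hF hI hi

end Run

/-! ### The potential of a disjoint-set forest -/

/-- The potential of a non-root of rank `a` whose parent has rank `b`. -/
def nodePot (L a b : ℕ) : ℕ :=
  -- A pair `(k, i)` is counted as long as `i` steps of `ack k` from `a` lead beyond `b`; it is lost
  -- for good once the parent's rank has caught up.
  ((Finset.range L ×ˢ Finset.Icc 1 (a + 1)).filter fun q => b < (ack q.1)^[q.2] a).card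

theorem nodePot_le (L a b : ℕ) : nodePot L a b ≤ L * (a + 1) :=
  (Finset.card_filter_le _ _).trans (by simp)

/-- The parent's rank only grows, under compression as well as under linking, so a non-root never
gains potential. -/
theorem nodePot_anti (L a : ℕ) {b b' : ℕ} (h : b ≤ b') : nodePot L a b' ≤ nodePot L a b :=
  Finset.card_le_card fun q hq => by
    simp only [Finset.mem_filter] at hq ⊢
    exact ⟨hq.1, lt_of_le_of_lt h hq.2⟩

/-- This explains the range of `i` in `nodePot`: for `a ≥ 1`, `a + 1` steps of one level from `a`
reach at least the value of the next level at `a`. -/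
theorem ack_succ_eq_iterate (k a : ℕ) : ack (k + 1) a = (ack k)^[a + 1] 1 := by
  induction a with
  | zero => simp
  | succ a ih => rw [ack_succ_succ, ih, ← Function.iterate_succ_apply' (ack k) (a + 1) 1]

/-- The largest level `k` with `ack k a ≤ b`. -/
def level (L a b : ℕ) : ℕ := Nat.findGreatest (fun k => ack k a ≤ b) (L - 1)

theorem level_lt {L : ℕ} (hL : 0 < L) (a b : ℕ) : level L a b < L :=
  lt_of_le_of_lt (Nat.findGreatest_le _) (by omega)

theorem ack_level_le {L a b : ℕ} (h : a < b) : ack (level L a b) a ≤ b :=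
  Nat.findGreatest_spec (P := fun k => ack k a ≤ b) (m := 0) (Nat.zero_le _) (by simpa using h)

theorem lt_ack_level_succ {L a b : ℕ} (hb : b < ack L a) : b < ack (level L a b + 1) a := by
  by_contra! hle
  by_cases h : level L a b + 1 ≤ L - 1
  · exact Nat.findGreatest_is_greatest (P := fun k => ack k a ≤ b) (Nat.lt_succ_self _) h hle
  · have : ack L a ≤ ack (level L a b + 1) a := ack_mono_left a (by omega)
    omega

/-- A node pays for its own visit if a later node of the path has the same level. -/
theorem nodePot_lt {L a b c d r : ℕ} (ha : 1 ≤ a) (hab : a < b) (hbc : b ≤ c) (hcd : c < d)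
    (hdr : d ≤ r) (hr : r < ack L 1) (hlev : level L a b = level L c d) :
    nodePot L a r < nodePot L a b := by
  set k := level L a b with hk
  have hL : 0 < L := Nat.pos_of_ne_zero (by rintro rfl; simp at hr; omega)
  have hb : b < ack (k + 1) a :=
    lt_ack_level_succ (by have := ack_mono_right L ha; omega)
  have hd : ack k c ≤ d := by rw [hlev]; exact ack_level_le hcd
  set f := ack k
  have hmono : StrictMono f := ack_strictMono_right k
  -- The iteration in `ack_succ_eq_iterate` starts at `1`; since `1 ≤ a` it may start at `a`
  -- instead. This is why ranks are shifted by one.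
  have htop : b < f^[a + 1] a := by
    rw [ack_succ_eq_iterate] at hb
    exact lt_of_lt_of_le hb (hmono.monotone.iterate _ ha)
  -- `i` is the number of steps of `ack k` from `a` that stay within `b`.
  obtain ⟨i, hi, hle, hlt⟩ : ∃ i ≤ a, f^[i] a ≤ b ∧ b < f^[i + 1] a := by
    by_contra! hcon
    have : ∀ i ≤ a + 1, f^[i] a ≤ b := by
      intro i hi
      induction i with
      | zero => simpa using hab.le
      | succ i ih => exact hcon i (by omega) (ih (by omega))
    have := this (a + 1) le_rfl
    omega
  refine Finset.card_lt_card (Finset.ssubset_iff_subset_ne.2 ⟨fun q hq => ?_, fun heq => ?_⟩)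
  · simp only [Finset.mem_filter] at hq ⊢
    exact ⟨hq.1, by omega⟩
  -- The pair `(k, i + 1)` is lost: the later node has `ack k c ≤ d`, and `f^[i] a ≤ b ≤ c`, so
  -- `f^[i + 1] a ≤ d ≤ r`.
  · have hmem : (k, i + 1) ∈ (Finset.range L ×ˢ Finset.Icc 1 (a + 1)).filter
        fun q => b < (ack q.1)^[q.2] a := by
      simp only [Finset.mem_filter, Finset.mem_product, Finset.mem_range, Finset.mem_Icc]
      exact ⟨⟨level_lt hL _ _, by omega, by omega⟩, hlt⟩
    rw [← heq] at hmem
    have h1 := (Finset.mem_filter.1 hmem).2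
    simp only [Function.iterate_succ_apply'] at h1
    have : f (f^[i] a) ≤ f c := hmono.monotone (hle.trans hbc)
    change r < f (f^[i] a) at h1
    omega

/-- The nodes below the root `r` on the path that starts at a node. -/
def IsPath (uf : ℕ → ℕ) (r : ℕ) : ℕ → List ℕ → Prop
  | x, [] => x = r ∧ uf r = r
  | x, y :: l => y = x ∧ uf x ≠ x ∧ IsPath uf r (uf x) l

/-- A forest on the nodes below `N`, given by parent pointers, with its ranks and its roots. -/
structure IsForest (N : ℕ) (uf rank root : ℕ → ℕ) : Prop where
  uf_lt : ∀ x < N, uf x < N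
  rank_lt : ∀ x < N, uf x ≠ x → rank x < rank (uf x)
  root_lt : ∀ x < N, root x < N
  uf_root : ∀ x < N, uf (root x) = root x
  root_uf : ∀ x < N, root (uf x) = root x
  root_eq : ∀ x < N, uf x = x → root x = x
  -- A crude substitute for the logarithmic bound on ranks: a link raises a rank by at most one and
  -- removes one root. Ranks below `N` are all that the Ackermann argument needs.
  rank_le : ∀ x < N, rank x + ((Finset.range N).filter fun y => uf y = y).card ≤ N

namespace IsForest

variable {N : ℕ} {uf rank root : ℕ → ℕ}

theorem rank_lt_card (h : IsForest N uf rank root) {x : ℕ} (hx : x < N) : rank x < N := by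
  have h1 := h.rank_le x hx
  have : 0 < ((Finset.range N).filter fun y => uf y = y).card :=
    Finset.card_pos.2 ⟨root x, by simp [h.root_lt x hx, h.uf_root x hx]⟩
  omega

/-- Ranks increase strictly towards the root and stay below `N`, so climbing ends. -/
theorem exists_path (h : IsForest N uf rank root) {x : ℕ} (hx : x < N) :
    ∃ l, IsPath uf (root x) x l := by
  induction hk : N - rank x using Nat.strong_induction_on generalizing x with
  | _ k ih =>
    by_cases hu : uf x = x
    · have := h.root_eq x hx hu
      exact ⟨[], this.symm, by rw [this, hu]⟩
    · have h1 := h.rank_lt x hx hu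
      have h2 := h.rank_lt_card hx
      obtain ⟨l, hl⟩ := ih _ (by omega) (h.uf_lt x hx) rfl
      rw [h.root_uf x hx] at hl
      exact ⟨x :: l, rfl, hu, hl⟩

theorem path_mem (h : IsForest N uf rank root) {r : ℕ} {l : List ℕ} {x : ℕ} (hx : x < N)
    (hl : IsPath uf r x l) : r < N ∧ rank x ≤ rank r ∧ root x = r ∧ uf r = r ∧
      ∀ y ∈ l, y < N ∧ rank x ≤ rank y ∧ rank (uf y) ≤ rank r ∧ root y = r ∧ uf y ≠ y := by
  induction l generalizing x with
  | nil =>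
    obtain ⟨rfl, hr⟩ := hl
    exact ⟨hx, le_rfl, h.root_eq x hx hr, hr, by simp⟩
  | cons y l ih =>
    obtain ⟨rfl, hu, hl⟩ := hl
    obtain ⟨h1, h2, h3, h4, h5⟩ := ih (h.uf_lt y hx) hl
    have h6 := h.rank_lt y hx hu
    rw [h.root_uf y hx] at h3
    refine ⟨h1, by omega, h3, h4, fun z hz => ?_⟩
    rcases List.mem_cons.1 hz with rfl | hz
    · exact ⟨hx, le_rfl, h2, h3, hu⟩
    · obtain ⟨a, b, c⟩ := h5 z hz
      exact ⟨a, by omega, c⟩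

theorem path_nodup (h : IsForest N uf rank root) {r : ℕ} {l : List ℕ} {x : ℕ} (hx : x < N)
    (hl : IsPath uf r x l) : l.Nodup := by
  induction l generalizing x with
  | nil => simp
  | cons y l ih =>
    obtain ⟨rfl, hu, hl⟩ := hl
    refine List.nodup_cons.2 ⟨fun hy => ?_, ih (h.uf_lt y hx) hl⟩
    have h1 := ((h.path_mem (h.uf_lt y hx) hl).2.2.2.2 y hy).2.1
    have := h.rank_lt y hx hu
    omega

/-- The potentials on a path pay for its compression up to the number of levels. -/
theorem path_pot (h : IsForest N uf rank root) {L r : ℕ} (hN : N < ack L 1) {l : List ℕ} {x : ℕ}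
    (hx : x < N) (hl : IsPath uf r x l) :
    (l.map fun y => nodePot L (rank y + 1) (rank r + 1)).sum + l.length ≤
      (l.map fun y => nodePot L (rank y + 1) (rank (uf y) + 1)).sum +
        (l.map fun y => level L (rank y + 1) (rank (uf y) + 1)).toFinset.card := by
  induction l generalizing x with
  | nil => simp
  | cons y l ih =>
    obtain ⟨rfl, hu, hl⟩ := hl
    have hr := h.path_mem (h.uf_lt y hx) hl
    have h1 := ih (h.uf_lt y hx) hl
    have h2 := h.rank_lt y hx hu
    have h3 : nodePot L (rank y + 1) (rank r + 1) ≤ nodePot L (rank y + 1) (rank (uf y) + 1) :=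
      nodePot_anti _ _ (by omega)
    simp only [List.map_cons, List.sum_cons, List.length_cons, List.toFinset_cons]
    -- If the level of `y` recurs further up, `y` pays for itself by `nodePot_lt`; otherwise it
    -- contributes a new level to the count on the right.
    by_cases hmem : level L (rank y + 1) (rank (uf y) + 1) ∈
        (l.map fun y => level L (rank y + 1) (rank (uf y) + 1)).toFinset
    · rw [Finset.insert_eq_of_mem hmem]
      obtain ⟨z, hz, hlev⟩ := List.mem_map.1 (List.mem_toFinset.1 hmem)
      obtain ⟨z1, z2, z3, -, z5⟩ := hr.2.2.2.2 z hz
      have := h.rank_lt z z1 z5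
      have hrr := h.rank_lt_card hr.1
      have : nodePot L (rank y + 1) (rank r + 1) < nodePot L (rank y + 1) (rank (uf y) + 1) :=
        nodePot_lt (c := rank z + 1) (d := rank (uf z) + 1) (by omega) (by omega) (by omega)
          (by omega) (by omega) (by omega) hlev.symm
      omega
    · rw [Finset.card_insert_of_notMem hmem]
      omega

end IsForest

/-- The potential of a disjoint-set forest. -/
def forestPot (L N : ℕ) (uf rank : ℕ → ℕ) : ℕ :=
  ∑ x ∈ Finset.range N,
    -- A root holds the maximum `nodePot_le` allows for its rank, so nothing has to be added when it
    -- becomes a non-root.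
    if uf x = x then L * (rank x + 2) else nodePot L (rank x + 1) (rank (uf x) + 1)

/-- Path compression. -/
def compress (uf : ℕ → ℕ) (r : ℕ) (l : List ℕ) : ℕ → ℕ := fun y => if y ∈ l then r else uf y

namespace IsForest

variable {N : ℕ} {uf rank root : ℕ → ℕ}

theorem compress_pot (h : IsForest N uf rank root) {L r : ℕ} (hL : 0 < L) (hN : N < ack L 1) {l : List ℕ}
    {x : ℕ} (hx : x < N) (hl : IsPath uf r x l) :
    forestPot L N (compress uf r l) rank + l.length ≤ forestPot L N uf rank + L := by
  have hp := h.path_mem hx hl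
  have hnd := h.path_nodup hx hl
  have h1 := h.path_pot hN hx hl
  have h2 : (l.map fun y => level L (rank y + 1) (rank (uf y) + 1)).toFinset.card ≤ L := by
    refine (Finset.card_le_card (t := Finset.range L) fun k hk => ?_).trans (by simp)
    obtain ⟨z, -, rfl⟩ := List.mem_map.1 (List.mem_toFinset.1 hk)
    simpa using level_lt hL _ _
  have hsub : l.toFinset ⊆ Finset.range N := fun y hy => by
    simpa using (hp.2.2.2.2 y (List.mem_toFinset.1 hy)).1
  have hs : ∀ g : ℕ → ℕ, (l.map g).sum = ∑ y ∈ l.toFinset, g y := fun g =>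
    (List.sum_toFinset g hnd).symm
  unfold forestPot
  rw [← Finset.sum_sdiff hsub, ← Finset.sum_sdiff hsub]
  rw [hs, hs] at h1
  have e1 : ∀ x ∈ Finset.range N \ l.toFinset, (if compress uf r l x = x then L * (rank x + 2)
      else nodePot L (rank x + 1) (rank (compress uf r l x) + 1)) = if uf x = x then
      L * (rank x + 2) else nodePot L (rank x + 1) (rank (uf x) + 1) := fun x hx => by
    have : x ∉ l := by simpa using (Finset.mem_sdiff.1 hx).2
    simp [compress, this]
  have e2 : ∀ x ∈ l.toFinset, (if compress uf r l x = x then L * (rank x + 2)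
      else nodePot L (rank x + 1) (rank (compress uf r l x) + 1)) =
      nodePot L (rank x + 1) (rank r + 1) := fun x hx => by
    have hx := List.mem_toFinset.1 hx
    have : r ≠ x := by rintro rfl; exact (hp.2.2.2.2 r hx).2.2.2.2 hp.2.2.2.1
    simp [compress, hx, this]
  have e3 : ∀ x ∈ l.toFinset, (if uf x = x then L * (rank x + 2)
      else nodePot L (rank x + 1) (rank (uf x) + 1)) =
      nodePot L (rank x + 1) (rank (uf x) + 1) := fun x hx => by
    simp [(hp.2.2.2.2 x (List.mem_toFinset.1 hx)).2.2.2.2]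
  rw [Finset.sum_congr rfl e1, Finset.sum_congr rfl e2, Finset.sum_congr rfl e3]
  omega

theorem compress (h : IsForest N uf rank root) {r : ℕ} {l : List ℕ} {x : ℕ} (hx : x < N)
    (hl : IsPath uf r x l) : IsForest N (compress uf r l) rank root := by
  obtain ⟨h1, -, h3, h4, h5⟩ := h.path_mem hx hl
  have hrr := h.root_eq r h1 h4
  have hnot : ∀ y, WTO.compress uf r l y = y ↔ uf y = y := fun y => by
    unfold WTO.compress
    split_ifs with hy
    · have := (h5 y hy).2.2.2.2
      simp only [this, iff_false]
      rintro rfl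
      exact this h4
    · rfl
  refine ⟨fun y hy => ?_, fun y hy hne => ?_, h.root_lt, fun y hy => ?_, fun y hy => ?_,
    fun y hy hu => h.root_eq y hy ((hnot y).1 hu), fun y hy => ?_⟩
  · unfold WTO.compress; split_ifs
    exacts [h1, h.uf_lt y hy]
  · rw [Ne, hnot] at hne
    have := h.rank_lt y hy hne
    unfold WTO.compress; split_ifs with hm
    · have := h5 y hm; omega
    · exact this
  · rw [hnot]; exact h.uf_root y hy
  · unfold WTO.compress; split_ifs with hm
    · rw [hrr, (h5 y hm).2.2.2.1]
    · exact h.root_uf y hy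
  · simpa only [hnot] using h.rank_le y hy

/-- Linking a root to another root of at least its rank, whose rank is increased to `c` if
necessary. -/
theorem link (h : IsForest N uf rank root) {a b c : ℕ} (ha : a < N) (hb : b < N)
    (hua : uf a = a) (hub : uf b = b) (hab : a ≠ b) (hc : rank a < c) (hbc : rank b ≤ c)
    (hcb : c ≤ rank b + 1) :
    IsForest N (Function.update uf a b) (Function.update rank b c)
      (fun x => if root x = a then b else root x) := by
  have hra := h.root_eq a ha hua
  have hrb := h.root_eq b hb hub
  have hnot : ∀ y, Function.update uf a b y = y ↔ uf y = y ∧ y ≠ a := fun y => by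
    by_cases hy : y = a
    · subst hy; simp [hab.symm]
    · simp [hy]
  -- One root disappears, which makes room for the new rank `c ≤ rank b + 1` in `rank_le`.
  have hcard : ((Finset.range N).filter fun y => Function.update uf a b y = y).card + 1 =
      ((Finset.range N).filter fun y => uf y = y).card := by
    rw [← Finset.card_erase_add_one (a := a) (s := (Finset.range N).filter fun y => uf y = y)
      (by simp [ha, hua])]
    congr 2
    ext y
    simp only [Finset.mem_filter, Finset.mem_erase, hnot]
    tauto
  refine ⟨fun y hy => ?_, fun y hy hne => ?_, fun y hy => ?_, fun y hy => ?_, fun y hy => ?_,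
    fun y hy hu => ?_, fun y hy => ?_⟩
  · by_cases hya : y = a
    · subst hya; simpa using hb
    · simpa [hya] using h.uf_lt y hy
  · by_cases hya : y = a
    · subst hya; simpa [hab] using hc
    · rw [Function.update_of_ne hya] at hne ⊢
      have hyb : y ≠ b := by rintro rfl; exact hne hub
      have := h.rank_lt y hy hne
      rw [Function.update_of_ne hyb]
      by_cases hy' : uf y = b
      · rw [hy'] at this ⊢; simp; omega
      · simpa [hy'] using this
  · split_ifs
    exacts [hb, h.root_lt y hy]
  · rw [hnot]; split_ifs with hy'
    exacts [⟨hub, hab.symm⟩, ⟨h.uf_root y hy, hy'⟩]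
  · by_cases hya : y = a
    · subst hya; simp [hra, hrb, hab.symm]
    · simp [hya, h.root_uf y hy]
  · rw [hnot] at hu
    simp [h.root_eq y hy hu.1, hu.2]
  · have h1 := h.rank_le y hy
    have h2 := h.rank_le b hb
    by_cases hyb : y = b
    · subst hyb; simp; omega
    · rw [Function.update_of_ne hyb]; omega

/-- Only the root `b` can gain, and its rank grows by at most one, which costs `L`. The root `a` was
charged in advance, and all other nodes see parents of no smaller rank. -/
theorem _root_.WTO.forestPot_link {L a b c : ℕ} (hb : b < N)
    (hua : uf a = a) (hub : uf b = b) (hab : a ≠ b) (hbc : rank b ≤ c) (hcb : c ≤ rank b + 1) :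
    forestPot L N (Function.update uf a b) (Function.update rank b c) ≤
      forestPot L N uf rank + L := by
  have hb' : b ∈ Finset.range N := by simpa using hb
  unfold forestPot
  rw [← Finset.add_sum_erase _ _ hb', ← Finset.add_sum_erase _ _ hb']
  have h1 : ∀ x ∈ (Finset.range N).erase b, (if Function.update uf a b x = x then
      L * (Function.update rank b c x + 2) else
      nodePot L (Function.update rank b c x + 1)
        (Function.update rank b c (Function.update uf a b x) + 1)) ≤
      if uf x = x then L * (rank x + 2) else nodePot L (rank x + 1) (rank (uf x) + 1) := by
    intro x hx
    have hxb : x ≠ b := (Finset.mem_erase.1 hx).1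
    rw [Function.update_of_ne hxb]
    by_cases hxa : x = a
    · subst hxa
      simp only [Function.update_self, hab.symm, if_false, hua, if_true]
      exact nodePot_le _ _ _
    · rw [Function.update_of_ne hxa]
      split_ifs
      · exact le_rfl
      · refine nodePot_anti _ _ ?_
        by_cases hy : uf x = b
        · rw [hy]; simp; omega
        · simp [hy]
  have h2 := Finset.sum_le_sum h1
  have h3 : L * (c + 2) ≤ L * (rank b + 2) + L := by
    calc L * (c + 2) ≤ L * (rank b + 2 + 1) := Nat.mul_le_mul_left _ (by omega)
      _ = _ := by ring
  simp only [Function.update_of_ne hab.symm, hub, if_true, Function.update_self]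
  omega

end IsForest

/-! ### The inverse Ackermann function -/

theorem le_ack_invAck (n : ℕ) : n ≤ ack (invAck n) (invAck n) :=
  Nat.sInf_mem (s := {k : ℕ | n ≤ ack k k}) ⟨n, (lt_ack_right n n).le⟩

/-- Two levels turn `ack k k` into a value at argument `1`, since `ack (k + 2) 1 = ack (k + 1) (ack
(k + 1) 1)`. Two more make room for the virtual root and for strictness. -/
theorem lt_ack_of_invAck (n : ℕ) : n + 1 < ack (invAck n + 4) 1 := by
  set k := invAck n
  have h1 : n ≤ ack (k + 2) 1 := by
    calc n ≤ ack k k := le_ack_invAck n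
      _ ≤ ack (k + 1) (ack (k + 1) 1) := by
        refine (ack_mono_left k (Nat.le_succ k)).trans (ack_mono_right _ ?_)
        have := add_lt_ack (k + 1) 1
        omega
      _ = ack (k + 2) 1 := by
        rw [ack_succ_succ (k + 1) 0, ack_succ_zero]
  have h2 : ack (k + 2) 1 < ack (k + 3) 1 := ack_strictMono_left 1 (Nat.lt_succ_self _)
  have h3 : ack (k + 3) 1 < ack (k + 4) 1 := ack_strictMono_left 1 (Nat.lt_succ_self _)
  omega

/-! ### The disjoint-set operations of the program -/

/-- The amortization of the operations on disjoint sets of the numbers up to `n`. -/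
noncomputable def setAmortization (n : ℕ) : Amortization where
  -- A node on the path of a find costs `9` steps in the climb and at most `14` in the compression,
  -- together `23`. The unit then covers `23 * L` plus the constant overheads, where `L + 1 = invAck
  -- n + 5`.
  pot uf rank := 23 * forestPot (invAck n + 4) (n + 1) uf rank
  unit := 100 * (invAck n + 5)
  le_unit := by omega

theorem IsPath.congr {uf uf' : ℕ → ℕ} {r : ℕ} {l : List ℕ} {x : ℕ} (h : IsPath uf r x l)
    (hl : ∀ y ∈ l, uf' y = uf y) (hr : uf' r = uf r) : IsPath uf' r x l := by
  induction l generalizing x with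
  | nil => exact ⟨h.1, hr.trans h.2⟩
  | cons y l ih =>
    obtain ⟨rfl, hu, h⟩ := h
    have hy := hl y (by simp)
    refine ⟨rfl, by rwa [hy], ?_⟩
    rw [hy]
    exact ih h fun z hz => hl z (by simp [hz])

theorem IsPath.uf_root {uf : ℕ → ℕ} {r : ℕ} {l : List ℕ} {x : ℕ} (h : IsPath uf r x l) :
    uf r = r := by
  induction l generalizing x with
  | nil => exact h.2
  | cons y l ih => exact ih h.2.2

theorem exec_climb {s : Mem} {r : ℕ} {l : List ℕ} (h : IsPath (s.arr .uf) r (s.reg .fr) l) :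
    Exec (.loop (.not (.eq (.get .uf (.reg .fr)) (.reg .fr))) (.set .fr (.get .uf (.reg .fr)))) s
      (9 * l.length + 6) (s.setReg .fr r) := by
  induction l generalizing s with
  | nil =>
    obtain ⟨h1, h2⟩ := h
    have : s.setReg .fr r = s := by rw [← h1]; simp [Mem.setReg]
    rw [this]
    exact .loop_false (by simp [h1, h2])
  | cons y l ih =>
    obtain ⟨rfl, hu, h⟩ := h
    have h1 := Exec.loop_true (b := .not (.eq (.get .uf (.reg .fr)) (.reg .fr)))
      (by simpa using hu) (Exec.set .fr (.get .uf (.reg .fr)) s) (ih (by simpa using h))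
    have h2 : (s.setReg .fr (s.arr .uf (s.reg .fr))).setReg .fr r = s.setReg .fr r := by
      simp [Mem.setReg]
    simp only [Exp.eval, h2] at h1
    convert h1 using 1
    simp [Test.cost, Exp.cost]
    omega

theorem exec_compress {s : Mem} {r : ℕ} {l : List ℕ} (h : IsPath (s.arr .uf) r (s.reg .fx) l)
    (hl : l.Nodup) (hr : s.reg .fr = r) :
    ∃ t s', Exec (.loop (.not (.eq (.get .uf (.reg .fx)) (.reg .fr)))
      (.seq (.set .fy (.get .uf (.reg .fx))) (.seq (.store .uf (.reg .fx) (.reg .fr))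
        (.set .fx (.reg .fy))))) s t s' ∧ t ≤ 14 * l.length + 6 ∧
      s'.arr .uf = compress (s.arr .uf) r l := by
  -- The loop stops already at a child of the root. The same exit serves the root itself, which is
  -- its own parent.
  have h_root : s.arr .uf (s.reg .fx) = r → ∃ t s',
      Exec (.loop (.not (.eq (.get .uf (.reg .fx)) (.reg .fr)))
      (.seq (.set .fy (.get .uf (.reg .fx))) (.seq (.store .uf (.reg .fx) (.reg .fr))
        (.set .fx (.reg .fy))))) s t s' ∧ t ≤ 14 * l.length + 6 ∧
      s'.arr .uf = s.arr .uf := fun h1 =>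
    ⟨_, s, .loop_false (by simp [h1, hr]), by simp [Test.cost, Exp.cost], rfl⟩
  induction l generalizing s with
  | nil =>
    obtain ⟨h1, h2⟩ := h
    have : compress (s.arr .uf) r [] = s.arr .uf := funext fun z => by simp [compress]
    rw [this]
    exact h_root (by rw [h1, h2])
  | cons y l ih =>
    obtain ⟨rfl, hu, h⟩ := h
    by_cases h1 : s.arr .uf (s.reg .fx) = r
    · obtain ⟨t, s', h2, h3, h4⟩ := h_root h1
      refine ⟨t, s', h2, h3, h4.trans (funext fun z => ?_)⟩
      -- A child of the root is the last node of the path, and redirecting it to `r` would change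
      -- nothing.
      have : l = [] := by
        rcases l with _ | ⟨z, l⟩
        · rfl
        · exfalso
          obtain ⟨rfl, h5, h⟩ := h
          rw [h1] at h5
          exact h5 h.uf_root
      subst this
      by_cases hz : z = s.reg .fx
      · subst hz; simp [compress, h1]
      · simp [compress, hz]
    · obtain ⟨hy, hl⟩ := List.nodup_cons.1 hl
      have hxr : r ≠ s.reg .fx := by
        rintro rfl
        exact hu h.uf_root
      set s₁ := ((s.setReg .fy (s.arr .uf (s.reg .fx))).setArr .uf (s.reg .fx) r).setReg .fx
        (s.arr .uf (s.reg .fx)) with hs₁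
      have hb : Exec (.seq (.set .fy (.get .uf (.reg .fx))) (.seq (.store .uf (.reg .fx) (.reg .fr))
          (.set .fx (.reg .fy)))) s 8 s₁ := by
        have := Exec.seq (Exec.set .fy (.get .uf (.reg .fx)) s) (Exec.seq
          (Exec.store .uf (.reg .fx) (.reg .fr) _) (Exec.set .fx (.reg .fy) _))
        simpa [Exp.cost, hr, hs₁] using this
      have huf : s₁.arr .uf = Function.update (s.arr .uf) (s.reg .fx) r := by simp [hs₁]
      have hfx : s₁.reg .fx = s.arr .uf (s.reg .fx) := by simp [hs₁]
      have hp : IsPath (s₁.arr .uf) r (s₁.reg .fx) l := by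
        rw [huf, hfx]
        refine h.congr (fun z hz => Function.update_of_ne ?_ _ _) (Function.update_of_ne hxr _ _)
        rintro rfl
        exact hy hz
      obtain ⟨t, s', h2, h3, h4⟩ := ih hp hl (by simp [hs₁, hr]) fun h1 =>
        ⟨_, s₁, .loop_false (by simp only [Test.Holds, Exp.eval, h1]; simp [hs₁, hr]),
          by simp [Test.cost, Exp.cost], rfl⟩
      refine ⟨_, s', .loop_true (by simp [h1, hr]) hb h2, by simp [Test.cost, Exp.cost]; omega, ?_⟩
      rw [h4, huf]
      funext z
      by_cases hz : z = s.reg .fx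
      · subst hz; simp [compress, hy]
      · simp [compress, hz]

/-- The steps along the path are paid by the drop in `compress_pot`. The remaining `23 * L` and the
constant fit into one unit. -/
theorem run_findRoot {n : ℕ} {s : Mem} {root : ℕ → ℕ}
    (h : IsForest (n + 1) (s.arr .uf) (s.arr .rank) root) (hx : s.reg .fx ≤ n) :
    Run (setAmortization n) findRoot s fun u s' => u = 1 ∧ s'.reg .fr = root (s.reg .fx) ∧
      IsForest (n + 1) (s'.arr .uf) (s'.arr .rank) root := by
  have hx : s.reg .fx < n + 1 := by omega
  obtain ⟨l, hl⟩ := h.exists_path hx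
  have h1 := Exec.set .fr (.reg .fx) s
  have h2 := exec_climb (s := s.setReg .fr (s.reg .fx)) (r := root (s.reg .fx)) (l := l)
    (by simpa using hl)
  obtain ⟨t, s', h3, h4, h5⟩ := exec_compress
    (s := (s.setReg .fr (s.reg .fx)).setReg .fr (root (s.reg .fx))) (r := root (s.reg .fx)) (l := l)
    (by simpa using hl) (h.path_nodup hx hl) (by simp)
  have hfr := h3.agree.reg .fr (by decide)
  have hrank := h3.agree.arr .rank (by decide)
  simp only [Mem.setReg_arr, Mem.setReg_reg, if_true] at hfr hrank h5
  refine ⟨1, s', _, h1.seq (h2.seq h3), ?_, rfl, hfr, ?_⟩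
  · have := h.compress_pot (L := invAck n + 4) (by omega) (lt_ack_of_invAck n) hx hl
    rw [h5, hrank]
    simp only [setAmortization, Exp.cost]
    omega
  · rw [h5, hrank]; exact h.compress hx hl

/-- Disjoint sets of the numbers below `N`, with the representative `rp x` of `x`. -/
def IsSets (N : ℕ) (uf rank name rp : ℕ → ℕ) : Prop :=
  ∃ root, IsForest N uf rank root ∧
    ∀ x < N, rp x < N ∧ root (rp x) = root x ∧ rp x = name (root x)

/-- Needed for the search: the vertices it collects are values of `rp`, hence representatives
themselves. -/
theorem IsSets.rp_rp {N : ℕ} {uf rank name rp : ℕ → ℕ} (h : IsSets N uf rank name rp) {x : ℕ}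
    (hx : x < N) : rp (rp x) = rp x := by
  obtain ⟨root, -, h⟩ := h
  obtain ⟨h1, h2, h3⟩ := h x hx
  rw [(h _ h1).2.2, h2, ← h3]

/-- The representatives after the sets of `x` and `y` have been united. -/
def mergeRep (rp : ℕ → ℕ) (x y : ℕ) : ℕ → ℕ :=
  fun z => if rp z = rp x ∨ rp z = rp y then y else rp z

theorem run_rep {n : ℕ} {s : Mem} {rp : ℕ → ℕ} (z : Reg) {a : Exp}
    (h : IsSets (n + 1) (s.arr .uf) (s.arr .rank) (s.arr .name) rp)
    (ha : a.cost < 20) (hx : a.eval s ≤ n) :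
    Run (setAmortization n) (rep z a) s fun u s' => u = 3 ∧ s'.reg z = rp (a.eval s) ∧
      IsSets (n + 1) (s'.arr .uf) (s'.arr .rank) (s'.arr .name) rp := by
  obtain ⟨root, h, hr⟩ := h
  refine Run.set_seq ha ((run_findRoot (by simpa using h) (by simpa using hx)).bind ?_)
  rintro u s' ⟨rfl, hfr, h'⟩ hf
  refine Run.set (by decide) ⟨rfl, ?_, root, h', ?_⟩
  · simp [hfr, hf.arr .name (by decide), (hr _ (Nat.lt_succ_of_le hx)).2.2]
  · simpa [hf.arr .name (by decide)] using hr

/-- The part of `merge` that links the roots. -/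
theorem run_link {n : ℕ} {s : Mem} {root : ℕ → ℕ} {p q : ℕ}
    (h : IsForest (n + 1) (s.arr .uf) (s.arr .rank) root)
    (hp : s.reg .ra = p) (hq : s.reg .rb = q) (hpn : p < n + 1) (hqn : q < n + 1)
    (hup : s.arr .uf p = p) (huq : s.arr .uf q = q) :
    Run (setAmortization n) (onlyIf (.not (.eq (.reg .ra) (.reg .rb)))
      (.ite (.lt (.get .rank (.reg .ra)) (.get .rank (.reg .rb)))
        (.store .uf (.reg .ra) (.reg .rb))
        (.seq (.store .uf (.reg .rb) (.reg .ra))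
        (.seq (onlyIf (.eq (.get .rank (.reg .ra)) (.get .rank (.reg .rb)))
            (.store .rank (.reg .ra) (.succ (.get .rank (.reg .ra)))))
          (.set .rb (.reg .ra)))))) s fun u s' => u = 1 ∧
      (s'.reg .rb = p ∨ s'.reg .rb = q) ∧
      IsForest (n + 1) (s'.arr .uf) (s'.arr .rank)
        (fun z => if root z = p ∨ root z = q then s'.reg .rb else root z) := by
  subst hp hq
  have hrp := h.root_eq _ hpn hup
  have hrq := h.root_eq _ hqn huq
  by_cases hpq : s.reg .ra = s.reg .rb
  · refine ⟨1, s, _, .ite_false (by simpa using hpq) (.skip s), ?_, rfl, .inr rfl, ?_⟩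
    · simp [setAmortization, Test.cost, Exp.cost]; omega
    · convert h using 2 with z
      simp only [hpq, or_self]
      split_ifs with h1
      exacts [h1.symm, rfl]
  by_cases hlt : s.arr .rank (s.reg .ra) < s.arr .rank (s.reg .rb)
  · refine ⟨1, _, _, .ite_true (by simpa using hpq) (.ite_true (by simpa using hlt)
      (.store _ _ _ _)), ?_, rfl, .inr rfl, ?_⟩
    · have := forestPot_link (L := invAck n + 4) (rank := s.arr .rank) hqn hup huq hpq le_rfl
        (Nat.le_succ _)
      rw [Function.update_eq_self] at this
      simp only [Mem.setArr_arr, Exp.eval, if_true, reduceCtorEq, if_false, setAmortization,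
        Test.cost, Exp.cost]
      omega
    · have := h.link hpn hqn hup huq hpq hlt le_rfl (Nat.le_succ _)
      rw [Function.update_eq_self] at this
      simp only [Mem.setArr_arr, Exp.eval, if_true, reduceCtorEq, if_false, Mem.setArr_reg]
      convert this using 2 with z
      split_ifs <;> tauto
  · by_cases heq : s.arr .rank (s.reg .ra) = s.arr .rank (s.reg .rb)
    · refine ⟨1, _, _, .ite_true (by simpa using hpq) (.ite_false (by simpa using hlt)
        (.seq (.store _ _ _ _) (.seq (.ite_true (by simpa using heq) (.store _ _ _ _))
          (.set _ _ _)))), ?_, rfl, .inl (by simp), ?_⟩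
      · have := forestPot_link (L := invAck n + 4) (rank := s.arr .rank) (a := s.reg .rb)
          (b := s.reg .ra) hpn huq hup (Ne.symm hpq) (Nat.le_succ _) le_rfl
        simp only [Mem.setArr_arr, Exp.eval, if_true, reduceCtorEq, if_false, setAmortization,
          Test.cost, Exp.cost, Mem.setReg_arr, Mem.setArr_reg, Nat.succ_eq_add_one] at this ⊢
        omega
      · have := h.link hqn hpn huq hup (Ne.symm hpq) (by rw [heq]; exact Nat.lt_succ_self _)
          (Nat.le_succ _) le_rfl
        simp only [Mem.setArr_arr, Exp.eval, if_true, reduceCtorEq, if_false, Mem.setReg_arr,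
          Mem.setArr_reg, Mem.setReg_reg]
        convert this using 2 with z
        split_ifs <;> tauto
    · refine ⟨1, _, _, .ite_true (by simpa using hpq) (.ite_false (by simpa using hlt)
        (.seq (.store _ _ _ _) (.seq (.ite_false (by simpa using heq) (.skip _))
          (.set _ _ _)))), ?_, rfl, .inl (by simp), ?_⟩
      · have := forestPot_link (L := invAck n + 4) (rank := s.arr .rank) (a := s.reg .rb)
          (b := s.reg .ra) hpn huq hup (Ne.symm hpq) le_rfl (Nat.le_succ _)
        rw [Function.update_eq_self] at this
        simp only [Mem.setArr_arr, Exp.eval, if_true, reduceCtorEq, if_false, setAmortization,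
          Test.cost, Exp.cost, Mem.setReg_arr] at this ⊢
        omega
      · have := h.link hqn hpn huq hup (Ne.symm hpq) (by omega) le_rfl (Nat.le_succ _)
        rw [Function.update_eq_self] at this
        simp only [Mem.setArr_arr, Exp.eval, if_true, reduceCtorEq, if_false, Mem.setReg_arr,
          Mem.setArr_reg, Mem.setReg_reg]
        convert this using 2 with z
        split_ifs <;> tauto

/-- The expression `b` is evaluated again after both finds and after the link, so its value must be
stable under everything that `merge` may write. The eight units are two finds, the link and five
assignments. -/
theorem run_merge {n : ℕ} {s : Mem} {rp : ℕ → ℕ} {a b : Exp} {x y : ℕ}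
    (h : IsSets (n + 1) (s.arr .uf) (s.arr .rank) (s.arr .name) rp)
    (ha : a.cost < 20) (hb : b.cost < 19)
    (hax : a.eval s = x) (hby : ∀ s', (merge a b).Frame s s' → b.eval s' = y)
    (hx : x ≤ n) (hy : y ≤ n) :
    Run (setAmortization n) (merge a b) s fun u s' => u = 8 ∧
      IsSets (n + 1) (s'.arr .uf) (s'.arr .rank) (s'.arr .name) (mergeRep rp x y) := by
  obtain ⟨root, h, hr⟩ := h
  have hx : x < n + 1 := by omega
  have hy : y < n + 1 := by omega
  have hF : (merge a b).Frame s s := .refl _ _ _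
  have hwR : ∀ z, (merge a b).modR z = false → findRoot.modR z = false := by
    rintro ⟨⟩ <;> first | exact fun _ => rfl | (intro h; cases h)
  have hwA : ∀ z, (merge a b).modA z = false → findRoot.modA z = false := by
    rintro ⟨⟩ <;> first | exact fun _ => rfl | (intro h; cases h)
  refine Run.set_seq ha ((run_findRoot (by simpa using h) (by simp [hax]; omega)).bind ?_)
  rintro _ s₁ ⟨rfl, hfr₁, h₁⟩ hf₁
  replace hF := (hF.setReg (z := .fx) (c := a.eval s) rfl).trans (hf₁.weaken hwR hwA)
  refine Run.set_seq (by decide) ?_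
  replace hF := hF.setReg (z := .ra) (c := s₁.reg .fr) rfl
  have hby₁ := hby _ hF
  refine Run.set_seq (by omega) ?_
  simp only [Exp.eval, hby₁]
  replace hF := hF.setReg (z := .fx) (c := y) rfl
  refine (run_findRoot (root := root) (by simpa using h₁) (by simp; omega)).bind ?_
  rintro _ s₂ ⟨rfl, hfr₂, h₂⟩ hf₂
  replace hF := hF.trans (hf₂.weaken hwR hwA)
  have hra₂ := hf₂.reg .ra (by decide)
  simp only [Mem.setReg_reg, reduceCtorEq, if_false, if_true, hax] at hra₂ hfr₂ hfr₁
  refine Run.set_seq (by decide) ?_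
  replace hF := hF.setReg (z := .rb) (c := s₂.reg .fr) rfl
  simp only [Exp.eval]
  have key := run_link (s := s₂.setReg .rb (s₂.reg .fr)) (root := root) (p := root x)
    (q := root y) (by simpa using h₂) (by simp [hra₂, hfr₁]) (by simp [hfr₂])
    (h.root_lt _ hx) (h.root_lt _ hy) (by simpa using h₂.uf_root _ hx)
    (by simpa using h₂.uf_root _ hy)
  refine key.bind ?_
  rintro _ s₃ ⟨rfl, hrb, h₃⟩ hf₃
  replace hF := hF.trans (hf₃.weaken (R' := (merge a b).modR) (A' := (merge a b).modA)
    (by rintro ⟨⟩ <;> first | exact fun _ => rfl | (intro h; cases h))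
    (by rintro ⟨⟩ <;> first | exact fun _ => rfl | (intro h; cases h)))
  have hname : s₃.arr .name = s.arr .name := by
    have h1 := hf₁.arr .name (by decide)
    have h2 := hf₂.arr .name (by decide)
    have h3 := hf₃.arr .name (by decide)
    simp only [Mem.setReg_arr] at h1 h2 h3
    rw [h3, h2, h1]
  refine Run.store (by decide) (by simp [Exp.cost]; omega) ⟨rfl, _, by simpa using h₃, ?_⟩
  intro z hz
  simp only [Exp.eval, hby _ hF, Mem.setArr_arr, if_true, hname]
  obtain ⟨hz1, hz2, hz3⟩ := hr z hz
  obtain ⟨hx1, hx2, hx3⟩ := hr x hx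
  obtain ⟨hy1, hy2, hy3⟩ := hr y hy
  have hiff : ∀ {v w : ℕ}, v < n + 1 → w < n + 1 → (rp v = rp w ↔ root v = root w) :=
    fun hv hw => ⟨fun h => by rw [← (hr _ hv).2.1, ← (hr _ hw).2.1, h],
      fun h => by rw [(hr _ hv).2.2, (hr _ hw).2.2, h]⟩
  -- Having the same representative and having the same root are equivalent, so `mergeRep` describes
  -- the forest after the link.
  have hcond : (rp z = rp x ∨ rp z = rp y) ↔ (root z = root x ∨ root z = root y) := by
    rw [hiff hz hx, hiff hz hy]
  unfold mergeRep
  by_cases hc : root z = root x ∨ root z = root y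
  · simp [hcond.2 hc, hc, hy]
  · have : root z ≠ s₃.reg .rb := by
      rcases hrb with h | h <;> rw [h] <;> tauto
    simp only [hcond, hc, if_false]
    refine ⟨hz1, by rw [hz2, if_neg hc], ?_⟩
    rw [Function.update_of_ne this, hz3]

/-- The amortization with the same unit and without potential. -/
noncomputable def plainAmortization (n : ℕ) : Amortization where
  pot _ _ := 0
  unit := (setAmortization n).unit
  le_unit := (setAmortization n).le_unit

/-- Without potential, stores into `uf` and `rank` are harmless; `makeSets` needs them. -/
theorem Run.plain_store {n : ℕ} {a : Arr} {i e : Exp} {s : Mem} {Q : ℕ → Mem → Prop}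
    (he : i.cost + e.cost < 20) (h : Q 1 (s.setArr a (i.eval s) (e.eval s))) :
    Run (plainAmortization n) (.store a i e) s Q :=
  ⟨1, _, _, .store a i e s, by
    have := (plainAmortization n).le_unit
    simp only [plainAmortization] at this ⊢
    omega, h⟩

/-- An amortized program after a program whose result has a small potential. -/
theorem Run.plain_bind {n k : ℕ} {c d : Cmd} {s : Mem} {Q Q' : ℕ → Mem → Prop}
    (h : Run (plainAmortization n) c s Q)
    (hd : ∀ u s', Q u s' → c.Frame s s' →
      (setAmortization n).pot (s'.arr .uf) (s'.arr .rank) ≤ (setAmortization n).unit * k ∧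
      Run (setAmortization n) d s' fun u' => Q' (u + k + u')) :
    Run (plainAmortization n) (.seq c d) s Q' := by
  obtain ⟨u, s₁, t, hx, ht, hq⟩ := h
  obtain ⟨hk, u', s₂, t', hx', ht', hq'⟩ := hd u s₁ hq hx.agree
  -- The initial potential is bought with `k` units, and the final one is nonnegative and is
  -- dropped.
  refine ⟨u + k + u', s₂, t + t', hx.seq hx', ?_, hq'⟩
  simp only [plainAmortization] at ht ⊢
  rw [mul_add, mul_add]
  omega

theorem run_makeSets {n : ℕ} {s : Mem} (hn : s.reg .n = n) :
    Run (plainAmortization n) makeSets s fun u s' => u = 5 * (n + 1) + 2 ∧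
      (setAmortization n).pot (s'.arr .uf) (s'.arr .rank) ≤ (setAmortization n).unit * (n + 1) ∧
      IsSets (n + 1) (s'.arr .uf) (s'.arr .rank) (s'.arr .name) id := by
  refine Run.forRange (n + 1) (fun k u s => u = 5 * k + 1 ∧
    ∀ x < k, s.arr .uf x = x ∧ s.arr .rank x = 0 ∧ s.arr .name x = x)
    (by decide) (by decide) ?_ ⟨rfl, by simp⟩ ?_ ?_
  · intro s' hF
    simp [hF.reg .n (by decide), hn]
  · rintro k u s - ⟨h2, h4⟩ hi hk
    refine (Run.plain_store (by decide) ((Run.plain_store (by decide)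
      (Run.plain_store (by decide) ?_)).seq)).seq
    refine ⟨by omega, fun x hx => ?_⟩
    by_cases hxk : x = k
    · subst hxk; simp [hi]
    · simpa [hi, hxk] using h4 x (by omega)
  · rintro u s - ⟨h2, h4⟩ -
    refine ⟨by omega, ?_, id, ⟨?_, ?_, fun x hx => hx, ?_, ?_, fun x _ _ => rfl, ?_⟩, ?_⟩
    · have : forestPot (invAck n + 4) (n + 1) (s.arr .uf) (s.arr .rank) =
          ∑ x ∈ Finset.range (n + 1), (invAck n + 4) * 2 :=
        Finset.sum_congr rfl fun x hx => by
          have := h4 x (by simpa using hx)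
          simp [this.1, this.2.1]
      simp only [setAmortization, this, Finset.sum_const, Finset.card_range, smul_eq_mul]
      -- Each of the `n + 1` singletons is a root of rank `0` with potential `2 * L`, and `23 * 2 *
      -- L` is below one unit.
      nlinarith
    · intro x hx; rw [(h4 x hx).1]; exact hx
    · intro x hx h; exact absurd (h4 x hx).1 h
    · intro x hx; exact (h4 x hx).1
    · intro x hx; simp [(h4 x hx).1]
    · intro x hx
      rw [(h4 x hx).2.1, zero_add]
      exact (Finset.card_filter_le _ _).trans (by simp)
    · intro x hx; exact ⟨hx, rfl, by simp [(h4 x hx).2.2]⟩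

/-! ### Linked lists -/

/-- The linked list that starts at the pointer (one more than the first element, or zero). -/
def Chain (nxt : ℕ → ℕ) : ℕ → List ℕ → Prop
  | p, [] => p = 0
  | p, e :: l => p = e + 1 ∧ Chain nxt (nxt e) l

theorem Chain.congr {nxt nxt' : ℕ → ℕ} {l : List ℕ} {p : ℕ} (h : Chain nxt p l)
    (hn : ∀ e ∈ l, nxt' e = nxt e) : Chain nxt' p l := by
  induction l generalizing p with
  | nil => exact h
  | cons e l ih =>
    refine ⟨h.1, ?_⟩
    rw [hn e (by simp)]
    exact ih h.2 fun e' he' => hn e' (by simp [he'])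

/-- Total correctness of `forList`: the invariant `I` is indexed by the elements that remain and
the amortized time so far. -/
theorem Run.forList {A : Amortization} {hd nxt : Arr} {a : Exp} {body : Cmd} {s₀ : Mem}
    {Q : ℕ → Mem → Prop} {l : List ℕ} (hl : Chain (s₀.arr nxt) (s₀.arr hd (a.eval s₀)) l)
    (I : List ℕ → ℕ → Mem → Prop) (ha : a.cost < 19) (hp : body.modR .p = false)
    (hn : body.modA nxt = false) (h₀ : I l 1 (s₀.setReg .p (s₀.arr hd (a.eval s₀))))
    -- The three extra units are the test and the assignments to `e` and `p`.
    (step : ∀ e l u s p, (WTO.forList hd nxt a body).Frame s₀ s → I (e :: l) u s →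
      Run A body ((s.setReg .e e).setReg .p p) fun u' s' => I l (u + u' + 3) s')
    (final : ∀ u s, (WTO.forList hd nxt a body).Frame s₀ s → I [] u s → Q (u + 1) s) :
    Run A (WTO.forList hd nxt a body) s₀ Q := by
  have hF : (WTO.forList hd nxt a body).Frame s₀ s₀ := .refl _ _ _
  refine Run.set_seq (by simp [Exp.cost]; omega) ?_
  refine Run.loop (by decide) (fun k u s => ∃ l, (WTO.forList hd nxt a body).Frame s₀ s ∧
      I l (u + 1) s ∧ Chain (s.arr nxt) (s.reg .p) l ∧ k = l.length)
    (k₀ := l.length) ⟨l, hF.setReg (by simp [WTO.forList, Cmd.modR]), h₀, by simpa using hl, rfl⟩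
    ?_ ?_
  · rintro k u s ⟨l, hF, hI, hl, rfl⟩ hne
    rcases l with _ | ⟨e, l⟩
    · simp only [Test.Holds, Exp.eval] at hne
      exact absurd hl hne
    obtain ⟨he, hl⟩ := hl
    refine Run.set_seq (by decide) (Run.set_seq (by simp [Exp.cost]) ?_)
    simp only [Exp.eval, he, Nat.add_sub_cancel, Mem.setReg_arr, Mem.setReg_reg, if_true]
    refine (step e l _ s (s.arr nxt e) hF hI).imp fun u' s' hI' hf => ?_
    refine ⟨l.length, by simp, l, ?_, ?_, ?_, rfl⟩
    · exact ((hF.setReg (by simp [WTO.forList, Cmd.modR])).setReg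
        (by simp [WTO.forList, Cmd.modR])).trans (hf.weaken
          (by simp +contextual [WTO.forList, Cmd.modR])
          (by simp +contextual [WTO.forList, Cmd.modA]))
    · convert hI' using 1; omega
    · rw [hf.arr nxt hn, hf.reg .p hp]
      simpa using hl
  · rintro k u s ⟨l, hF, hI, hl, rfl⟩ hne
    rcases l with _ | ⟨e, l⟩
    · rw [add_comm 1]; exact final _ _ hF hI
    · exact absurd hl.1 (by simp only [Test.Holds, Exp.eval, not_not] at hne; omega)

/-- The linked list that starts at the pointer `p` has the elements `S`, without repetition. -/
def IsListOf (nxt : ℕ → ℕ) (p : ℕ) (S : Finset ℕ) : Prop :=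
  ∃ l, Chain nxt p l ∧ l.Nodup ∧ ∀ e, e ∈ l ↔ e ∈ S

theorem IsListOf.empty (nxt : ℕ → ℕ) : IsListOf nxt 0 ∅ :=
  ⟨[], rfl, List.nodup_nil, by simp⟩

theorem IsListOf.update {nxt : ℕ → ℕ} {p : ℕ} {S : Finset ℕ} (h : IsListOf nxt p S) {e : ℕ}
    (he : e ∉ S) (c : ℕ) : IsListOf (Function.update nxt e c) p S := by
  obtain ⟨l, h1, h2, h3⟩ := h
  refine ⟨l, h1.congr fun x hx => Function.update_of_ne ?_ _ _, h2, h3⟩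
  rintro rfl
  exact he ((h3 _).1 hx)

theorem IsListOf.cons {nxt : ℕ → ℕ} {p : ℕ} {S : Finset ℕ} (h : IsListOf nxt p S) {e : ℕ}
    (he : e ∉ S) : IsListOf (Function.update nxt e p) (e + 1) (insert e S) := by
  obtain ⟨l, h1, h2, h3⟩ := h.update he p
  exact ⟨e :: l, ⟨rfl, by simpa using h1⟩, List.nodup_cons.2 ⟨fun hm => he ((h3 e).1 hm), h2⟩,
    fun x => by simp [h3]⟩

theorem nodup_length_eq {l : List ℕ} {S : Finset ℕ} (h : l.Nodup) (hS : ∀ e, e ∈ l ↔ e ∈ S) :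
    l.length = S.card := by
  rw [← List.toFinset_card_of_nodup h]
  congr 1
  ext e
  simp [hS]

/-- The kinds of lists of edges: back edges by target, cross/forward edges by source, removed edges,
current non-back edges by target. -/
inductive Kind
  | none | back | cross | stored | cur
  deriving DecidableEq

/-- The edges in list number `a` of the given kind. -/
def slot (m : ℕ) (loc : ℕ → Kind × ℕ) (K : Kind) (a : ℕ) : Finset ℕ :=
  (Finset.range m).filter fun e => loc e = (K, a)

/-- The lists with numbers in `I` are represented in memory. -/
def IsFamily (m : ℕ) (loc : ℕ → Kind × ℕ) (K : Kind) (I : ℕ → Prop) (hd nxt : ℕ → ℕ) : Prop :=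
  ∀ a, I a → IsListOf nxt (hd a) (slot m loc K a)

/-- Overwriting `nxt e` destroys no list of the family, because `e` lies in none of its slots. -/
theorem IsFamily.insert {m : ℕ} {loc : ℕ → Kind × ℕ} {K : Kind} {I : ℕ → Prop} {hd nxt : ℕ → ℕ}
    (h : IsFamily m loc K I hd nxt) {e : ℕ} (he : e < m) (hK : (loc e).1 ≠ K) (a : ℕ) :
    IsFamily m (Function.update loc e (K, a)) K I (Function.update hd a (e + 1))
      (Function.update nxt e (hd a)) := by
  intro b hb
  have hne : e ∉ slot m loc K b := fun h => hK (by rw [(Finset.mem_filter.1 h).2])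
  by_cases hba : b = a
  · subst hba
    have := (h b hb).cons hne
    rw [Function.update_self]
    convert this using 1
    ext x
    by_cases hx : x = e
    · subst hx; simp [slot, he]
    · simp [slot, hx]
  · rw [Function.update_of_ne hba]
    have := (h b hb).update hne (hd a)
    convert this using 1
    ext x
    by_cases hx : x = e
    · subst hx
      simpa [slot, Ne.symm hba, he] using fun h : loc x = (K, b) => hK (by rw [h])
    · simp [slot, hx]

/-- An edge can move in `loc` while the memory still links it into its old list. The smaller index
set `J` gives up that list. -/
theorem IsFamily.update_loc {m : ℕ} {loc : ℕ → Kind × ℕ} {K : Kind} {I J : ℕ → Prop}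
    {hd nxt : ℕ → ℕ} (h : IsFamily m loc K I hd nxt) (hJ : ∀ a, J a → I a) {e : ℕ} {k : Kind × ℕ}
    (he : ∀ a, J a → loc e ≠ (K, a)) (hk : k.1 ≠ K) :
    IsFamily m (Function.update loc e k) K J hd nxt := by
  intro b hb
  convert h b (hJ b hb) using 1
  ext x
  by_cases hx : x = e
  · subst hx
    have : k ≠ (K, b) := by rintro rfl; exact hk rfl
    simp [slot, he b hb, this]
  · simp [slot, hx]

theorem IsFamily.mono {m : ℕ} {loc : ℕ → Kind × ℕ} {K : Kind} {I J : ℕ → Prop}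
    {hd nxt : ℕ → ℕ} (h : IsFamily m loc K I hd nxt) (hJ : ∀ a, J a → I a) :
    IsFamily m loc K J hd nxt := fun a ha => h a (hJ a ha)

/-- The amortization of edges: moving an edge releases the difference of the weights of its old and
new places. -/
theorem sum_update_loc {m : ℕ} (wt : Kind × ℕ → ℕ) (loc : ℕ → Kind × ℕ) {e : ℕ} (he : e < m)
    (k : Kind × ℕ) :
    ∑ x ∈ Finset.range m, wt (Function.update loc e k x) + wt (loc e) =
      ∑ x ∈ Finset.range m, wt (loc x) + wt k := by
  have he : e ∈ Finset.range m := by simpa using he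
  rw [← Finset.add_sum_erase _ _ he, ← Finset.add_sum_erase _ _ he, Function.update_self]
  have : ∑ x ∈ (Finset.range m).erase e, wt (Function.update loc e k x) =
      ∑ x ∈ (Finset.range m).erase e, wt (loc x) :=
    Finset.sum_congr rfl fun x hx => by rw [Function.update_of_ne (Finset.mem_erase.1 hx).1]
  omega

theorem run_insertInto {A : Amortization} {s : Mem} {hd nxt : Arr} {a : Exp} (x : ℕ)
    (h₁ : hd ≠ .uf ∧ hd ≠ .rank) (h₂ : nxt ≠ .uf ∧ nxt ≠ .rank)
    (hc : a.cost < 15)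
    (ha : ∀ s', (insertInto hd nxt a).Frame s s' → a.eval s' = x) {Q : ℕ → Mem → Prop}
    (h : Q 2 ((s.setArr nxt (s.reg .e) (s.arr hd x)).setArr hd x (s.reg .e + 1))) :
    Run A (insertInto hd nxt a) s Q := by
  have hF : (insertInto hd nxt a).Frame s s := .refl _ _ _
  refine Run.store_seq h₂ (by simp [Exp.cost]; omega) (Run.store h₁ (by simp [Exp.cost]; omega) ?_)
  rw [ha _ (hF.setArr (by simp [insertInto, Cmd.modA]))]
  simpa [ha _ hF] using h

/-! ### Scheduling constraints -/

/-- The scheduling constraints in memory. -/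
structure HasConstraints (s : Mem) : Prop where
  src_lt : ∀ c < s.reg .fc, s.arr .fsrc c < s.reg .xc
  tgt_lt : ∀ c < s.reg .fc, s.arr .ftgt c < s.reg .xc
  list : ∀ v < s.reg .xc, IsListOf (s.arr .fNxt) (s.arr .fHd v)
    ((Finset.range (s.reg .fc)).filter fun c => s.arr .fsrc c = v)
  npred_eq : ∀ v < s.reg .xc,
    s.arr .npred v = ((Finset.range (s.reg .fc)).filter fun c => s.arr .ftgt c = v).card

theorem HasConstraints.congr {s s' : Mem} (h : HasConstraints s)
    (hxc : s'.reg .xc = s.reg .xc) (hfc : s'.reg .fc = s.reg .fc)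
    (h1 : s'.arr .fsrc = s.arr .fsrc) (h2 : s'.arr .ftgt = s.arr .ftgt)
    (h3 : s'.arr .fHd = s.arr .fHd) (h4 : s'.arr .fNxt = s.arr .fNxt)
    (h5 : s'.arr .npred = s.arr .npred) : HasConstraints s' := by
  obtain ⟨a, b, c, d⟩ := h
  constructor <;> simp only [hxc, hfc, h1, h2, h3, h4, h5] <;> assumption

theorem filter_range_update {f : ℕ → ℕ} {k x v : ℕ} :
    ((Finset.range (k + 1)).filter fun c => Function.update f k x c = v) =
      if v = x then insert k ((Finset.range k).filter fun c => f c = v)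
      else (Finset.range k).filter fun c => f c = v := by
  ext c
  by_cases hc : c = k
  · subst hc
    by_cases hv : v = x <;> simp [hv, eq_comm]
  · by_cases hv : v = x <;> simp [hc, hv] <;> omega

/-- Both expressions are evaluated several times between the stores, hence the stability conditions
`ha` and `hb`. The new constraint gets the fresh number `fc`, which is in no list. -/
theorem run_addConstraint {A : Amortization} {s : Mem} {a b : Exp} {x y : ℕ}
    (h : HasConstraints s) (hca : a.cost < 15) (hcb : b.cost < 8)
    (ha : ∀ s', (addConstraint a b).Frame s s' → a.eval s' = x)
    (hb : ∀ s', (addConstraint a b).Frame s s' → b.eval s' = y)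
    (hx : x < s.reg .xc) (hy : y < s.reg .xc) :
    Run A (addConstraint a b) s fun u s' => u = 6 ∧ s'.reg .fc = s.reg .fc + 1 ∧
      s'.arr .fsrc = Function.update (s.arr .fsrc) (s.reg .fc) x ∧
      s'.arr .ftgt = Function.update (s.arr .ftgt) (s.reg .fc) y ∧ HasConstraints s' := by
  have hF : (addConstraint a b).Frame s s := .refl _ _ _
  refine Run.store_seq (by decide) (by simp [Exp.cost]; omega) ?_
  simp only [Exp.eval, ha _ hF]
  replace hF := hF.setArr (a := .fsrc) (i := s.reg .fc) (c := x) rfl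
  refine Run.store_seq (by decide) (by simp [Exp.cost]; omega) ?_
  simp only [Exp.eval, hb _ hF, Mem.setArr_reg]
  replace hF := hF.setArr (a := .ftgt) (i := s.reg .fc) (c := y) rfl
  refine Run.store_seq (by decide) (by simp [Exp.cost]; omega) ?_
  simp only [Exp.eval, ha _ hF, Mem.setArr_reg, Mem.setArr_arr, reduceCtorEq, if_false]
  replace hF := hF.setArr (a := .fNxt) (i := s.reg .fc) (c := s.arr .fHd x) rfl
  refine Run.set_seq (by decide) ?_
  simp only [Exp.eval, Mem.setArr_reg]
  replace hF := hF.setReg (z := .fc) (c := s.reg .fc + 1) rfl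
  refine Run.store_seq (by decide) (by simp [Exp.cost]; omega) ?_
  simp only [Exp.eval, ha _ hF, Mem.setArr_reg, Mem.setReg_reg, if_true]
  replace hF := hF.setArr (a := .fHd) (i := x) (c := s.reg .fc + 1) rfl
  refine Run.store (by decide) (by simp [Exp.cost]; omega) ?_
  simp only [Exp.eval, hb _ hF, Mem.setArr_arr, Mem.setReg_arr, reduceCtorEq, if_false]
  refine ⟨trivial, by simp, by simp, by simp, ?_⟩
  have hnot : ∀ S : Finset ℕ, S ⊆ Finset.range (s.reg .fc) → s.reg .fc ∉ S := fun S hS hm => by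
    simpa using hS hm
  constructor
  · intro c hc
    simp only [Mem.setArr_arr, Mem.setArr_reg, Mem.setReg_reg, Mem.setReg_arr, reduceCtorEq,
      if_false, if_true] at hc ⊢
    by_cases hcf : c = s.reg .fc
    · subst hcf; simpa using hx
    · rw [Function.update_of_ne hcf]; exact h.src_lt c (by omega)
  · intro c hc
    simp only [Mem.setArr_arr, Mem.setArr_reg, Mem.setReg_reg, Mem.setReg_arr, reduceCtorEq,
      if_false, if_true] at hc ⊢
    by_cases hcf : c = s.reg .fc
    · subst hcf; simpa using hy
    · rw [Function.update_of_ne hcf]; exact h.tgt_lt c (by omega)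
  · intro v hv
    simp only [Mem.setArr_arr, Mem.setArr_reg, Mem.setReg_reg, Mem.setReg_arr, reduceCtorEq,
      if_false, if_true] at hv ⊢
    rw [filter_range_update]
    have hl := h.list v hv
    have hm := hnot _ (Finset.filter_subset (fun c => s.arr .fsrc c = v) _)
    by_cases hvx : v = x
    · subst hvx
      simpa using hl.cons hm
    · simpa [hvx] using hl.update hm _
  · intro v hv
    simp only [Mem.setArr_arr, Mem.setArr_reg, Mem.setReg_reg, Mem.setReg_arr, reduceCtorEq,
      if_false, if_true] at hv ⊢
    rw [filter_range_update]
    have hl := h.npred_eq v hv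
    have hm := hnot _ (Finset.filter_subset (fun c => s.arr .ftgt c = v) _)
    by_cases hvx : v = y
    · subst hvx
      rw [if_pos rfl, Finset.card_insert_of_notMem hm, Function.update_self, hl]
    · rw [if_neg hvx, Function.update_of_ne hvx, hl]

/-! ### Initialization -/

/-- The function numbers the vertices below `n`. -/
structure IsNumbering (n : ℕ) (f : ℕ → ℕ) : Prop where
  lt : ∀ v < n, f v < n
  inj : ∀ u < n, ∀ v < n, f u = f v → u = v
  surj : ∀ i < n, ∃ v < n, f v = i

/-- The memory holds a graph with `n` vertices and `m` edges, parents, and two numberings. -/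
structure HasGraph (n m : ℕ) (s : Mem) : Prop where
  n_eq : s.reg .n = n
  m_eq : s.reg .m = m
  lift_eq : s.reg .lift = 1
  src_lt : ∀ e < m, s.arr .src e < n
  tgt_lt : ∀ e < m, s.arr .tgt e < n
  par_le : ∀ v < n, s.arr .par v ≤ n
  dfn : IsNumbering n (s.arr .dfn)
  post : IsNumbering n (s.arr .post)

theorem HasGraph.frame {n m : ℕ} {R : Reg → Bool} {A : Arr → Bool} {s s' : Mem}
    (h : HasGraph n m s) (hf : Agree R A s s')
    (hR : (R .n || R .m || R .lift) = false)
    (hA : (A .src || A .tgt || A .par || A .dfn || A .post) = false) : HasGraph n m s' := by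
  simp only [Bool.or_eq_false_iff] at hR hA
  obtain ⟨⟨h1, h2⟩, h3⟩ := hR
  obtain ⟨⟨⟨⟨h4, h5⟩, h6⟩, h7⟩, h8⟩ := hA
  obtain ⟨a, b, c, d, e, f, g, i⟩ := h
  constructor <;> simpa only [hf.reg _ h1, hf.reg _ h2, hf.reg _ h3, hf.arr _ h4, hf.arr _ h5,
    hf.arr _ h6, hf.arr _ h7, hf.arr _ h8]

/-- The array lists the vertices by their numbers. -/
def IsOrder (n : ℕ) (f ord : ℕ → ℕ) : Prop := ∀ v < n, ord (f v) = v

theorem IsOrder.spec {n : ℕ} {f ord : ℕ → ℕ} (h : IsOrder n f ord) (hf : IsNumbering n f) {i : ℕ}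
    (hi : i < n) : ord i < n ∧ f (ord i) = i := by
  obtain ⟨v, hv, rfl⟩ := hf.surj i hi
  rw [h v hv]
  exact ⟨hv, rfl⟩

/-- The result of the initialization. -/
structure IsSetUp (n m : ℕ) (loc : ℕ → Kind × ℕ) (s : Mem) : Prop where
  back : IsFamily m loc .back (· < n) (s.arr .bHd) (s.arr .bNxt)
  cross : IsFamily m loc .cross (· < n) (s.arr .cHd) (s.arr .cNxt)
  cur : IsFamily m loc .cur (· < n) (s.arr .inHd) (s.arr .inNxt)
  stored : ∀ v ≤ n, s.arr .rHd v = 0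
  kind : ∀ e < m, ((loc e).1 = .back ∨ (loc e).1 = .cross ∨ (loc e).1 = .cur) ∧ (loc e).2 < n
  ord : IsOrder n (s.arr .dfn) (s.arr .ord)
  pord : IsOrder n (s.arr .post) (s.arr .pord)
  xc_eq : s.reg .xc = n
  fc_eq : s.reg .fc = 0
  ex_eq : ∀ v < n, s.arr .ex v = v
  constraints : HasConstraints s

theorem slot_eq_empty {m : ℕ} {loc : ℕ → Kind × ℕ} {K : Kind} {a : ℕ}
    (h : ∀ e < m, (loc e).1 ≠ K) : slot m loc K a = ∅ :=
  Finset.filter_eq_empty_iff.2 fun e he heq => h e (by simpa using he) (by rw [heq])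

theorem run_setUp {A : Amortization} {n m : ℕ} {s : Mem} (hg : HasGraph n m s) :
    Run A setUp s fun u s' => u ≤ 17 * (n + m + 1) ∧ ∃ loc, IsSetUp n m loc s' := by
  have hF : setUp.Frame s s := .refl _ _ _
  refine Run.set_seq (by decide) (Run.set_seq (by decide) ?_)
  simp only [Exp.eval, hg.n_eq]
  set s₀ := (s.setReg .xc n).setReg .fc 0 with hs₀
  have hg₀ : HasGraph n m s₀ :=
    hg.frame (((Agree.refl setUp.modR setUp.modA s).setReg rfl).setReg rfl) rfl rfl
  have hxc : s₀.reg .xc = n := by simp [hs₀]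
  have hfc : s₀.reg .fc = 0 := by simp [hs₀]
  clear_value s₀
  clear hF hg hs₀
  refine Run.bind (Q := fun u s => u = 13 * n + 2 ∧ ∀ v < n, s.arr .ex v = v ∧ s.arr .bHd v = 0 ∧
    s.arr .cHd v = 0 ∧ s.arr .rHd v = 0 ∧ s.arr .inHd v = 0 ∧ s.arr .fHd v = 0 ∧
    s.arr .npred v = 0 ∧ s.arr .ord (s₀.arr .dfn v) = v ∧ s.arr .pord (s₀.arr .post v) = v) ?_ ?_
  · refine Run.forRange n (fun k u s => u = 13 * k + 1 ∧ ∀ v < k, s.arr .ex v = v ∧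
      s.arr .bHd v = 0 ∧ s.arr .cHd v = 0 ∧ s.arr .rHd v = 0 ∧ s.arr .inHd v = 0 ∧
      s.arr .fHd v = 0 ∧ s.arr .npred v = 0 ∧ s.arr .ord (s₀.arr .dfn v) = v ∧
      s.arr .pord (s₀.arr .post v) = v) (by decide) (by decide)
      (fun s hF => by simp [hF.reg .n rfl, hg₀.n_eq]) ⟨rfl, by simp⟩ ?_ ?_
    · rintro k u s hF ⟨h1, h2⟩ hi hk
      iterate 10 refine Run.store_seq (by decide) (by decide) ?_
      refine Run.store (by decide) (by decide) ⟨by omega, fun v hv => ?_⟩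
      have hd : s.arr .dfn = s₀.arr .dfn := hF.arr _ rfl
      have hp : s.arr .post = s₀.arr .post := hF.arr _ rfl
      simp only [Exp.eval, Mem.setReg_arr, Mem.setArr_arr, Mem.setArr_reg, hi, reduceCtorEq,
        if_false, if_true, hd, hp]
      by_cases hvk : v = k
      · subst hvk; simp
      -- The numberings are injective, so the entries of earlier vertices in `ord` and `pord`
      -- survive.
      · have hdv : s₀.arr .dfn v ≠ s₀.arr .dfn k := fun h =>
          hvk (hg₀.dfn.inj v (by omega) k hk h)
        have hpv : s₀.arr .post v ≠ s₀.arr .post k := fun h =>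
          hvk (hg₀.post.inj v (by omega) k hk h)
        simpa only [Function.update_of_ne hvk, Function.update_of_ne hdv,
          Function.update_of_ne hpv] using h2 v (by omega)
    · rintro u s - ⟨h1, h2⟩ -
      exact ⟨by omega, h2⟩
  rintro u₁ s₁ ⟨hu₁, h₁⟩ hf₁
  have hg₁ := hg₀.frame hf₁ rfl rfl
  refine Run.store_seq (by decide) (by decide) ?_
  have hn₁ : Exp.eval s₁ (.reg .n) = n := hg₁.n_eq
  rw [hn₁, Exp.eval]
  set s₂ := s₁.setArr .rHd n 0 with hs₂
  have hg₂ : HasGraph n m s₂ :=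
    hg₁.frame ((Agree.refl setUp.modR setUp.modA s₁).setArr rfl) rfl rfl
  refine Run.forRange m (fun k u s => u ≤ 8 * k + 1 ∧ ∃ loc,
    IsFamily m loc .back (· < n) (s.arr .bHd) (s.arr .bNxt) ∧
    IsFamily m loc .cross (· < n) (s.arr .cHd) (s.arr .cNxt) ∧
    IsFamily m loc .cur (· < n) (s.arr .inHd) (s.arr .inNxt) ∧
    -- Edges below `k` have been put into a list; the others have the kind `none`.
    (∀ e < k, ((loc e).1 = .back ∨ (loc e).1 = .cross ∨ (loc e).1 = .cur) ∧ (loc e).2 < n) ∧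
    ∀ e, k ≤ e → loc e = (.none, 0)) (by decide) (by decide)
    (fun s hF => by simp [hF.reg .m rfl, hg₂.m_eq]) ?_ ?_ ?_
  · have hempty : ∀ K a, K ≠ Kind.none → slot m (fun _ => (Kind.none, 0)) K a = ∅ :=
      fun K a hK => slot_eq_empty fun _ _ => hK.symm
    refine ⟨by omega, fun _ => (.none, 0), ?_, ?_, ?_, by simp, by simp⟩ <;> intro a ha <;>
      rw [hempty _ _ (by decide)] <;> simp [hs₂, h₁ a ha, IsListOf.empty]
  · rintro k u s hF ⟨h1, loc, hb, hc, ht, hk, hn⟩ hi hkm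
    have hg := hg₂.frame hF rfl rfl
    refine Run.set_seq (by decide) (Run.set_seq (by decide) ?_)
    have hloc := hn k le_rfl
    have hsrc := hg.src_lt k hkm
    have htgt := hg.tgt_lt k hkm
    have key : ∀ (K : Kind) (a : ℕ), (K = .back ∨ K = .cross ∨ K = .cur) → a < n →
        (∀ e < k + 1, ((Function.update loc k (K, a) e).1 = .back ∨
          (Function.update loc k (K, a) e).1 = .cross ∨
          (Function.update loc k (K, a) e).1 = .cur) ∧ (Function.update loc k (K, a) e).2 < n) ∧
        ∀ e, k + 1 ≤ e → Function.update loc k (K, a) e = (.none, 0) := by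
      intro K a hK ha
      refine ⟨fun e he => ?_, fun e he => ?_⟩
      · by_cases hek : e = k
        · subst hek; simpa using ⟨hK, ha⟩
        · rw [Function.update_of_ne hek]; exact hk e (by omega)
      · rw [Function.update_of_ne (by omega)]; exact hn e (by omega)
    have hup : ∀ {K : Kind} {hd nxt : ℕ → ℕ} {K' : Kind} {a : ℕ}, K ≠ .none → K' ≠ K →
        IsFamily m loc K (· < n) hd nxt →
        IsFamily m (Function.update loc k (K', a)) K (· < n) hd nxt := fun hK hK' h =>
      h.update_loc (fun _ => id) (fun a _ h => hK (by rw [hloc] at h; exact (congrArg Prod.fst h).symm))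
        hK'
    -- Every outcome of the classification puts the edge into exactly one list at the same cost,
    -- which is all that the time bound needs.
    refine Run.ite (by decide) (fun _ => ?_) fun _ => Run.ite (by decide) (fun _ => ?_) fun _ => ?_
    · refine run_insertInto (s.arr .tgt k) (by decide) (by decide) (by decide)
        (fun s' hf => by simp [hf.reg .v rfl, hi]) ?_
      refine ⟨by omega, _, ?_, ?_, ?_, key .back (s.arr .tgt k) (by simp) htgt⟩
      · simpa [hi] using hb.insert hkm (by simp [hloc]) (s.arr .tgt k)
      · simpa using hup (by decide) (by decide) hc
      · simpa using hup (by decide) (by decide) ht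
    · refine run_insertInto (s.arr .tgt k) (by decide) (by decide) (by decide)
        (fun s' hf => by simp [hf.reg .v rfl, hi]) ?_
      refine ⟨by omega, _, ?_, ?_, ?_, key .cur (s.arr .tgt k) (by simp) htgt⟩
      · simpa using hup (by decide) (by decide) hb
      · simpa using hup (by decide) (by decide) hc
      · simpa [hi] using ht.insert hkm (by simp [hloc]) (s.arr .tgt k)
    · refine run_insertInto (s.arr .src k) (by decide) (by decide) (by decide)
        (fun s' hf => by simp [hf.reg .u rfl, hi]) ?_
      refine ⟨by omega, _, ?_, ?_, ?_, key .cross (s.arr .src k) (by simp) hsrc⟩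
      · simpa using hup (by decide) (by decide) hb
      · simpa [hi] using hc.insert hkm (by simp [hloc]) (s.arr .src k)
      · simpa using hup (by decide) (by decide) ht
  · rintro u s hF ⟨h1, loc, hb, hc, ht, hk, -⟩ -
    have hA : ∀ a, a ≠ .rHd → (forRange .e (.reg .m) (.seq (.set .u (.get .src (.reg .e))) (.seq
        (.set .v (.get .tgt (.reg .e))) (.ite (.and (.not (.lt (.get .dfn (.reg .u))
        (.get .dfn (.reg .v)))) (.not (.lt (.get .post (.reg .v)) (.get .post (.reg .u)))))
      (insertInto .bHd .bNxt (.reg .v))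
      (.ite (.eq (.get .par (.reg .v)) (.reg .u))
        (insertInto .inHd .inNxt (.reg .v))
        (insertInto .cHd .cNxt (.reg .u))))))).modA a = false → s.arr a = s₁.arr a :=
      fun a ha h => (hF.arr a h).trans (by simp [hs₂, ha])
    have hd : s.arr .dfn = s₀.arr .dfn := (hA _ (by decide) rfl).trans (hf₁.arr _ rfl)
    have hp : s.arr .post = s₀.arr .post := (hA _ (by decide) rfl).trans (hf₁.arr _ rfl)
    have hxc' : s.reg .xc = n := (hF.reg _ rfl).trans ((hf₁.reg _ rfl).trans hxc)
    have hfc' : s.reg .fc = 0 := (hF.reg _ rfl).trans ((hf₁.reg _ rfl).trans hfc)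
    refine ⟨by omega, loc, hb, hc, ht, fun v hv => ?_, hk, fun v hv => ?_, fun v hv => ?_, hxc',
      hfc', fun v hv => ?_, ?_, ?_, fun v hv => ?_, fun v hv => ?_⟩
    · rw [hF.arr .rHd rfl]
      by_cases hvn : v = n
      · subst hvn; simp [hs₂]
      · simpa [hs₂, hvn] using (h₁ v (by omega)).2.2.2.1
    · rw [hd, hA .ord (by decide) rfl]; exact (h₁ v hv).2.2.2.2.2.2.2.1
    · rw [hp, hA .pord (by decide) rfl]; exact (h₁ v hv).2.2.2.2.2.2.2.2
    · rw [hA .ex (by decide) rfl]; exact (h₁ v hv).1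
    · simp [hfc']
    · simp [hfc']
    · rw [hxc'] at hv
      rw [hfc', hA .fHd (by decide) rfl, (h₁ v hv).2.2.2.2.2.1]
      exact .empty _
    · rw [hxc'] at hv
      rw [hfc', hA .npred (by decide) rfl, (h₁ v hv).2.2.2.2.2.2.1]
      rfl

/-! ### Removal of the cross/forward edges -/

/-- The lists of edges after the removal of the cross/forward edges. -/
structure HasLists (n m : ℕ) (loc : ℕ → Kind × ℕ) (back stored : ℕ → Prop) (s : Mem) : Prop where
  back : IsFamily m loc .back back (s.arr .bHd) (s.arr .bNxt)
  stored : IsFamily m loc .stored stored (s.arr .rHd) (s.arr .rNxt)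
  cur : IsFamily m loc .cur (· < n) (s.arr .inHd) (s.arr .inNxt)

/-- The disjoint sets in memory have the representatives `rp`. -/
def HasSets (n : ℕ) (rp : ℕ → ℕ) (s : Mem) : Prop :=
  IsSets (n + 1) (s.arr .uf) (s.arr .rank) (s.arr .name) rp

theorem sum_indicator_le (m : ℕ) (loc : ℕ → Kind × ℕ) (wt : Kind × ℕ → ℕ) {b : ℕ}
    (h : ∀ k, wt k ≤ b) : ∑ e ∈ Finset.range m, wt (loc e) ≤ b * m := by
  calc ∑ e ∈ Finset.range m, wt (loc e) ≤ ∑ e ∈ Finset.range m, b :=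
        Finset.sum_le_sum fun e _ => h _
    _ = b * m := by simp [mul_comm]

/-- A cross/forward edge pays `8` units when it moves into `R`: three for the list, three for `rep`,
two for the insertion. A vertex pays `13`, of which `merge` takes eight. -/
theorem run_removeAllCrossForwardEdges {n m : ℕ} {s : Mem} {loc : ℕ → Kind × ℕ}
    (hg : HasGraph n m s) (hs : IsSetUp n m loc s) :
    Run (plainAmortization n) removeAllCrossForwardEdges s fun u s' => u ≤ 24 * (n + m + 1) ∧
      ∃ loc, HasLists n m loc (· < n) (· ≤ n) s' := by
  refine (run_makeSets hg.n_eq).plain_bind (k := n + 1) ?_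
  rintro u₀ s₀ ⟨hu₀, hpot, hsets⟩ hf
  refine ⟨hpot, ?_⟩
  have hg₀ := hg.frame hf rfl rfl
  set wt : Kind × ℕ → ℕ := fun k => if k.1 = .cross then 1 else 0 with hwt
  have hpord : IsOrder n (s₀.arr .post) (s₀.arr .pord) := by
    rw [hf.arr _ rfl, hf.arr .pord rfl]; exact hs.pord
  refine Run.forRange n (fun k u s => ∃ loc rp, HasSets n rp s ∧
    HasLists n m loc (· < n) (· ≤ n) s ∧
    IsFamily m loc .cross (fun a => a < n ∧ k ≤ s₀.arr .post a) (s.arr .cHd) (s.arr .cNxt) ∧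
    u + 8 * ∑ e ∈ Finset.range m, wt (loc e) ≤ 13 * k + 8 * m + 1) (by decide) (by decide)
    (fun s hF => by simp [hF.reg .n rfl, hg₀.n_eq]) ?_ ?_ ?_
  · refine ⟨loc, id, hsets, ⟨?_, ?_, ?_⟩, ?_, ?_⟩
    · simpa [hf.arr .bHd rfl, hf.arr .bNxt rfl] using hs.back
    · intro a ha
      rw [slot_eq_empty fun e he h => ?_]
      · simp [hf.arr .rHd rfl, hs.stored a ha, IsListOf.empty]
      · have := (hs.kind e he).1
        rw [h] at this
        simp at this
    · simpa [hf.arr .inHd rfl, hf.arr .inNxt rfl] using hs.cur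
    · simpa [hf.arr .cHd rfl, hf.arr .cNxt rfl] using
        hs.cross.mono (J := fun a => a < n ∧ 0 ≤ s₀.arr .post a) fun a h => h.1
    · have := sum_indicator_le m loc wt (b := 1) fun k => by simp only [hwt]; split_ifs <;> omega
      omega
  · rintro k u s hF ⟨loc, rp, hr, hl, hc, hu⟩ hi hk
    have hg := hg₀.frame hF rfl rfl
    refine Run.set_seq (by decide) ?_
    have hw := hpord.spec hg₀.post hk
    have hev : Exp.eval s (.get .pord (.reg .j)) = s₀.arr .pord k := by
      simp [hi, hF.arr .pord rfl]
    rw [hev]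
    set w := s₀.arr .pord k with hwdef
    set s₁ := s.setReg .w w with hs₁
    have hg₁ : HasGraph n m s₁ :=
      hg.frame ((Agree.refl removeAllCrossForwardEdges.modR removeAllCrossForwardEdges.modA
        s).setReg rfl) rfl rfl
    obtain ⟨l, hl1, hl2, hl3⟩ := hc w ⟨hw.1, hw.2.ge⟩
    refine Run.bind (Q := fun u' s' => ∃ loc rp, HasSets n rp s' ∧
      HasLists n m loc (· < n) (· ≤ n) s' ∧
      IsFamily m loc .cross (fun a => a < n ∧ k + 1 ≤ s₀.arr .post a)
        (s'.arr .cHd) (s'.arr .cNxt) ∧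
      u + u' + 8 * ∑ e ∈ Finset.range m, wt (loc e) ≤ 13 * k + 8 * m + 3) ?_ ?_
    · refine Run.forList (l := l) (by simpa [hs₁] using hl1) (fun l u' s => ∃ loc rp,
        HasSets n rp s ∧ HasLists n m loc (· < n) (· ≤ n) s ∧
        IsFamily m loc .cross (fun a => a < n ∧ k + 1 ≤ s₀.arr .post a)
          (s.arr .cHd) (s.arr .cNxt) ∧ l.Nodup ∧ (∀ e ∈ l, e < m ∧ loc e = (.cross, w)) ∧
        u + u' + 8 * ∑ e ∈ Finset.range m, wt (loc e) ≤ 13 * k + 8 * m + 2)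
        (by decide) (by decide) (by decide) ?_ ?_ ?_
      · refine ⟨loc, rp, hr, ⟨hl.1, hl.2, hl.3⟩, ?_, hl2, fun e he => ?_, by omega⟩
        · have := hc.mono (J := fun a => a < n ∧ k + 1 ≤ s₀.arr .post a)
            fun a h => ⟨h.1, by omega⟩
          simpa [hs₁] using this
        · simpa [slot] using (hl3 e).1 he
      · rintro e l u' s p hF₁ ⟨loc, rp, hr, hl, hc, hnd, hmem, hu⟩
        obtain ⟨hem, hloc⟩ := hmem e (by simp)
        have hg := hg₁.frame hF₁ rfl rfl
        refine (run_rep .q (rp := rp) (by simpa [HasSets] using hr) (by decide)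
          (by simpa using (hg.tgt_lt e hem).le)).bind ?_
        rintro _ s' ⟨rfl, hq, hr'⟩ hf'
        simp only [Exp.eval, Mem.setReg_arr, Mem.setReg_reg, reduceCtorEq, if_false, if_true] at hq
        have he' : s'.reg .e = e := by simp [hf'.reg .e rfl]
        refine run_insertInto (rp (s.arr .tgt e)) (by decide) (by decide) (by decide)
          (fun s'' hf => by simp [hf.reg .q rfl, hq]) ?_
        refine ⟨Function.update loc e (.stored, rp (s.arr .tgt e)), rp, by simpa [HasSets] using hr',
          ⟨?_, ?_, ?_⟩, ?_, (List.nodup_cons.1 hnd).2, fun e₁ he₁ => ?_, ?_⟩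
        · simpa [hf'.arr .bHd rfl, hf'.arr .bNxt rfl] using
            hl.back.update_loc (fun a => id) (e := e) (by simp [hloc]) (by simp)
        · simpa [hf'.arr .rHd rfl, hf'.arr .rNxt rfl, he'] using
            hl.stored.insert hem (by simp [hloc]) (rp (s.arr .tgt e))
        · simpa [hf'.arr .inHd rfl, hf'.arr .inNxt rfl] using
            hl.cur.update_loc (fun a => id) (e := e) (by simp [hloc]) (by simp)
        -- The old list of `e` is that of `w`, whose post number `k` has just left the index set.
        · have := hc.update_loc (fun a => id) (e := e) (k := (.stored, rp (s.arr .tgt e)))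
            (fun a ha h => by
              rw [hloc] at h
              have : w = a := by simpa using h
              subst this
              have := ha.2
              omega) (by simp)
          simpa [hf'.arr .cHd rfl, hf'.arr .cNxt rfl] using this
        · rw [Function.update_of_ne]
          · exact hmem e₁ (by simp [he₁])
          · rintro rfl; exact (List.nodup_cons.1 hnd).1 he₁
        · have := sum_update_loc wt loc hem (.stored, rp (s.arr .tgt e))
          have h1 : wt (loc e) = 1 := by simp [hwt, hloc]
          have h2 : wt (.stored, rp (s.arr .tgt e)) = 0 := by simp [hwt]
          omega
      · rintro u' s - ⟨loc, rp, hr, hl, hc, -, -, hu⟩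
        exact ⟨loc, rp, hr, hl, hc, by omega⟩
    · rintro u' s₂ ⟨loc, rp, hr, hl, hc, hu⟩ hf₂
      have hw₂ : s₂.reg .w = w := by simp [hf₂.reg .w rfl, hs₁]
      have hg₂ := hg₁.frame hf₂ rfl rfl
      refine (run_merge (x := w) (y := s₂.arr .par w) hr (by decide) (by decide) (by simp [hw₂])
        (fun s' hf => by simp [hf.reg .w rfl, hf.arr .par rfl, hw₂]) hw.1.le
        (hg₂.par_le w hw.1)).imp ?_
      rintro _ s₃ ⟨rfl, hr'⟩ hf₃
      refine ⟨loc, _, by simpa [HasSets] using hr', ⟨?_, ?_, ?_⟩, ?_, by omega⟩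
      · simpa [hf₃.arr .bHd rfl, hf₃.arr .bNxt rfl] using hl.back
      · simpa [hf₃.arr .rHd rfl, hf₃.arr .rNxt rfl] using hl.stored
      · simpa [hf₃.arr .inHd rfl, hf₃.arr .inNxt rfl] using hl.cur
      · simpa [hf₃.arr .cHd rfl, hf₃.arr .cNxt rfl] using hc
  · rintro u s - ⟨loc, rp, hr, hl, hc, hu⟩ -
    exact ⟨by omega, loc, hl⟩

/-! ### Restoring edges and adding constraints -/

/-- The gap `8` in `hwt` pays for moving one edge: list, `rep` and insertion. The list of `a` leaves
the index set because its chain in memory is not erased. -/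
theorem run_restoreCrossForwardEdges {n m a : ℕ} {s : Mem} {rp : ℕ → ℕ} {loc : ℕ → Kind × ℕ}
    {back stored : ℕ → Prop} (wt : Kind × ℕ → ℕ) (hwt : ∀ q b, wt (.cur, q) + 8 ≤ wt (.stored, b))
    (hg : HasGraph n m s) (hr : HasSets n rp s) (hl : HasLists n m loc back stored s)
    (hh : s.reg .h = a) (ha : stored a) :
    Run (setAmortization n) restoreCrossForwardEdges s fun u s' => ∃ loc',
      HasSets n rp s' ∧ HasLists n m loc' back (fun b => stored b ∧ b ≠ a) s' ∧
      u + ∑ e ∈ Finset.range m, wt (loc' e) ≤ ∑ e ∈ Finset.range m, wt (loc e) + 2 := by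
  obtain ⟨l, hl1, hl2, hl3⟩ := hl.stored a ha
  refine Run.forList (l := l) (by simpa [hh] using hl1) (fun l u s => ∃ loc',
    HasSets n rp s ∧ HasLists n m loc' back (fun b => stored b ∧ b ≠ a) s ∧ l.Nodup ∧
    (∀ e ∈ l, e < m ∧ loc' e = (.stored, a)) ∧
    u + ∑ e ∈ Finset.range m, wt (loc' e) ≤ ∑ e ∈ Finset.range m, wt (loc e) + 1)
    (by decide) (by decide) (by decide) ?_ ?_ ?_
  · refine ⟨loc, hr, ⟨hl.1, hl.2.mono fun b h => h.1, hl.3⟩, hl2, fun e he => ?_, by omega⟩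
    simpa [slot] using (hl3 e).1 he
  · rintro e l u s p hF ⟨loc, hr, hl, hnd, hmem, hu⟩
    obtain ⟨hem, hloc⟩ := hmem e (by simp)
    have hg := hg.frame hF rfl rfl
    refine (run_rep .q (rp := rp) (by simpa [HasSets] using hr) (by decide)
      (by simpa using (hg.tgt_lt e hem).le)).bind ?_
    rintro _ s' ⟨rfl, hq, hr'⟩ hf'
    simp only [Exp.eval, Mem.setReg_arr, Mem.setReg_reg, reduceCtorEq, if_false, if_true] at hq
    have he' : s'.reg .e = e := by simp [hf'.reg .e rfl]
    refine run_insertInto (rp (s.arr .tgt e)) (by decide) (by decide) (by decide)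
      (fun s'' hf => by simp [hf.reg .q rfl, hq]) ?_
    refine ⟨Function.update loc e (.cur, rp (s.arr .tgt e)), by simpa [HasSets] using hr',
      ⟨?_, ?_, ?_⟩, (List.nodup_cons.1 hnd).2, fun e₁ he₁ => ?_, ?_⟩
    · simpa [hf'.arr .bHd rfl, hf'.arr .bNxt rfl] using
        hl.back.update_loc (fun a => id) (e := e) (by simp [hloc]) (by simp)
    · have := hl.stored.update_loc (fun a => id) (e := e) (k := (.cur, rp (s.arr .tgt e)))
        (fun b hb h => hb.2 (by rw [hloc] at h; simpa using h.symm)) (by simp)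
      simpa [hf'.arr .rHd rfl, hf'.arr .rNxt rfl] using this
    · simpa [hf'.arr .inHd rfl, hf'.arr .inNxt rfl, he'] using
        hl.cur.insert hem (by simp [hloc]) (rp (s.arr .tgt e))
    · rw [Function.update_of_ne]
      · exact hmem e₁ (by simp [he₁])
      · rintro rfl; exact (List.nodup_cons.1 hnd).1 he₁
    · have := sum_update_loc wt loc hem (.cur, rp (s.arr .tgt e))
      rw [hloc] at this
      have := hwt (rp (s.arr .tgt e)) a
      omega
  · rintro u s - ⟨loc, hr, hl, -, -, hu⟩
    exact ⟨loc, hr, hl, by omega⟩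

/-- The scheduling constraints and the exits in memory. -/
structure HasExits (n : ℕ) (s : Mem) : Prop where
  constraints : HasConstraints s
  le_xc : n ≤ s.reg .xc
  ex_lt : ∀ v < n, s.arr .ex v < s.reg .xc

theorem HasExits.frame {n : ℕ} {R : Reg → Bool} {A : Arr → Bool} {s s' : Mem}
    (h : HasExits n s) (hf : Agree R A s s') (hR : (R .xc || R .fc) = false)
    (hA : (A .ex || A .fsrc || A .ftgt || A .fHd || A .fNxt || A .npred) = false) :
    HasExits n s' := by
  simp only [Bool.or_eq_false_iff] at hR hA
  obtain ⟨h1, h2⟩ := hR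
  obtain ⟨⟨⟨⟨⟨h3, h4⟩, h5⟩, h6⟩, h7⟩, h8⟩ := hA
  obtain ⟨a, b, c⟩ := h
  refine ⟨a.congr (hf.reg _ h1) (hf.reg _ h2) (hf.arr _ h4) (hf.arr _ h5) (hf.arr _ h6)
    (hf.arr _ h7) (hf.arr _ h8), ?_, ?_⟩ <;> simpa only [hf.reg _ h1, hf.arr _ h3]

theorem HasExits.setReg {n : ℕ} {s : Mem} (h : HasExits n s) {z : Reg} (c : ℕ)
    (hz : (z = .xc ∨ z = .fc → False)) : HasExits n (s.setReg z c) := by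
  have h1 : Reg.xc ≠ z := fun h => hz (.inl h.symm)
  have h2 : Reg.fc ≠ z := fun h => hz (.inr h.symm)
  refine ⟨h.1.congr ?_ ?_ rfl rfl rfl rfl rfl, ?_, ?_⟩
  · simp [h1]
  · simp [h2]
  · simpa [h1] using h.2
  · simpa [h1] using h.3

/-- The loop that adds constraints from the exits of the sources of the edges in a list. -/
theorem run_addConstraints {n m : ℕ} {s : Mem} {rp : ℕ → ℕ} {S : Finset ℕ} {b : Exp} (y : ℕ → ℕ)
    (hg : HasGraph n m s) (hr : HasSets n rp s) (hrp : ∀ x < n, rp x < n) (hx : HasExits n s)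
    (hl : IsListOf (s.arr .inNxt) (s.arr .inHd (s.reg .v)) S) (hS : ∀ e ∈ S, e < m)
    (hcb : b.cost < 8)
    (hb : ∀ s' e, (forList .inHd .inNxt (.reg .v) (.seq (rep .q (.get .src (.reg .e)))
      (addConstraint (.get .ex (.reg .q)) b))).Frame s s' → s'.reg .e = e → b.eval s' = y e)
    (hy : ∀ e ∈ S, y e < n) :
    Run (setAmortization n) (forList .inHd .inNxt (.reg .v) (.seq (rep .q (.get .src (.reg .e)))
      (addConstraint (.get .ex (.reg .q)) b))) s fun u s' => u = 12 * S.card + 2 ∧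
      s'.reg .fc ≤ s.reg .fc + u ∧ HasSets n rp s' ∧ HasExits n s' := by
  obtain ⟨l, hl1, hl2, hl3⟩ := hl
  set f := forList .inHd .inNxt (.reg .v) (.seq (rep .q (.get .src (.reg .e)))
      (addConstraint (.get .ex (.reg .q)) b)) with hf
  refine Run.forList (l := l) hl1 (fun l' u s' => u + 12 * l'.length = 12 * l.length + 1 ∧
    (∀ e ∈ l', e ∈ S) ∧ s'.reg .fc ≤ s.reg .fc + u ∧ HasSets n rp s' ∧ HasExits n s')
    (by decide) rfl rfl ?_ ?_ ?_
  · exact ⟨by omega, fun e he => (hl3 e).1 he, by simp, hr, hx.setReg _ (by simp)⟩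
  · rintro e l' u s₁ p hF ⟨hu, hmem, hfc, hr, hx⟩
    have heS := hmem e (by simp)
    have hg := hg.frame hF rfl rfl
    have hsrc := hg.src_lt e (hS e heS)
    set s₂ := (s₁.setReg .e e).setReg .p p with hs₂
    have hF₂ : f.Frame s s₂ := (hF.setReg rfl).setReg rfl
    refine (run_rep .q (rp := rp) (s := s₂) hr (by decide)
      (by simpa [hs₂] using hsrc.le)).bind ?_
    rintro _ s₃ ⟨rfl, hq, hr'⟩ hf₃
    simp only [Exp.eval, hs₂, Mem.setReg_arr, Mem.setReg_reg, reduceCtorEq, if_false, if_true] at hq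
    have hx₃ : HasExits n s₃ :=
      ((hx.setReg _ (by simp)).setReg _ (by simp) : HasExits n s₂).frame hf₃ rfl rfl
    have hF₃ : f.Frame s s₃ := hF₂.trans ((hf₃.seq_left _).forList _ _ _)
    have he₃ : s₃.reg .e = e := by simp [hf₃.reg .e rfl, hs₂]
    have hfc₃ : s₃.reg .fc = s₁.reg .fc := by simp [hf₃.reg .fc rfl, hs₂]
    refine (run_addConstraint (x := s₃.arr .ex (rp (s₁.arr .src e))) (y := y e) hx₃.1 (by decide)
      hcb (fun s' hf' => by simp [hf'.arr .ex rfl, hf'.reg .q rfl, hq])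
      (fun s' hf' => hb s' e (hF₃.trans ((hf'.seq_right _).forList _ _ _))
        (by rw [hf'.reg .e rfl, he₃]))
      (hx₃.3 _ (hrp _ hsrc)) ((hy e heS).trans_le hx₃.2)).imp ?_
    rintro _ s₄ ⟨rfl, h1, -, -, h2⟩ hf₄
    refine ⟨?_, fun e he => hmem e (by simp [he]), by omega, ?_, h2, ?_, ?_⟩
    · simp only [List.length_cons] at hu
      omega
    · simpa [HasSets, hf₄.arr .uf rfl, hf₄.arr .rank rfl, hf₄.arr .name rfl] using hr'
    · simpa [hf₄.reg .xc rfl] using hx₃.2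
    · simpa [hf₄.reg .xc rfl, hf₄.arr .ex rfl] using hx₃.3
  · rintro u s₁ - ⟨hu, -, hfc, hr, hx⟩
    simp only [List.length_nil, nodup_length_eq hl2 hl3] at hu
    exact ⟨by omega, by omega, hr, hx⟩

theorem run_addConstraintsTo {n m w : ℕ} {s : Mem} {rp : ℕ → ℕ} {loc : ℕ → Kind × ℕ}
    {back stored : ℕ → Prop} (hg : HasGraph n m s) (hr : HasSets n rp s)
    (hrp : ∀ x < n, rp x < n) (hx : HasExits n s) (hl : HasLists n m loc back stored s)
    (hv : s.reg .v = w) (hw : w < n) :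
    Run (setAmortization n) addConstraintsTo s fun u s' =>
      u = 24 * (slot m loc .cur w).card + 5 ∧
      s'.reg .fc ≤ s.reg .fc + u ∧ HasSets n rp s' ∧ HasExits n s' := by
  have hS : ∀ e ∈ slot m loc .cur w, e < m := fun e he => by
    simpa using (Finset.mem_filter.1 he).1
  refine (run_addConstraints (fun e => s.arr .tgt e) hg hr hrp hx
    (by rw [hv]; exact hl.cur w hw) hS (by decide)
    (fun s' e hf he => by simp [hf.arr .tgt rfl, he]) (fun e he => hg.tgt_lt e (hS e he))).bind ?_
  rintro _ s₁ ⟨rfl, hfc₁, hr₁, hx₁⟩ hf₁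
  have hg₁ := hg.frame hf₁ rfl rfl
  have hv₁ : s₁.reg .v = w := (hf₁.reg .v rfl).trans hv
  refine Run.onlyIf (by decide) (fun _ => ?_) fun h => absurd hg₁.lift_eq h
  refine (run_addConstraints (fun _ => w) hg₁ hr₁ hrp hx₁
    (by rw [hv₁, hf₁.arr .inNxt rfl, hf₁.arr .inHd rfl]; exact hl.cur w hw) hS (by decide)
    (fun s' e hf he => by simp [hf.reg .v rfl, hv₁]) (fun e he => hw)).imp ?_
  rintro _ s₂ ⟨rfl, hfc₂, hr₂, hx₂⟩ -
  exact ⟨by omega, by omega, hr₂, hx₂⟩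

/-! ### The search for nested components -/

/-- The first `k` entries of the sequence `f` are different representatives below `n`, and they
are marked with `h`. -/
structure IsWork (n : ℕ) (rp f mark : ℕ → ℕ) (h k : ℕ) : Prop where
  lt : ∀ i < k, f i < n
  rp_eq : ∀ i < k, rp (f i) = f i
  mark_eq : ∀ i < k, mark (f i) = h
  inj : ∀ i < k, ∀ j < k, f i = f j → i = j

namespace IsWork

variable {n h k : ℕ} {rp f mark : ℕ → ℕ}

theorem zero (n : ℕ) (rp f mark : ℕ → ℕ) (h : ℕ) : IsWork n rp f mark h 0 := by
  constructor <;> simp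

theorem injOn (hw : IsWork n rp f mark h k) : Set.InjOn f (Finset.range k) := fun i hi j hj =>
  hw.inj i (by simpa using hi) j (by simpa using hj)

theorem le (hw : IsWork n rp f mark h k) : k ≤ n := by
  have := Finset.card_le_card_of_injOn (s := Finset.range k) (t := Finset.range n) f
    (fun i hi => by simpa using hw.lt i (by simpa using hi)) hw.injOn
  simpa using this

theorem push (hw : IsWork n rp f mark h k) {q : ℕ} (hq : q < n) (hrp : rp q = q)
    (hne : ∀ i < k, f i ≠ q) :
    IsWork n rp (Function.update f k q) (Function.update mark q h) h (k + 1) := by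
  have key : ∀ i < k + 1, i = k ∧ Function.update f k q i = q ∨
      i < k ∧ Function.update f k q i = f i := fun i hi => by
    by_cases hik : i = k
    · subst hik; simp
    · exact .inr ⟨by omega, Function.update_of_ne hik _ _⟩
  refine ⟨fun i hi => ?_, fun i hi => ?_, fun i hi => ?_, fun i hi j hj => ?_⟩
  · rcases key i hi with ⟨-, h⟩ | ⟨h', h⟩ <;> rw [h]
    exacts [hq, hw.lt i h']
  · rcases key i hi with ⟨-, h⟩ | ⟨h', h⟩ <;> rw [h]
    exacts [hrp, hw.rp_eq i h']
  · rcases key i hi with ⟨-, h⟩ | ⟨h', h⟩ <;> rw [h]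
    · simp
    · rw [Function.update_of_ne (hne i h')]; exact hw.mark_eq i h'
  · rcases key i hi with ⟨h1, h⟩ | ⟨h1, h⟩ <;> rcases key j hj with ⟨h2, h'⟩ | ⟨h2, h'⟩ <;>
      rw [h, h']
    · omega
    · exact fun h => absurd h.symm (hne j h2)
    · exact fun h => absurd h (hne i h1)
    · exact hw.inj i h1 j h2

/-- Only this direction is needed: what is listed is marked. A stale mark could only shorten the
search, so nothing is required of the previous contents of the mark arrays. -/
theorem ne_of_mark (hw : IsWork n rp f mark h k) {q : ℕ} (hq : mark q ≠ h) :
    ∀ i < k, f i ≠ q := fun i hi he => hq (by rw [← he, hw.mark_eq i hi])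

end IsWork

open Reg Arr Exp in
theorem run_collectPreds {n m a : ℕ} {s : Mem} {rp : ℕ → ℕ} {S : Finset ℕ} (hg : HasGraph n m s)
    (hr : HasSets n rp s) (hrp : ∀ x < n, rp x < n)
    (hl : IsListOf (s.arr .bNxt) (s.arr .bHd a) S) (hS : ∀ e ∈ S, e < m)
    (hh : s.reg .h = a) (hnp : s.reg .np = 0) :
    Run (setAmortization n) (forList bHd bNxt h (.seq (rep q (src e))
      (onlyIf (.not (.eq (pmark q) h)) (.seq (.store pmark q h) (.seq (.store pl np q)
        (.set np (succ np))))))) s fun u s' => u ≤ 10 * S.card + 2 ∧ s'.reg .np ≤ S.card ∧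
      HasSets n rp s' ∧ IsWork n rp (s'.arr .pl) (s'.arr .pmark) a (s'.reg .np) := by
  obtain ⟨l, hl1, hl2, hl3⟩ := hl
  refine Run.forList (l := l) (by simpa [hh] using hl1) (fun l' u s' =>
    u + 10 * l'.length ≤ 10 * l.length + 1 ∧ s'.reg .np + l'.length ≤ l.length ∧
    (∀ e ∈ l', e ∈ S) ∧ HasSets n rp s' ∧
    IsWork n rp (s'.arr .pl) (s'.arr .pmark) a (s'.reg .np)) (by decide) rfl rfl ?_ ?_ ?_
  · refine ⟨by omega, by simp [hnp], fun e he => (hl3 e).1 he, hr, ?_⟩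
    simp only [Mem.setReg_reg, reduceCtorEq, if_false, hnp]
    exact .zero ..
  · rintro e l' u s₁ p hF ⟨hu, hnp, hmem, hr, hw⟩
    have hg := hg.frame hF rfl rfl
    have hsrc := hg.src_lt e (hS e (hmem e (by simp)))
    simp only [List.length_cons] at hu hnp
    refine (run_rep .q (rp := rp) (by simpa [HasSets] using hr) (by decide) (by simpa using hsrc.le)).bind ?_
    rintro _ s₃ ⟨rfl, hq, hr'⟩ hf₃
    simp only [Exp.eval, Mem.setReg_arr, Mem.setReg_reg, reduceCtorEq, if_false, if_true] at hq
    set x := rp (s₁.arr .src e) with hx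
    have hh₃ : s₃.reg .h = a := by simp [hf₃.reg .h rfl, hF.reg .h rfl, hh]
    have hnp₃ : s₃.reg .np = s₁.reg .np := by simp [hf₃.reg .np rfl]
    have hpl : s₃.arr .pl = s₁.arr .pl := by simp [hf₃.arr .pl rfl]
    have hpm : s₃.arr .pmark = s₁.arr .pmark := by simp [hf₃.arr .pmark rfl]
    have hmem' : ∀ e ∈ l', e ∈ S := fun e he => hmem e (by simp [he])
    refine Run.onlyIf (by decide) (fun hne => ?_) fun _ => ?_
    · simp only [Test.Holds, Exp.eval, hq, hh₃, hpm] at hne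
      refine Run.store_seq (by decide) (by decide) (Run.store_seq (by decide) (by decide)
        (Run.set (by decide) ⟨by omega, ?_, hmem', hr', ?_⟩))
      · simp [hnp₃]; omega
      · simpa [hq, hh₃, hnp₃, hpl, hpm] using hw.push (hrp _ hsrc)
          (hr.rp_rp (hsrc.trans (Nat.lt_succ_self n))) (hw.ne_of_mark hne)
    · exact ⟨by omega, by omega, hmem', hr', by rwa [hpl, hpm, hnp₃]⟩
  · rintro u s₁ - ⟨hu, hnp, -, hr, hw⟩
    simp only [List.length_nil, nodup_length_eq hl2 hl3] at hu hnp
    exact ⟨by omega, by omega, hr, hw⟩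

open Reg Arr Exp in
theorem run_initWork {A : Amortization} {n a b : ℕ} {s : Mem} {rp : ℕ → ℕ}
    (hp : IsWork n rp (s.arr .pl) (s.arr .pmark) a b)
    (hh : s.reg .h = a) (hnp : s.reg .np = b) (hnw : s.reg .nw = 0) :
    Run A (forRange j np (.seq (.set q (pl j)) (onlyIf (.not (.eq q h)) (.seq (.store mark q h)
      (.seq (.store wl nw q) (.set nw (succ nw))))))) s fun u s' => u ≤ 7 * b + 2 ∧
      s'.reg .nw ≤ b ∧ IsWork n rp (s'.arr .wl) (s'.arr .mark) a (s'.reg .nw) ∧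
      ∀ i < s'.reg .nw, s'.arr .wl i ≠ a := by
  refine Run.forRange b (fun k u s' => u ≤ 7 * k + 1 ∧ s'.reg .nw ≤ k ∧
    IsWork n rp (s'.arr .wl) (s'.arr .mark) a (s'.reg .nw) ∧
    -- This loop does not test marks, so distinctness of the entries is inherited from `pl`; hence
    -- the index `j < k`.
    ∀ i < s'.reg .nw, s'.arr .wl i ≠ a ∧ ∃ j < k, s'.arr .wl i = s.arr .pl j)
    (by decide) rfl (fun s' hF => (hF.reg .np rfl).trans hnp) ?_ ?_ ?_
  · simp only [Mem.setReg_reg, reduceCtorEq, if_false, hnw]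
    exact ⟨by omega, le_rfl, .zero .., by simp⟩
  · rintro k u s₁ hF ⟨hu, hk, hw, hi⟩ hj hkb
    refine Run.set_seq (by decide) ?_
    have hh₁ : s₁.reg .h = a := (hF.reg .h rfl).trans hh
    have hpl : s₁.arr .pl = s.arr .pl := hF.arr .pl rfl
    simp only [Exp.eval, hj, hpl]
    refine Run.onlyIf (by decide) (fun hne => ?_) fun _ => ?_
    · simp only [Test.Holds, Exp.eval, Mem.setReg_reg, reduceCtorEq, if_false, if_true, hh₁] at hne
      refine Run.store_seq (by decide) (by decide) (Run.store_seq (by decide) (by decide)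
        (Run.set (by decide) ⟨by omega, ?_, ?_, ?_⟩))
      · simp; omega
      · have hne' : ∀ i < s₁.reg .nw, s₁.arr .wl i ≠ s.arr .pl k := fun i hi' h => by
          obtain ⟨-, j', hj', he⟩ := hi i hi'
          have := hp.inj j' (by omega) k hkb (by rw [← he, h])
          omega
        simpa [hh₁] using hw.push (hp.lt k hkb) (hp.rp_eq k hkb) hne'
      · intro i hi'
        simp only [Mem.setReg_reg, Mem.setArr_reg, Mem.setReg_arr, Mem.setArr_arr, reduceCtorEq,
          if_false, if_true, Exp.eval] at hi' ⊢
        by_cases hin : i = s₁.reg .nw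
        · subst hin
          simp only [Function.update_self]
          exact ⟨hne, k, by omega, rfl⟩
        · simp only [Function.update_of_ne hin]
          obtain ⟨h1, j, hj, h2⟩ := hi i (by omega)
          exact ⟨h1, j, by omega, h2⟩
    · simp only [Mem.setReg_reg, Mem.setReg_arr, reduceCtorEq, if_false]
      exact ⟨by omega, by omega, hw, fun i hi' => by
        obtain ⟨h1, j, hj, h2⟩ := hi i hi'
        exact ⟨h1, j, by omega, h2⟩⟩
  · rintro u s₁ - ⟨hu, hk, hw, hi⟩ -
    exact ⟨by omega, hk, hw, fun i h => (hi i h).1⟩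

-- The worklist consists of distinct vertices below `n`, so at most `n` are scanned and `n - k`
-- decreases. An in-edge costs `10` units, and each scanned vertex another `5`. The parameter `b` is
-- the size of `P_h`: without predecessors there is no search, which matters since no merge would
-- pay for it.
open Reg Arr Exp in
theorem run_search {n m a b : ℕ} {s : Mem} {rp : ℕ → ℕ} {loc : ℕ → Kind × ℕ}
    {back stored : ℕ → Prop} (hg : HasGraph n m s) (hr : HasSets n rp s)
    (hrp : ∀ x < n, rp x < n) (hl : HasLists n m loc back stored s) (hh : s.reg .h = a)
    (hk : s.reg .k = 0) (hw : IsWork n rp (s.arr .wl) (s.arr .mark) a (s.reg .nw))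
    (hne : ∀ i < s.reg .nw, s.arr .wl i ≠ a) (hb : b = 0 → s.reg .nw = 0) :
    Run (setAmortization n) (.loop (.lt k nw) (.seq (.set v (wl k)) (.seq (.set k (succ k))
      (forList inHd inNxt v (.seq (rep q (src e))
        (onlyIf (.and (.not (.eq (mark q) h)) (.not (.eq q h))) (.seq (.store mark q h)
          (.seq (.store wl nw q) (.set nw (succ nw)))))))))) s fun u s' =>
      HasSets n rp s' ∧ IsWork n rp (s'.arr .wl) (s'.arr .mark) a (s'.reg .nw) ∧
      (∀ i < s'.reg .nw, s'.arr .wl i ≠ a) ∧ (b = 0 → s'.reg .nw = 0) ∧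
      u ≤ ∑ i ∈ Finset.range (s'.reg .nw), (10 * (slot m loc .cur (s'.arr .wl i)).card + 5) + 1 := by
  set g : ℕ → ℕ := fun v => 10 * (slot m loc .cur v).card + 5 with hgdef
  refine Run.loop_frame (by decide) (fun κ u s' => HasSets n rp s' ∧
    IsWork n rp (s'.arr .wl) (s'.arr .mark) a (s'.reg .nw) ∧
    (∀ i < s'.reg .nw, s'.arr .wl i ≠ a) ∧ (b = 0 → s'.reg .nw = 0) ∧
    s'.reg .k ≤ s'.reg .nw ∧ κ = n - s'.reg .k ∧
    u ≤ ∑ i ∈ Finset.range (s'.reg .k), g (s'.arr .wl i)) (k₀ := n)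
    ⟨hr, hw, hne, hb, by omega, by omega, by omega⟩ ?_ ?_
  · rintro κ u s₁ hF ⟨hr, hw, hne, hb, hk, rfl, hu⟩ hlt
    simp only [Test.Holds, Exp.eval] at hlt
    have hb0 : b ≠ 0 := fun h => by have := hb h; omega
    have hwn := hw.le
    set k₁ := s₁.reg .k with hk₁
    have hx := hw.lt k₁ hlt
    set x := s₁.arr .wl k₁ with hxdef
    have hlist : IsListOf (s₁.arr .inNxt) (s₁.arr .inHd x) (slot m loc .cur x) := by
      rw [hF.arr .inNxt rfl, hF.arr .inHd rfl]; exact hl.cur x hx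
    obtain ⟨l, hl1, hl2, hl3⟩ := hlist
    refine Run.set_seq (by decide) (Run.set_seq (by decide) ?_)
    simp only [Exp.eval, Mem.setReg_reg, reduceCtorEq, if_false, ← hk₁, ← hxdef]
    have hg₁ : HasGraph n m ((s₁.setReg .v x).setReg .k (k₁ + 1)) := by
      refine hg.frame (R := (Cmd.seq (.set v (wl k)) (.seq (.set k (succ k)) _)).modR)
        (A := fun a => (_ : Cmd).modA a) ((hF.setReg ?_).setReg ?_) ?_ ?_ <;> rfl
    refine Run.forList (l := l) (by simpa using hl1) (fun l' u' s' =>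
      u' + 10 * l'.length ≤ 10 * l.length + 1 ∧ (∀ e ∈ l', e < m) ∧ HasSets n rp s' ∧
      IsWork n rp (s'.arr .wl) (s'.arr .mark) a (s'.reg .nw) ∧
      (∀ i < s'.reg .nw, s'.arr .wl i ≠ a) ∧ k₁ < s'.reg .nw ∧
      ∀ i < k₁ + 1, s'.arr .wl i = s₁.arr .wl i) (by decide) rfl rfl ?_ ?_ ?_
    · refine ⟨by omega, fun e he => ?_, hr, by simpa using hw, by simpa using hne,
        by simpa using hlt, by simp⟩
      simpa using (Finset.mem_filter.1 ((hl3 e).1 he)).1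
    · rintro e l' u' s₂ p hF₂ ⟨hu, hmem, hr, hw, hne, hk, hpre⟩
      have hg := hg₁.frame hF₂ rfl rfl
      have hsrc := hg.src_lt e (hmem e (by simp))
      simp only [List.length_cons] at hu
      refine (run_rep .q (rp := rp) (by simpa [HasSets] using hr) (by decide) (by simpa using hsrc.le)).bind ?_
      rintro _ s₃ ⟨rfl, hq, hr'⟩ hf₃
      simp only [Exp.eval, Mem.setReg_arr, Mem.setReg_reg, reduceCtorEq, if_false, if_true] at hq
      have hh₃ : s₃.reg .h = a := by
        simp [hf₃.reg .h rfl, hF₂.reg .h rfl, hF.reg .h rfl, hh]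
      have hnw₃ : s₃.reg .nw = s₂.reg .nw := by simp [hf₃.reg .nw rfl]
      have hwl : s₃.arr .wl = s₂.arr .wl := by simp [hf₃.arr .wl rfl]
      have hm : s₃.arr .mark = s₂.arr .mark := by simp [hf₃.arr .mark rfl]
      have hmem' : ∀ e ∈ l', e < m := fun e he => hmem e (by simp [he])
      refine Run.onlyIf (by decide) (fun hne' => ?_) fun _ => ?_
      · simp only [Test.Holds, Exp.eval, hq, hh₃, hm] at hne'
        refine Run.store_seq (by decide) (by decide) (Run.store_seq (by decide) (by decide)
          (Run.set (by decide) ⟨by omega, hmem', hr', ?_, ?_, ?_, ?_⟩))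
        · simpa [hq, hh₃, hnw₃, hwl, hm] using hw.push (hrp _ hsrc)
            (hr.rp_rp (hsrc.trans (Nat.lt_succ_self n))) (hw.ne_of_mark hne'.1)
        · intro i hi
          simp only [Mem.setReg_reg, Mem.setArr_reg, Mem.setReg_arr, Mem.setArr_arr, reduceCtorEq,
            if_false, if_true, Exp.eval, hnw₃, hq, hwl] at hi ⊢
          by_cases hin : i = s₂.reg .nw
          · subst hin; simpa using hne'.2
          · rw [Function.update_of_ne hin]; exact hne i (by omega)
        · simp [hnw₃]; omega
        · intro i hi
          simp only [Mem.setArr_reg, Mem.setReg_arr, Mem.setArr_arr, reduceCtorEq,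
            if_false, if_true, Exp.eval, hnw₃, hwl]
          -- New vertices are written at position `nw`, beyond the entries already scanned.
          rw [Function.update_of_ne (by omega)]; exact hpre i hi
      · exact ⟨by omega, hmem', hr', by rwa [hwl, hm, hnw₃], by rwa [hwl, hnw₃], by rwa [hnw₃],
          by rwa [hwl]⟩
    · rintro u' s₂ hF₂ ⟨hu', -, hr, hw, hne, hk, hpre⟩
      have hks : s₂.reg .k = k₁ + 1 := by simp [hF₂.reg .k rfl]
      simp only [List.length_nil, nodup_length_eq hl2 hl3] at hu'
      refine ⟨n - (k₁ + 1), by omega, hr, hw, hne, fun h => absurd h hb0, by omega, by omega, ?_⟩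
      rw [hks, Finset.sum_range_succ, hpre k₁ (by omega), Finset.sum_congr rfl fun i hi => by
        rw [hpre i (by have := Finset.mem_range.1 hi; omega)]]
      simp only [← hxdef, hgdef] at hu ⊢
      omega
  · rintro κ u s₁ hF ⟨hr, hw, hne, hb, hk, rfl, hu⟩ hlt
    simp only [Test.Holds, Exp.eval] at hlt
    have : s₁.reg .k = s₁.reg .nw := by omega
    rw [this] at hu
    exact ⟨hr, hw, hne, hb, Nat.succ_le_succ hu⟩

/-! ### The constraints of a component -/

theorem run_findNestedSCCs {n m a : ℕ} {s : Mem} {rp : ℕ → ℕ} {loc : ℕ → Kind × ℕ}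
    {back stored : ℕ → Prop} (hg : HasGraph n m s) (hr : HasSets n rp s)
    (hrp : ∀ x < n, rp x < n) (hl : HasLists n m loc back stored s) (hh : s.reg .h = a)
    (ha : back a) :
    Run (setAmortization n) findNestedSCCs s fun u s' => HasSets n rp s' ∧
      s'.reg .np ≤ (slot m loc .back a).card ∧
      (∀ i < s'.reg .np, s'.arr .pl i < n) ∧
      IsWork n rp (s'.arr .wl) (s'.arr .mark) a (s'.reg .nw) ∧
      (∀ i < s'.reg .nw, s'.arr .wl i ≠ a) ∧ (s'.reg .np = 0 → s'.reg .nw = 0) ∧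
      u ≤ 17 * (slot m loc .back a).card + 8 +
        ∑ i ∈ Finset.range (s'.reg .nw), (10 * (slot m loc .cur (s'.arr .wl i)).card + 5) := by
  have hF : findNestedSCCs.Frame s s := .refl _ _ _
  refine Run.set_seq (by decide) ?_
  replace hF := hF.setReg (z := .np) (c := 0) rfl
  refine (run_collectPreds (n := n) (m := m) (a := a) (rp := rp) (S := slot m loc .back a)
    (hg.frame hF rfl rfl) hr hrp (by simpa using hl.back a ha)
    (fun e he => by simpa using (Finset.mem_filter.1 he).1) (by simpa using hh) (by simp)).bind ?_
  rintro u₁ s₁ ⟨hu₁, hnp₁, hr₁, hp₁⟩ hf₁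
  replace hF := hF.trans ((hf₁.seq_left _).seq_right _)
  have hh₁ : s₁.reg .h = a := (hF.reg .h rfl).trans hh
  refine Run.set_seq (by decide) ?_
  refine (run_initWork (s := s₁.setReg .nw 0) (a := a) (b := s₁.reg .np) (by simpa using hp₁)
    (by simpa using hh₁) (by simp) (by simp)).bind ?_
  rintro u₂ s₂ ⟨hu₂, hnw₂, hw₂, hne₂⟩ hf₂
  have hl₂ : HasLists n m loc back stored s₂ := by
    obtain ⟨h1, h2, h3⟩ := hl
    constructor <;> simpa [hf₂.arr .bHd rfl, hf₁.arr .bHd rfl, hf₂.arr .bNxt rfl, hf₁.arr .bNxt rfl,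
      hf₂.arr .rHd rfl, hf₁.arr .rHd rfl, hf₂.arr .rNxt rfl, hf₁.arr .rNxt rfl,
      hf₂.arr .inHd rfl, hf₁.arr .inHd rfl, hf₂.arr .inNxt rfl, hf₁.arr .inNxt rfl]
  have hr₂ : HasSets n rp s₂ := by
    simpa [HasSets, hf₂.arr .uf rfl, hf₂.arr .rank rfl, hf₂.arr .name rfl] using hr₁
  replace hF := (hF.setReg (z := .nw) (c := 0) rfl).trans
    ((((hf₂.seq_left _).seq_right _).seq_right _).seq_right _)
  have hh₂ : s₂.reg .h = a := (hF.reg .h rfl).trans hh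
  have hnp₂ : s₂.reg .np = s₁.reg .np := by simp [hf₂.reg .np rfl]
  have hpl₂ : s₂.arr .pl = s₁.arr .pl := by simp [hf₂.arr .pl rfl]
  refine Run.set_seq (by decide) ?_
  replace hF := hF.setReg (z := .k) (c := 0) rfl
  refine (run_search (n := n) (m := m) (a := a) (rp := rp) (loc := loc) (b := s₁.reg .np)
    (s := s₂.setReg .k 0) (hg.frame hF rfl rfl) hr₂ hrp ⟨hl₂.1, hl₂.2, hl₂.3⟩
    (by simpa using hh₂) (by simp) (by simpa using hw₂) (by simpa using hne₂)
    (fun h => by simp only [Mem.setReg_reg, reduceCtorEq, if_false]; omega)).imp ?_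
  rintro u₃ s₃ ⟨hr₃, hw₃, hne₃, hb₃, hu₃⟩ hf₃
  have hnp₃ : s₃.reg .np = s₁.reg .np := by simp [hf₃.reg .np rfl, hnp₂]
  have hpl₃ : s₃.arr .pl = s₁.arr .pl := by simp [hf₃.arr .pl rfl, hpl₂]
  refine ⟨hr₃, by omega, ?_, hw₃, hne₃, by rwa [hnp₃], by omega⟩
  rw [hpl₃, hnp₃]
  exact hp₁.lt

/-- All constraints have both ends below the old `xc`, so the new element starts with an empty list
and no predecessors. -/
theorem HasConstraints.newExit {s s' : Mem} (h : HasConstraints s)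
    (hxc : s'.reg .xc = s.reg .xc + 1) (hfc : s'.reg .fc = s.reg .fc)
    (h1 : s'.arr .fsrc = s.arr .fsrc) (h2 : s'.arr .ftgt = s.arr .ftgt)
    (h3 : s'.arr .fHd = Function.update (s.arr .fHd) (s.reg .xc) 0)
    (h4 : s'.arr .fNxt = s.arr .fNxt)
    (h5 : s'.arr .npred = Function.update (s.arr .npred) (s.reg .xc) 0) : HasConstraints s' := by
  constructor <;> simp only [hxc, hfc, h1, h2, h3, h4, h5]
  · intro c hc; have := h.src_lt c hc; omega
  · intro c hc; have := h.tgt_lt c hc; omega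
  · intro v hv
    by_cases hvx : v = s.reg .xc
    · subst hvx
      rw [Function.update_self, Finset.filter_eq_empty_iff.2 fun c hc => by
        have := h.src_lt c (by simpa using hc); omega]
      exact .empty _
    · rw [Function.update_of_ne hvx]; exact h.list v (by omega)
  · intro v hv
    by_cases hvx : v = s.reg .xc
    · subst hvx
      rw [Function.update_self, Finset.filter_eq_empty_iff.2 fun c hc => by
        have := h.tgt_lt c (by simpa using hc); omega]
      rfl
    · rw [Function.update_of_ne hvx]; exact h.npred_eq v (by omega)

-- Two facts feed the potential argument: the merged vertices get the representative `a`, and no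
-- vertex other than `a` can become a representative anew.
open Reg Arr Exp in
theorem run_mergeAll {n a b : ℕ} {s : Mem} {rp : ℕ → ℕ} (hr : HasSets n rp s)
    (hrp : ∀ x < n, rp x < n) (hh : s.reg .h = a) (ha : a < n) (hnw : s.reg .nw = b)
    (hw : ∀ i < b, s.arr .wl i < n) :
    Run (setAmortization n) (forRange k nw (merge (wl k) h)) s fun u s' => u = 10 * b + 2 ∧
      ∃ rp', HasSets n rp' s' ∧ (∀ x < n, rp' x < n) ∧ (∀ z, rp' z = z → rp z = z ∨ z = a) ∧
        ∀ i < b, rp' (s.arr .wl i) = a := by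
  refine Run.forRange b (fun k u s' => u = 10 * k + 1 ∧
    ∃ rp', HasSets n rp' s' ∧ (∀ x < n, rp' x < n) ∧ (∀ z, rp' z = z → rp z = z ∨ z = a) ∧
        ∀ i < k, rp' (s.arr .wl i) = a) (by decide) rfl (fun s' hF => (hF.reg .nw rfl).trans hnw)
    ⟨rfl, rp, hr, hrp, fun z h => .inl h, by simp⟩ ?_ ?_
  · rintro k u s₁ hF ⟨hu, rp₁, hr, hrp₁, hal, hdead⟩ hi hk
    have hwl : s₁.arr .wl = s.arr .wl := hF.arr .wl rfl
    have hh₁ : s₁.reg .h = a := (hF.reg .h rfl).trans hh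
    refine (run_merge (a := .get wl (.reg Reg.k)) (b := .reg h) (x := s.arr .wl k) (y := a) hr (by decide) (by decide) (by simp [hi, hwl])
      (fun s' hf => (hf.reg .h rfl).trans hh₁) (hw k hk).le ha.le).imp ?_
    rintro _ s₂ ⟨rfl, hr₂⟩ hf₂
    refine ⟨by omega, mergeRep rp₁ (s.arr .wl k) a, hr₂, fun x hx => ?_, fun z hz => ?_,
      fun i hi => ?_⟩
    · unfold mergeRep; split_ifs
      exacts [ha, hrp₁ x hx]
    · unfold mergeRep at hz; split_ifs at hz
      exacts [.inr hz.symm, hal z hz]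
    · by_cases hik : i = k
      · subst hik; simp [mergeRep]
      · unfold mergeRep; split_ifs
        exacts [rfl, hdead i (by omega)]
  · rintro u s₁ - ⟨hu, h⟩ -
    exact ⟨by omega, h⟩

open Reg Arr Exp in
theorem run_constrainAll {n m b : ℕ} {s : Mem} {rp : ℕ → ℕ} {loc : ℕ → Kind × ℕ}
    {back stored : ℕ → Prop} (hg : HasGraph n m s) (hr : HasSets n rp s)
    (hrp : ∀ x < n, rp x < n) (hx : HasExits n s) (hl : HasLists n m loc back stored s)
    (hnw : s.reg .nw = b) (hw : ∀ i < b, s.arr .wl i < n) :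
    Run (setAmortization n) (forRange k nw (.seq (.set v (wl k)) addConstraintsTo)) s fun u s' =>
      u = ∑ i ∈ Finset.range b, (24 * (slot m loc .cur (s.arr .wl i)).card + 8) + 2 ∧
      s'.reg .fc ≤ s.reg .fc + u ∧ HasSets n rp s' ∧ HasExits n s' := by
  refine Run.forRange b (fun k u s' =>
      u = ∑ i ∈ Finset.range k, (24 * (slot m loc .cur (s.arr .wl i)).card + 8) + 1 ∧
      s'.reg .fc ≤ s.reg .fc + u ∧ HasSets n rp s' ∧ HasExits n s') (by decide) rfl
    (fun s' hF => (hF.reg .nw rfl).trans hnw)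
    ⟨rfl, by simp, hr, hx.setReg _ (by simp)⟩ ?_ ?_
  · rintro k u s₁ hF ⟨hu, hfc, hr, hx⟩ hi hk
    have hwl : s₁.arr .wl = s.arr .wl := hF.arr .wl rfl
    refine Run.set_seq (by decide) ?_
    simp only [Exp.eval, hi, hwl]
    have hg₁ : HasGraph n m (s₁.setReg .v (s.arr .wl k)) :=
      hg.frame (hF.setReg (z := .v) rfl) rfl rfl
    refine (run_addConstraintsTo (w := s.arr .wl k) hg₁ hr hrp (hx.setReg _ (by simp)) (loc := loc)
      (back := back) (stored := stored) ⟨?_, ?_, ?_⟩ (by simp) (hw k hk)).imp ?_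
    · simpa [hF.arr .bHd rfl, hF.arr .bNxt rfl] using hl.1
    · simpa [hF.arr .rHd rfl, hF.arr .rNxt rfl] using hl.2
    · simpa [hF.arr .inHd rfl, hF.arr .inNxt rfl] using hl.3
    rintro u₂ s₂ ⟨hu₂, hfc₂, hr₂, hx₂⟩ -
    refine ⟨?_, ?_, hr₂, hx₂.setReg _ (by simp)⟩
    · rw [Finset.sum_range_succ]; omega
    · simp only [Mem.setReg_reg, reduceCtorEq, if_false] at hfc₂ ⊢; omega
  · rintro u s₁ - ⟨hu, hfc, hr, hx⟩ -
    exact ⟨by omega, by omega, hr, hx⟩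

open Reg Arr Exp in
theorem run_exitConstraints {n b : ℕ} {s : Mem} {rp : ℕ → ℕ} (hr : HasSets n rp s)
    (hrp : ∀ x < n, rp x < n) (hx : HasExits n s) (hxx : s.reg .x < s.reg .xc)
    (hnp : s.reg .np = b) (hp : ∀ i < b, s.arr .pl i < n) :
    Run (setAmortization n) (forRange j np (.seq (rep q (pl j)) (addConstraint (ex q) x))) s
      fun u s' => u = 11 * b + 2 ∧
      s'.reg .fc ≤ s.reg .fc + u ∧ HasSets n rp s' ∧ HasExits n s' := by
  refine Run.forRange b (fun k u s' => u = 11 * k + 1 ∧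
      s'.reg .fc ≤ s.reg .fc + u ∧ HasSets n rp s' ∧ HasExits n s') (by decide) rfl
    (fun s' hF => (hF.reg .np rfl).trans hnp)
    ⟨rfl, by simp, hr, hx.setReg _ (by simp)⟩ ?_ ?_
  · rintro k u s₁ hF ⟨hu, hfc, hr, hx⟩ hi hk
    have hpl : s₁.arr .pl = s.arr .pl := hF.arr .pl rfl
    have hpk := hp k hk
    refine (run_rep .q (rp := rp) hr (by decide) (by simpa [hi, hpl] using hpk.le)).bind ?_
    rintro _ s₂ ⟨rfl, hq, hr₂⟩ hf₂
    simp only [Exp.eval, hi, hpl] at hq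
    have hx₂ := hx.frame hf₂ rfl rfl
    have hxs : s₂.reg .x = s.reg .x := (hf₂.reg .x rfl).trans (hF.reg .x rfl)
    have hxc : s₂.reg .xc = s.reg .xc := (hf₂.reg .xc rfl).trans (hF.reg .xc rfl)
    refine (run_addConstraint (x := s₂.arr .ex (rp (s.arr .pl k))) (y := s.reg .x) hx₂.1 (by decide)
      (by decide) (fun s' hf' => by simp [hf'.arr .ex rfl, hf'.reg .q rfl, hq])
      (fun s' hf' => by simp [hf'.reg .x rfl, hxs]) (hx₂.3 _ (hrp _ hpk)) (by omega)).imp ?_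
    rintro _ s₃ ⟨rfl, h1, -, -, h2⟩ hf₃
    have hfc₂ : s₂.reg .fc = s₁.reg .fc := hf₂.reg .fc rfl
    refine ⟨by omega, ?_, ?_, HasExits.setReg ⟨h2, ?_, ?_⟩ _ (by simp)⟩
    · simp only [Mem.setReg_reg, reduceCtorEq, if_false]; omega
    · simpa [HasSets, hf₃.arr .uf rfl, hf₃.arr .rank rfl, hf₃.arr .name rfl] using hr₂
    · simpa [hf₃.reg .xc rfl] using hx₂.2
    · simpa [hf₃.reg .xc rfl, hf₃.arr .ex rfl] using hx₂.3
  · rintro u s₁ - ⟨hu, hfc, hr, hx⟩ -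
    exact ⟨by omega, by omega, hr, hx⟩

/-- The constants collect the parts: `28 = 17 + 11` per back edge for the search and the constraints
to the exit, `34 = 10 + 24` per current edge for the search and the two kinds of constraints, `23 =
5 + 8 + 10` per vertex of `N` for search, constraints and merge. -/
theorem run_constructWPOForSCC {n m a : ℕ} {s : Mem} {rp : ℕ → ℕ} {loc : ℕ → Kind × ℕ}
    {back stored : ℕ → Prop} (hg : HasGraph n m s) (hr : HasSets n rp s)
    (hrp : ∀ x < n, rp x < n) (hx : HasExits n s) (hl : HasLists n m loc back stored s)
    (hh : s.reg .h = a) (ha : back a) (han : a < n) :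
    Run (setAmortization n) constructWPOForSCC s fun u s' => ∃ rp' : ℕ → ℕ, ∃ N : Finset ℕ,
      HasSets n rp' s' ∧ (∀ x < n, rp' x < n) ∧ HasExits n s' ∧
      s'.reg .xc ≤ s.reg .xc + 1 ∧ s'.reg .fc ≤ s.reg .fc + u ∧ N ⊆ Finset.range n ∧
      (∀ v ∈ N, rp v = v ∧ v ≠ a ∧ rp' v ≠ v) ∧ (∀ z, rp' z = z → rp z = z ∨ z = a) ∧
      u ≤ 28 * (slot m loc .back a).card + 21 +
        ∑ v ∈ N, (34 * (slot m loc .cur v).card + 23) := by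
  have hF : constructWPOForSCC.Frame s s := .refl _ _ _
  refine (run_findNestedSCCs hg hr hrp hl hh ha).bind ?_
  rintro u₁ s₁ ⟨hr₁, hnp₁, hpl₁, hw₁, hne₁, h0, hu₁⟩ hf₁
  have hg₁ := hg.frame hf₁ rfl rfl
  have hx₁ := hx.frame hf₁ rfl rfl
  have hl₁ : HasLists n m loc back stored s₁ := by
    obtain ⟨h1, h2, h3⟩ := hl
    constructor <;> simpa [hf₁.arr .bHd rfl, hf₁.arr .bNxt rfl, hf₁.arr .rHd rfl,
      hf₁.arr .rNxt rfl, hf₁.arr .inHd rfl, hf₁.arr .inNxt rfl]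
  have hh₁ : s₁.reg .h = a := (hf₁.reg .h rfl).trans hh
  have hxc₁ : s₁.reg .xc = s.reg .xc := hf₁.reg .xc rfl
  have hfc₁ : s₁.reg .fc = s.reg .fc := hf₁.reg .fc rfl
  refine Run.onlyIf (by decide) (fun hne => ?_) fun h => ?_
  swap
  -- If `P_h` is empty then so is the worklist, and the empty `N` accounts for all the time spent.
  · have h := h0 (by simpa using h)
    rw [h] at hu₁
    refine ⟨rp, ∅, hr₁, hrp, hx₁, by omega, by omega, by simp, by simp, fun z h => .inl h, ?_⟩
    simp only [Finset.range_zero, Finset.sum_empty] at hu₁ ⊢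
    omega
  refine (run_constrainAll (b := s₁.reg .nw) hg₁ hr₁ hrp hx₁ hl₁ rfl hw₁.lt).bind ?_
  rintro u₂ s₂ ⟨hu₂, hfc₂, hr₂, hx₂⟩ hf₂
  refine Run.set_seq (by decide) (Run.set_seq (by decide) (Run.store_seq (by decide) (by decide)
    (Run.store_seq (by decide) (by decide) ?_)))
  simp only [Exp.eval, Mem.setReg_reg, Mem.setArr_reg, reduceCtorEq, if_false, if_true]
  set s₃ := (((s₂.setReg .x (s₂.reg .xc)).setReg .xc (s₂.reg .xc + 1)).setArr .fHd
    (s₂.reg .xc) 0).setArr .npred (s₂.reg .xc) 0 with hs₃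
  have hx₃ : HasExits n s₃ := by
    refine ⟨hx₂.1.newExit ?_ ?_ ?_ ?_ ?_ ?_ ?_, ?_, ?_⟩ <;> simp [hs₃]
    · have := hx₂.2; omega
    · intro v hv; have := hx₂.3 v hv; omega
  have hnp₃ : s₃.reg .np = s₁.reg .np := by simp [hs₃, hf₂.reg .np rfl]
  have hpl₃ : s₃.arr .pl = s₁.arr .pl := by simp [hs₃, hf₂.arr .pl rfl]
  have hxc₃ : s₃.reg .xc = s.reg .xc + 1 := by simp [hs₃, hf₂.reg .xc rfl, hxc₁]
  have hxx₃ : s₃.reg .x = s.reg .xc := by simp [hs₃, hf₂.reg .xc rfl, hxc₁]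
  have hfc₃ : s₃.reg .fc = s₂.reg .fc := by simp [hs₃]
  refine (run_exitConstraints (s := s₃) (b := s₁.reg .np) (rp := rp)
    (by simpa [HasSets, hs₃] using hr₂) hrp hx₃ (by omega) hnp₃ (by rwa [hpl₃])).bind ?_
  rintro u₄ s₄ ⟨hu₄, hfc₄, hr₄, hx₄⟩ hf₄
  have hh₄ : s₄.reg .h = a := by simp [hf₄.reg .h rfl, hs₃, hf₂.reg .h rfl, hh₁]
  have hxc₄ : s₄.reg .xc = s.reg .xc + 1 := (hf₄.reg .xc rfl).trans hxc₃
  have hxx₄ : s₄.reg .x = s.reg .xc := (hf₄.reg .x rfl).trans hxx₃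
  have hnw₄ : s₄.reg .nw = s₁.reg .nw := by simp [hf₄.reg .nw rfl, hs₃, hf₂.reg .nw rfl]
  have hwl₄ : s₄.arr .wl = s₁.arr .wl := by simp [hf₄.arr .wl rfl, hs₃, hf₂.arr .wl rfl]
  refine Run.store_seq (by decide) (by decide) (Run.store_seq (by decide) (by decide) ?_)
  simp only [Exp.eval, Mem.setArr_reg, hh₄, hxx₄]
  set s₅ := (s₄.setArr .nest (s.reg .xc) a).setArr .ex a (s.reg .xc) with hs₅
  have hx₅ : HasExits n s₅ := by
    refine ⟨hx₄.1.congr ?_ ?_ ?_ ?_ ?_ ?_ ?_, ?_, ?_⟩ <;> simp [hs₅]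
    · exact hx₄.2
    · intro v hv
      by_cases hva : v = a
      · subst hva; simp; omega
      · simpa [hva] using hx₄.3 v hv
  refine (run_mergeAll (s := s₅) (a := a) (b := s₁.reg .nw) (rp := rp)
    (by simpa [HasSets, hs₅] using hr₄) hrp (by simp [hs₅, hh₄]) han (by simp [hs₅, hnw₄])
    (by simpa [hs₅, hwl₄] using hw₁.lt)).imp ?_
  rintro u₆ s₆ ⟨hu₆, rp', hr₆, hrp₆, hal, hdead⟩ hf₆
  have hwl₅ : s₅.arr .wl = s₁.arr .wl := by simp [hs₅, hwl₄]
  rw [hwl₅] at hdead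
  have hsum : ∀ f : ℕ → ℕ, ∑ v ∈ (Finset.range (s₁.reg .nw)).image (s₁.arr .wl), f v =
      ∑ i ∈ Finset.range (s₁.reg .nw), f (s₁.arr .wl i) := fun f => Finset.sum_image hw₁.injOn
  refine ⟨rp', (Finset.range (s₁.reg .nw)).image (s₁.arr .wl), hr₆, hrp₆,
    hx₅.frame hf₆ rfl rfl, ?_, ?_, ?_, ?_, hal, ?_⟩
  · rw [hf₆.reg .xc rfl]; simp [hs₅, hxc₄]
  · have : s₆.reg .fc = s₄.reg .fc := by rw [hf₆.reg .fc rfl]; simp [hs₅]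
    omega
  · intro v hv
    obtain ⟨i, hi, rfl⟩ := Finset.mem_image.1 hv
    simpa using hw₁.lt i (by simpa using hi)
  · intro v hv
    obtain ⟨i, hi, rfl⟩ := Finset.mem_image.1 hv
    have hi : i < s₁.reg .nw := by simpa using hi
    refine ⟨hw₁.rp_eq i hi, hne₁ i hi, ?_⟩
    rw [hdead i hi]
    exact (hne₁ i hi).symm
  · rw [hsum]
    have e1 : ∀ c d : ℕ, ∑ i ∈ Finset.range (s₁.reg .nw),
        (c * (slot m loc .cur (s₁.arr .wl i)).card + d) =
        c * ∑ i ∈ Finset.range (s₁.reg .nw), (slot m loc .cur (s₁.arr .wl i)).card +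
          s₁.reg .nw * d := fun c d => by
      rw [Finset.sum_add_distrib, Finset.mul_sum]; simp
    rw [e1] at hu₁ hu₂ ⊢
    omega

/-! ### The main loop -/

/-- How often the list of current edges of a vertex may still be searched: `rp` gives the
representatives, and the vertices numbered below `i` have not been processed. -/
def activity (dfn : ℕ → ℕ) (i : ℕ) (rp : ℕ → ℕ) (a : ℕ) : ℕ :=
  -- The second summand covers the possibility that processing `a` makes it a representative again.
  -- Thus no argument is needed that unprocessed vertices are still representatives.
  (if rp a = a then 1 else 0) + if dfn a < i then 1 else 0

/-- The amortized time that an edge still has to pay. -/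
def edgeWeight (dfn : ℕ → ℕ) (i : ℕ) (rp : ℕ → ℕ) : Kind × ℕ → ℕ
  -- A back edge is read once, when its target is processed. A stored edge holds `76 = 34 * 2 + 8`:
  -- its maximal weight as a current edge and its restoration.
  | (.back, a) => if dfn a < i then 28 else 0
  | (.stored, _) => 76
  | (.cur, a) => 34 * activity dfn i rp a
  | _ => 0

theorem activity_le (dfn : ℕ → ℕ) (i : ℕ) (rp : ℕ → ℕ) (a : ℕ) : activity dfn i rp a ≤ 2 := by
  unfold activity; split_ifs <;> omega

theorem edgeWeight_le (dfn : ℕ → ℕ) (i : ℕ) (rp : ℕ → ℕ) (k : Kind × ℕ) :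
    edgeWeight dfn i rp k ≤ 76 := by
  have := activity_le dfn i rp k.2
  obtain ⟨K, a⟩ := k
  cases K <;> simp only [edgeWeight] at this ⊢ <;> (try split_ifs) <;> omega

theorem sum_slot_card (m : ℕ) (loc : ℕ → Kind × ℕ) (K : Kind) (N : Finset ℕ) :
    ∑ v ∈ N, (slot m loc K v).card =
      ∑ e ∈ Finset.range m, if (loc e).1 = K ∧ (loc e).2 ∈ N then 1 else 0 := by
  simp only [slot, Finset.card_filter]
  rw [Finset.sum_comm]
  refine Finset.sum_congr rfl fun e _ => ?_
  by_cases hK : (loc e).1 = K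
  · have : ∀ v, loc e = (K, v) ↔ (loc e).2 = v := fun v => by
      rw [Prod.ext_iff]; simp [hK]
    simp [this, hK]
  · have : ∀ v, loc e ≠ (K, v) := fun v h => hK (by rw [h])
    simp [this, hK]

section Potential

variable {n m i a : ℕ} {dfn rp rp' : ℕ → ℕ} {loc : ℕ → Kind × ℕ} {N : Finset ℕ}

/-- Vertices of `N` lose the first summand. The processed vertex `a` loses the second, which
compensates for a possible gain of the first. No other vertex gains anything. -/
theorem activity_drop (ha : dfn a = i) (hN : ∀ v ∈ N, rp v = v ∧ v ≠ a ∧ rp' v ≠ v)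
    (hal : ∀ z, rp' z = z → rp z = z ∨ z = a) (v : ℕ) :
    activity dfn i rp' v + (if v ∈ N then 1 else 0) ≤ activity dfn (i + 1) rp v := by
  unfold activity
  by_cases hva : v = a
  · subst hva
    have hvN : v ∉ N := fun h => (hN v h).2.1 rfl
    rw [if_neg hvN, if_neg (show ¬ dfn v < i by omega), if_pos (show dfn v < i + 1 by omega)]
    split_ifs <;> omega
  · have h1 : (if dfn v < i then 1 else 0) ≤ if dfn v < i + 1 then 1 else 0 := by
      split_ifs <;> omega
    by_cases hvN : v ∈ N
    · obtain ⟨h2, -, h3⟩ := hN v hvN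
      rw [if_pos hvN, if_pos h2, if_neg h3]; omega
    · rw [if_neg hvN]
      by_cases h3 : rp' v = v
      · rcases hal v h3 with h2 | h2
        · rw [if_pos h2, if_pos h3]; omega
        · exact absurd h2 hva
      · rw [if_neg h3]; omega

theorem sum_activity_drop (ha : dfn a = i) (hN : ∀ v ∈ N, rp v = v ∧ v ≠ a ∧ rp' v ≠ v)
    (hal : ∀ z, rp' z = z → rp z = z ∨ z = a) (hNn : N ⊆ Finset.range n) :
    ∑ v ∈ Finset.range n, activity dfn i rp' v + N.card ≤
      ∑ v ∈ Finset.range n, activity dfn (i + 1) rp v := by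
  have h1 : N.card = ∑ v ∈ Finset.range n, if v ∈ N then 1 else 0 := by
    rw [← Finset.sum_filter, ← Finset.card_eq_sum_ones, Finset.filter_mem_eq_inter,
      Finset.inter_eq_right.2 hNn]
  rw [h1, ← Finset.sum_add_distrib]
  exact Finset.sum_le_sum fun v _ => activity_drop ha hN hal v

theorem sum_edgeWeight_drop (ha : dfn a = i) (hN : ∀ v ∈ N, rp v = v ∧ v ≠ a ∧ rp' v ≠ v)
    (hal : ∀ z, rp' z = z → rp z = z ∨ z = a) :
    ∑ e ∈ Finset.range m, edgeWeight dfn i rp' (loc e) + 28 * (slot m loc .back a).card +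
      34 * ∑ v ∈ N, (slot m loc .cur v).card ≤
      ∑ e ∈ Finset.range m, edgeWeight dfn (i + 1) rp (loc e) := by
  have h1 := sum_slot_card m loc .back {a}
  rw [Finset.sum_singleton] at h1
  rw [h1, sum_slot_card, Finset.mul_sum, Finset.mul_sum, ← Finset.sum_add_distrib,
    ← Finset.sum_add_distrib]
  refine Finset.sum_le_sum fun e _ => ?_
  obtain ⟨K, v⟩ := loc e
  cases K <;> simp only [edgeWeight, reduceCtorEq, false_and, true_and, if_false,
    Finset.mem_singleton, mul_zero, add_zero, le_refl]
  · by_cases hva : v = a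
    · subst hva
      rw [if_neg (show ¬ dfn v < i by omega), if_pos (show dfn v < i + 1 by omega)]
      simp
    · rw [if_neg hva]; split_ifs <;> omega
  · have := activity_drop ha hN hal v
    omega

end Potential

theorem run_mainLoop {n m : ℕ} {s : Mem} {loc : ℕ → Kind × ℕ} (hg : HasGraph n m s)
    (hr : HasSets n id s) (hx : HasExits n s) (hl : HasLists n m loc (· < n) (· ≤ n) s)
    (hord : IsOrder n (s.arr .dfn) (s.arr .ord)) (hi : s.reg .i = n) (hxc : s.reg .xc = n)
    (hfc : s.reg .fc = 0) :
    Run (setAmortization n) (.loop (.lt (.lit 0) (.reg .i)) (.seq (.set .i (.pred (.reg .i)))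
      (.seq (.set .h (.get .ord (.reg .i))) (.seq restoreCrossForwardEdges constructWPOForSCC))))
      s fun u s' => ∃ loc rp, HasSets n rp s' ∧ (∀ x < n, rp x < n) ∧ HasExits n s' ∧
        HasLists n m loc (fun _ => False) (· = n) s' ∧ s'.reg .xc ≤ 2 * n ∧ s'.reg .fc ≤ u ∧
        u + ∑ e ∈ Finset.range m, edgeWeight (s.arr .dfn) 0 rp (loc e) ≤
          76 * m + 72 * n + 1 := by
  set d := s.arr .dfn with hd
  -- The invariant adds to the spent time what may still be charged: the edge weights, `23` per unit
  -- of activity of the vertices, and `26` per remaining iteration (`21` for the component, `2` for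
  -- restoring, `3` for test and assignments). Initially this is at most `76 * m + (46 + 26) * n`.
  -- At most one exit is created per iteration.
  refine Run.loop_frame (by decide) (fun κ u s' => κ = s'.reg .i ∧ κ ≤ n ∧ ∃ loc rp,
    HasSets n rp s' ∧ (∀ x < n, rp x < n) ∧ HasExits n s' ∧
    HasLists n m loc (fun a => a < n ∧ d a < κ) (fun b => b = n ∨ (b < n ∧ d b < κ)) s' ∧
    s'.reg .xc + κ ≤ 2 * n ∧ s'.reg .fc ≤ u ∧
    u + ∑ e ∈ Finset.range m, edgeWeight d κ rp (loc e) +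
      23 * ∑ v ∈ Finset.range n, activity d κ rp v + 26 * κ ≤ 76 * m + 72 * n) (k₀ := n) ?_ ?_ ?_
  · refine ⟨hi.symm, le_rfl, loc, id, hr, fun x => id, hx, ⟨?_, ?_, hl.cur⟩, by omega, by omega,
      ?_⟩
    · exact hl.back.mono (J := fun a => a < n ∧ d a < n) fun a h => h.1
    · exact hl.stored.mono (J := fun b => b = n ∨ (b < n ∧ d b < n)) fun b h => by omega
    · have h1 := sum_indicator_le m loc (edgeWeight d n id) (edgeWeight_le d n id)
      have h2 : ∑ v ∈ Finset.range n, activity d n id v ≤ ∑ v ∈ Finset.range n, 2 :=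
        Finset.sum_le_sum fun v _ => activity_le _ _ _ _
      simp only [Finset.sum_const, Finset.card_range, smul_eq_mul] at h2
      omega
  · rintro κ u s₁ hF ⟨hκ, hκn, loc, rp, hr, hrp, hx, hl, hxc, hfc, hu⟩ hlt
    simp only [Test.Holds, Exp.eval] at hlt
    obtain ⟨i, rfl⟩ : ∃ i, κ = i + 1 := ⟨κ - 1, by omega⟩
    refine Run.set_seq (by decide) (Run.set_seq (by decide) ?_)
    simp only [Exp.eval, ← hκ, Nat.add_sub_cancel, Mem.setReg_reg, Mem.setReg_arr, if_true,
      hF.arr .ord rfl]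
    obtain ⟨han, hda⟩ := hord.spec hg.dfn (show i < n by omega)
    set a := s.arr .ord i with ha
    set s₂ := (s₁.setReg .i i).setReg .h a with hs₂
    have hg₂ : HasGraph n m s₂ :=
      hg.frame ((hF.setReg (z := .i) (c := i) rfl).setReg (z := .h) (c := a) rfl) rfl rfl
    have hx₂ : HasExits n s₂ := (hx.setReg _ (by simp)).setReg _ (by simp)
    refine (run_restoreCrossForwardEdges (a := a) (rp := rp) (loc := loc)
      (edgeWeight d (i + 1) rp) (fun q b => ?_) hg₂ hr ⟨hl.1, hl.2, hl.3⟩ (by simp [hs₂])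
      (.inr ⟨han, by omega⟩)).bind ?_
    · have := activity_le d (i + 1) rp q
      simp only [edgeWeight]
      omega
    rintro u₃ s₃ ⟨loc₃, hr₃, hl₃, hu₃⟩ hf₃
    have hxc₃ : s₃.reg .xc = s₁.reg .xc := by simp [hf₃.reg .xc rfl, hs₂]
    have hfc₃ : s₃.reg .fc = s₁.reg .fc := by simp [hf₃.reg .fc rfl, hs₂]
    have hi₃ : s₃.reg .i = i := by simp [hf₃.reg .i rfl, hs₂]
    refine (run_constructWPOForSCC (a := a) (hg₂.frame hf₃ rfl rfl) hr₃ hrp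
      (hx₂.frame hf₃ rfl rfl) hl₃ (by simp [hf₃.reg .h rfl, hs₂]) ⟨han, by omega⟩ han).imp ?_
    rintro u₄ s₄ ⟨rp', N, hr₄, hrp₄, hx₄, hxc₄, hfc₄, hNn, hN, hal, hu₄⟩ hf₄
    refine ⟨i, by omega, ?_, by omega, loc₃, rp', hr₄, hrp₄, hx₄, ⟨?_, ?_, ?_⟩, by omega,
      by omega, ?_⟩
    · rw [hf₄.reg .i rfl, hi₃]
    · rw [hf₄.arr .bHd rfl, hf₄.arr .bNxt rfl]
      exact hl₃.back.mono (J := fun b => b < n ∧ d b < i) fun b h => ⟨h.1, by omega⟩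
    · rw [hf₄.arr .rHd rfl, hf₄.arr .rNxt rfl]
      refine hl₃.stored.mono (J := fun b => b = n ∨ (b < n ∧ d b < i)) fun b h => ?_
      rcases h with h | h
      · exact ⟨.inl h, by omega⟩
      · refine ⟨.inr ⟨h.1, by omega⟩, ?_⟩
        rintro rfl
        omega
    · rw [hf₄.arr .inHd rfl, hf₄.arr .inNxt rfl]
      exact hl₃.cur
    · have h1 := sum_edgeWeight_drop (m := m) (loc := loc₃) hda hN hal
      have h2 := sum_activity_drop hda hN hal hNn
      rw [Finset.sum_add_distrib, ← Finset.mul_sum] at hu₄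
      simp only [Finset.sum_const, smul_eq_mul] at hu₄
      omega
  · rintro κ u s₁ hF ⟨hκ, hκn, loc, rp, hr, hrp, hx, hl, hxc, hfc, hu⟩ hlt
    simp only [Test.Holds, Exp.eval] at hlt
    obtain rfl : κ = 0 := by omega
    exact ⟨loc, rp, hr, hrp, hx, ⟨fun a h => h.elim, fun b h => hl.stored b (.inl h), hl.cur⟩,
      by omega, by omega, by omega⟩

theorem run_connectWPOsOfMaximalSCCs {n m : ℕ} {s : Mem} {rp : ℕ → ℕ} {loc : ℕ → Kind × ℕ}
    {back stored : ℕ → Prop} (hg : HasGraph n m s) (hr : HasSets n rp s)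
    (hrp : ∀ x < n, rp x < n) (hx : HasExits n s) (hl : HasLists n m loc back stored s) :
    Run (setAmortization n) connectWPOsOfMaximalSCCs s fun u s' =>
      u ≤ 24 * m + 11 * n + 2 ∧ s'.reg .fc ≤ s.reg .fc + u ∧ HasConstraints s' := by
  refine Run.forRange n (fun k u s' =>
      u ≤ 24 * (∑ v ∈ Finset.range k, (slot m loc .cur v).card) + 11 * k + 1 ∧
      s'.reg .fc ≤ s.reg .fc + u ∧ HasSets n rp s' ∧ HasExits n s') (by decide) rfl
    (fun s' hF => (hF.reg .n rfl).trans hg.n_eq)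
    ⟨by simp, by simp, hr, hx.setReg _ (by simp)⟩ ?_ ?_
  · rintro k u s₁ hF ⟨hu, hfc, hr, hx⟩ hi hk
    have hg₁ := hg.frame hF rfl rfl
    refine (run_rep .q (rp := rp) hr (by decide) (by simp [hi]; omega)).bind ?_
    rintro _ s₂ ⟨rfl, hq, hr₂⟩ hf₂
    have hfc₂ : s₂.reg .fc = s₁.reg .fc := hf₂.reg .fc rfl
    rw [Finset.sum_range_succ]
    refine Run.onlyIf (by decide) (fun _ => ?_) fun _ => ?_
    · refine (run_addConstraintsTo (w := k) (loc := loc) (back := back) (stored := stored)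
        (hg₁.frame hf₂ rfl rfl) hr₂ hrp (hx.frame hf₂ rfl rfl) ⟨?_, ?_, ?_⟩
        ((hf₂.reg .v rfl).trans hi) hk).imp ?_
      · simpa [hf₂.arr .bHd rfl, hf₂.arr .bNxt rfl, hF.arr .bHd rfl, hF.arr .bNxt rfl] using hl.1
      · simpa [hf₂.arr .rHd rfl, hf₂.arr .rNxt rfl, hF.arr .rHd rfl, hF.arr .rNxt rfl] using hl.2
      · simpa [hf₂.arr .inHd rfl, hf₂.arr .inNxt rfl, hF.arr .inHd rfl, hF.arr .inNxt rfl]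
          using hl.3
      rintro u₃ s₃ ⟨hu₃, hfc₃, hr₃, hx₃⟩ -
      refine ⟨by omega, ?_, hr₃, hx₃.setReg _ (by simp)⟩
      simp only [Mem.setReg_reg, reduceCtorEq, if_false]; omega
    · refine ⟨by omega, ?_, hr₂, (hx.frame hf₂ rfl rfl).setReg _ (by simp)⟩
      simp only [Mem.setReg_reg, reduceCtorEq, if_false]; omega
  · rintro u s₁ - ⟨hu, hfc, hr, hx⟩ -
    -- The lists of current edges are disjoint.
    have : ∑ v ∈ Finset.range n, (slot m loc .cur v).card ≤ 1 * m := by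
      rw [sum_slot_card]
      exact sum_indicator_le m loc
        (fun k => if k.1 = .cur ∧ k.2 ∈ Finset.range n then 1 else 0)
        fun k => by split_ifs <;> omega
    exact ⟨by omega, by omega, hx.1⟩

/-- Each of the two rounds of disjoint sets starts from fresh singletons, whose potential costs `n +
1` units. -/
theorem run_constructWPOBU {n m : ℕ} {s : Mem} (hg : HasGraph n m s) :
    Run (plainAmortization n) constructWPOBU s fun u s' => u ≤ 200 * (n + m + 1) ∧
      s'.reg .xc ≤ 2 * n ∧ s'.reg .fc ≤ 200 * (n + m + 1) ∧ HasConstraints s' := by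
  refine (run_setUp hg).bind ?_
  rintro u₁ s₁ ⟨hu₁, loc₁, h₁⟩ hf₁
  have hg₁ := hg.frame hf₁ rfl rfl
  refine (run_removeAllCrossForwardEdges hg₁ h₁).bind ?_
  rintro u₂ s₂ ⟨hu₂, loc₂, hl₂⟩ hf₂
  have hg₂ := hg₁.frame hf₂ rfl rfl
  have hx₂ : HasExits n s₂ := by
    refine HasExits.frame ⟨h₁.constraints, h₁.xc_eq.ge, fun v hv => ?_⟩ hf₂ rfl rfl
    rw [h₁.ex_eq v hv, h₁.xc_eq]
    exact hv
  refine (run_makeSets hg₂.n_eq).plain_bind (k := n + 1) ?_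
  rintro u₃ s₃ ⟨hu₃, hpot, hr₃⟩ hf₃
  refine ⟨hpot, ?_⟩
  have hg₃ := hg₂.frame hf₃ rfl rfl
  have hx₃ := hx₂.frame hf₃ rfl rfl
  refine Run.set_seq (by decide) ?_
  have hn₃ : Exp.eval s₃ (.reg .n) = n := hg₃.n_eq
  rw [hn₃]
  set s₄ := s₃.setReg .i n with hs₄
  have hF₄ : Agree (· = .i) (fun _ => false) s₃ s₄ := (Agree.refl _ _ s₃).setReg (by simp)
  have hg₄ := hg₃.frame hF₄ rfl rfl
  refine (run_mainLoop (loc := loc₂) hg₄ hr₃ (hx₃.frame hF₄ rfl rfl) ⟨?_, ?_, ?_⟩ ?_ (by simp [hs₄])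
    ?_ ?_).bind ?_
  · simpa [hs₄, hf₃.arr .bHd rfl, hf₃.arr .bNxt rfl] using hl₂.1
  · simpa [hs₄, hf₃.arr .rHd rfl, hf₃.arr .rNxt rfl] using hl₂.2
  · simpa [hs₄, hf₃.arr .inHd rfl, hf₃.arr .inNxt rfl] using hl₂.3
  · simpa [hs₄, hf₃.arr .dfn rfl, hf₃.arr .ord rfl, hf₂.arr .dfn rfl, hf₂.arr .ord rfl,
      hf₁.arr .dfn rfl] using h₁.ord
  · simp [hs₄, hf₃.reg .xc rfl, hf₂.reg .xc rfl, h₁.xc_eq]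
  · simp [hs₄, hf₃.reg .fc rfl, hf₂.reg .fc rfl, h₁.fc_eq]
  rintro u₅ s₅ ⟨loc₅, rp, hr₅, hrp, hx₅, hl₅, hxc₅, hfc₅, hu₅⟩ hf₅
  have hg₅ := hg₄.frame hf₅ rfl rfl
  refine Run.set_seq (by decide) ?_
  have hn₅ : Exp.eval s₅ (.reg .n) = n := hg₅.n_eq
  rw [hn₅]
  set s₆ := s₅.setReg .h n with hs₆
  have hF₆ : Agree (· = .h) (fun _ => false) s₅ s₆ := (Agree.refl _ _ s₅).setReg (by simp)
  have hg₆ := hg₅.frame hF₆ rfl rfl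
  refine (run_restoreCrossForwardEdges (a := n) (edgeWeight (s₄.arr .dfn) 0 rp) (fun q b => ?_)
    hg₆ hr₅ ⟨hl₅.1, hl₅.2, hl₅.3⟩ (by simp [hs₆]) rfl).bind ?_
  · have := activity_le (s₄.arr .dfn) 0 rp q
    simp only [edgeWeight]
    omega
  rintro u₇ s₇ ⟨loc₇, hr₇, hl₇, hu₇⟩ hf₇
  have hxc₇ : s₇.reg .xc = s₅.reg .xc := by simp [hf₇.reg .xc rfl, hs₆]
  have hfc₇ : s₇.reg .fc = s₅.reg .fc := by simp [hf₇.reg .fc rfl, hs₆]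
  refine (run_connectWPOsOfMaximalSCCs (hg₆.frame hf₇ rfl rfl) hr₇ hrp
    ((hx₅.frame hF₆ rfl rfl).frame hf₇ rfl rfl) hl₇).imp ?_
  rintro u₈ s₈ ⟨hu₈, hfc₈, hc₈⟩ hf₈
  have hxc₈ : s₈.reg .xc = s₇.reg .xc := hf₈.reg .xc rfl
  exact ⟨by omega, by omega, by omega, hc₈⟩

/-! ### The topological traversal -/

/-- The state of a topological traversal of the constraints `c < F` from `src c` to `tgt c` on the
elements below `X`: the elements of `D` have been popped, and the constraints in `E` have been
counted. -/
structure IsTraversal (X F : ℕ) (src tgt : ℕ → ℕ) (D E : Finset ℕ) (sp : ℕ)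
    (stack count : ℕ → ℕ) : Prop where
  popped_lt : ∀ v ∈ D, v < X
  stack_lt : ∀ i < sp, stack i < X
  stack_inj : ∀ i < sp, ∀ j < sp, stack i = stack j → i = j
  stack_notMem : ∀ i < sp, stack i ∉ D
  counted_lt : ∀ c ∈ E, c < F
  counted_src : ∀ c ∈ E, src c ∈ D
  count_eq : ∀ v < X, count v = (E.filter fun c => tgt c = v).card
  -- This prevents a second push: counting a new constraint into `w` shows that `w` has been neither
  -- pushed nor popped.
  done : ∀ v, (v ∈ D ∨ ∃ i < sp, stack i = v) → ∀ c < F, tgt c = v → c ∈ E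

namespace IsTraversal

variable {X F : ℕ} {src tgt : ℕ → ℕ} {D E : Finset ℕ} {sp : ℕ} {stack count : ℕ → ℕ}

theorem pop (h : IsTraversal X F src tgt D E (sp + 1) stack count) :
    IsTraversal X F src tgt (insert (stack sp) D) E sp stack count where
  popped_lt v hv := by
    rcases Finset.mem_insert.1 hv with rfl | hv
    exacts [h.stack_lt sp (by omega), h.popped_lt v hv]
  stack_lt i hi := h.stack_lt i (by omega)
  stack_inj i hi j hj := h.stack_inj i (by omega) j (by omega)
  stack_notMem i hi hm := by
    rcases Finset.mem_insert.1 hm with he | hm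
    · have := h.stack_inj i (by omega) sp (by omega) he
      omega
    · exact h.stack_notMem i (by omega) hm
  counted_lt := h.counted_lt
  counted_src c hc := Finset.mem_insert_of_mem (h.counted_src c hc)
  count_eq := h.count_eq
  done v hv := by
    refine h.done v ?_
    rcases hv with hv | ⟨i, hi, rfl⟩
    · rcases Finset.mem_insert.1 hv with rfl | hv
      exacts [.inr ⟨sp, by omega, rfl⟩, .inl hv]
    · exact .inr ⟨i, by omega, rfl⟩

theorem visit (h : IsTraversal X F src tgt D E sp stack count) {e : ℕ} (he : e < F) (heE : e ∉ E)
    (hsrc : src e ∈ D) : IsTraversal X F src tgt D (insert e E) sp stack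
      (Function.update count (tgt e) (count (tgt e) + 1)) where
  popped_lt := h.popped_lt
  stack_lt := h.stack_lt
  stack_inj := h.stack_inj
  stack_notMem := h.stack_notMem
  counted_lt c hc := by
    rcases Finset.mem_insert.1 hc with rfl | hc
    exacts [he, h.counted_lt c hc]
  counted_src c hc := by
    rcases Finset.mem_insert.1 hc with rfl | hc
    exacts [hsrc, h.counted_src c hc]
  count_eq v hv := by
    by_cases hve : v = tgt e
    · subst hve
      rw [Function.update_self, Finset.filter_insert, if_pos rfl, Finset.card_insert_of_notMem
        (by simp [heE]), h.count_eq _ hv]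
    · rw [Function.update_of_ne hve, Finset.filter_insert, if_neg (Ne.symm hve), h.count_eq _ hv]
  done v hv c hc hcv := Finset.mem_insert_of_mem (h.done v hv c hc hcv)

theorem push (h : IsTraversal X F src tgt D E sp stack count) {w : ℕ} (hw : w < X)
    (hnew : w ∉ D ∧ ∀ i < sp, stack i ≠ w)
    (hcount : ((Finset.range F).filter fun c => tgt c = w).card ≤ count w) :
    IsTraversal X F src tgt D E (sp + 1) (Function.update stack sp w) count := by
  have key : ∀ i < sp + 1, i = sp ∧ Function.update stack sp w i = w ∨
      i < sp ∧ Function.update stack sp w i = stack i := fun i hi => by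
    by_cases hik : i = sp
    · subst hik; simp
    · exact .inr ⟨by omega, Function.update_of_ne hik _ _⟩
  refine ⟨h.popped_lt, fun i hi => ?_, fun i hi j hj => ?_, fun i hi => ?_, h.counted_lt,
    h.counted_src, h.count_eq, fun v hv => ?_⟩
  · rcases key i hi with ⟨-, h'⟩ | ⟨h1, h'⟩ <;> rw [h']
    exacts [hw, h.stack_lt i h1]
  · rcases key i hi with ⟨h1, h'⟩ | ⟨h1, h'⟩ <;> rcases key j hj with ⟨h2, h''⟩ | ⟨h2, h''⟩ <;>
      rw [h', h'']
    · omega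
    · exact fun he => absurd he.symm (hnew.2 j h2)
    · exact fun he => absurd he (hnew.2 i h1)
    · exact h.stack_inj i h1 j h2
  · rcases key i hi with ⟨-, h'⟩ | ⟨h1, h'⟩ <;> rw [h']
    exacts [hnew.1, h.stack_notMem i h1]
  · have hcase : v = w ∨ v ∈ D ∨ ∃ i < sp, stack i = v := by
      rcases hv with hv | ⟨i, hi, rfl⟩
      · exact .inr (.inl hv)
      · rcases key i hi with ⟨-, h'⟩ | ⟨h1, h'⟩ <;> rw [h']
        exacts [.inl rfl, .inr (.inr ⟨i, h1, rfl⟩)]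
    rcases hcase with rfl | hv
    · intro c hc hcv
      have hsub : (E.filter fun c => tgt c = v) ⊆ (Finset.range F).filter fun c => tgt c = v :=
        Finset.filter_subset_filter _ fun c hc => by simpa using h.counted_lt c hc
      -- The counted constraints into `v` are among all original ones and are at least as many, so
      -- all of them have been counted.
      have heq := Finset.eq_of_subset_of_card_le hsub (by rw [← h.count_eq v hw]; exact hcount)
      have : c ∈ (Finset.range F).filter fun c => tgt c = v := by simp [hc, hcv]
      rw [← heq] at this
      exact (Finset.mem_filter.1 this).1
    · exact h.done v hv

theorem card_popped_le (h : IsTraversal X F src tgt D E sp stack count) : D.card ≤ X :=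
  (Finset.card_le_card (t := Finset.range X) fun v hv => by simpa using h.popped_lt v hv).trans
    (by simp)

theorem card_counted_le (h : IsTraversal X F src tgt D E sp stack count) : E.card ≤ F :=
  (Finset.card_le_card (t := Finset.range F) fun v hv => by simpa using h.counted_lt v hv).trans
    (by simp)

end IsTraversal

open Reg Arr Exp in
theorem run_countSuccessors {A : Amortization} {X F a : ℕ} {src tgt : ℕ → ℕ} {D E : Finset ℕ}
    {s : Mem} {S : Finset ℕ} (hc : HasConstraints s) (hX : s.reg .xc = X) (hF : F ≤ s.reg .fc)
    (htgt : ∀ c < F, s.arr .ftgt c = tgt c)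
    (ht : IsTraversal X F src tgt D E (s.reg .sp) (s.arr .stack) (s.arr .count))
    (hv : s.reg .v = a) (haD : a ∈ D) (hl : IsListOf (s.arr .fNxt) (s.arr .fHd a) S)
    (hS : ∀ e ∈ S, e < F ∧ e ∉ E ∧ src e = a) :
    Run A (forList fHd fNxt v (.seq (.set w (ftgt e)) (.seq (.store count w (succ (count w)))
      (onlyIf (.eq (count w) (npred w)) (.seq (.store stack sp w) (.set sp (succ sp))))))) s
      fun u s' => ∃ E', u + 8 * E.card ≤ 8 * E'.card + 2 ∧
        IsTraversal X F src tgt D E' (s'.reg .sp) (s'.arr .stack) (s'.arr .count) := by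
  obtain ⟨l, hl1, hl2, hl3⟩ := hl
  refine Run.forList (l := l) (by simpa [hv] using hl1) (fun l' u s' => ∃ E',
    u + 8 * E.card ≤ 8 * E'.card + 1 ∧
    IsTraversal X F src tgt D E' (s'.reg .sp) (s'.arr .stack) (s'.arr .count) ∧ l'.Nodup ∧
    ∀ e ∈ l', e < F ∧ e ∉ E' ∧ src e = a) (by decide) rfl rfl ?_ ?_ ?_
  · exact ⟨E, by omega, by simpa using ht, hl2, fun e he => hS e ((hl3 e).1 he)⟩
  · rintro e l' u s₁ p hFr ⟨E', hu, ht, hnd, hmem⟩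
    obtain ⟨heF, heE, hes⟩ := hmem e (by simp)
    obtain ⟨hel, hnd⟩ := List.nodup_cons.1 hnd
    have hcard : (insert e E').card = E'.card + 1 := Finset.card_insert_of_notMem heE
    have hmem' : ∀ x ∈ l', x < F ∧ x ∉ insert e E' ∧ src x = a := fun x hx => by
      obtain ⟨h1, h2, h3⟩ := hmem x (by simp [hx])
      refine ⟨h1, fun h => ?_, h3⟩
      rcases Finset.mem_insert.1 h with rfl | h
      exacts [hel hx, h2 h]
    have hw : tgt e < X := by
      rw [← htgt e heF, ← hX]; exact hc.tgt_lt e (by omega)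
    have htg : s₁.arr .ftgt e = tgt e := by rw [hFr.arr .ftgt rfl, htgt e heF]
    -- `npred` may also count constraints added during the traversal; an inequality is enough for
    -- `push`.
    have hnp : ((Finset.range F).filter fun c => tgt c = tgt e).card ≤ s₁.arr .npred (tgt e) := by
      rw [hFr.arr .npred rfl, hc.npred_eq _ (by omega)]
      refine Finset.card_le_card fun c hc' => ?_
      simp only [Finset.mem_filter, Finset.mem_range] at hc' ⊢
      exact ⟨by omega, by rw [htgt c hc'.1]; exact hc'.2⟩
    have ht' := ht.visit heF heE (by rw [hes]; exact haD)
    refine Run.set_seq (by decide) (Run.store_seq (by decide) (by decide) ?_)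
    simp only [Exp.eval, Mem.setReg_reg, Mem.setReg_arr, if_true, reduceCtorEq, if_false, htg]
    refine Run.onlyIf (by decide) (fun heq => ?_) fun _ => ?_
    · simp only [Test.Holds, Exp.eval, Mem.setArr_arr, Mem.setReg_reg, Mem.setReg_arr, if_true,
        reduceCtorEq, if_false, Mem.setArr_reg, Function.update_self] at heq
      refine Run.store_seq (by decide) (by decide) (Run.set (by decide)
        ⟨insert e E', by omega, ?_, hnd, hmem'⟩)
      simp only [Exp.eval, Mem.setArr_arr, Mem.setReg_reg, Mem.setReg_arr, if_true,
        reduceCtorEq, if_false, Mem.setArr_reg]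
      refine ht'.push hw ⟨fun h => heE (ht.done _ (.inl h) e heF rfl), fun i hi h =>
        heE (ht.done _ (.inr ⟨i, hi, h⟩) e heF rfl)⟩ ?_
      rw [Function.update_self, heq]
      exact hnp
    · exact ⟨insert e E', by omega, by simpa using ht', hnd, hmem'⟩
  · rintro u s₁ - ⟨E', hu, ht, -, -⟩
    exact ⟨E', by omega, ht⟩

open Reg Arr Exp in
theorem run_initTraversal {A : Amortization} {X F : ℕ} {s : Mem} (hc : HasConstraints s)
    (hX : s.reg .xc = X) (hF : s.reg .fc = F) (hsp : s.reg .sp = 0) :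
    Run A (forRange v xc (.seq (.store count v (lit 0)) (onlyIf (.eq (npred v) (lit 0))
      (.seq (.store stack sp v) (.set sp (succ sp)))))) s fun u s' => u ≤ 6 * X + 2 ∧
      IsTraversal X F (s.arr .fsrc) (s.arr .ftgt) ∅ ∅ (s'.reg .sp) (s'.arr .stack)
        (s'.arr .count) := by
  refine Run.forRange X (fun k u s' => u ≤ 6 * k + 1 ∧
    IsTraversal k F (s.arr .fsrc) (s.arr .ftgt) ∅ ∅ (s'.reg .sp) (s'.arr .stack)
      (s'.arr .count)) (by decide) rfl (fun s' hFr => (hFr.reg .xc rfl).trans hX) ?_ ?_ ?_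
  · refine ⟨le_rfl, ?_⟩
    constructor <;> simp [hsp]
  · rintro k u s₁ hFr ⟨hu, ht⟩ hi hk
    have hnp : s₁.arr .npred = s.arr .npred := hFr.arr .npred rfl
    refine Run.store_seq (by decide) (by decide) ?_
    simp only [Exp.eval, hi]
    have ht' : IsTraversal (k + 1) F (s.arr .fsrc) (s.arr .ftgt) ∅ ∅ (s₁.reg .sp) (s₁.arr .stack)
        (Function.update (s₁.arr .count) k 0) := by
      obtain ⟨h1, h2, h3, h4, h5, h6, h7, h8⟩ := ht
      refine ⟨by simp, fun i hi => (h2 i hi).trans (Nat.lt_succ_self k), h3, h4, h5, h6,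
        fun v hv => ?_, h8⟩
      by_cases hvk : v = k
      · subst hvk; simp
      · rw [Function.update_of_ne hvk]; exact h7 v (by omega)
    refine Run.onlyIf (by decide) (fun heq => ?_) fun _ => ?_
    · simp only [Test.Holds, Exp.eval, Mem.setArr_arr, reduceCtorEq, if_false, Mem.setArr_reg, hi,
        hnp] at heq
      refine Run.store_seq (by decide) (by decide) (Run.set (by decide) ⟨by omega, ?_⟩)
      simp only [Exp.eval, Mem.setArr_arr, Mem.setReg_reg, Mem.setReg_arr, if_true,
        reduceCtorEq, if_false, Mem.setArr_reg, hi]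
      refine ht'.push (Nat.lt_succ_self k) ⟨by simp, fun i hi h => ?_⟩ ?_
      · have := ht.stack_lt i hi; omega
      · rw [← hF, ← hc.npred_eq k (by omega), heq]; exact Nat.zero_le _
    · exact ⟨by omega, by simpa using ht'⟩
  · rintro u s₁ - ⟨hu, ht⟩ -
    exact ⟨by omega, ht⟩

-- A popped element pays `13` units, including at most `7` for the constraint from its predecessor
-- in the order, and a counted constraint pays `8`. Constraints numbered from `F` on have popped
-- sources, so the list of a newly popped element contains original constraints only.
open Reg Arr Exp in
theorem run_traverse {A : Amortization} {X F : ℕ} {src tgt : ℕ → ℕ} {s : Mem}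
    (hc : HasConstraints s) (hX : s.reg .xc = X) (hF : s.reg .fc = F)
    (hsrc : s.arr .fsrc = src) (htgt : s.arr .ftgt = tgt) (hprev : s.reg .prev = 0)
    (ht : IsTraversal X F src tgt ∅ ∅ (s.reg .sp) (s.arr .stack) (s.arr .count)) :
    Run A (.loop (.lt (lit 0) sp) (.seq (.set sp (pred sp)) (.seq (.set v (stack sp))
      (.seq (onlyIf (.not (.eq prev (lit 0))) (addConstraint (pred prev) v))
      (.seq (.set prev (succ v)) (forList fHd fNxt v (.seq (.set w (ftgt e))
        (.seq (.store count w (succ (count w)))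
        (onlyIf (.eq (count w) (npred w)) (.seq (.store stack sp w) (.set sp (succ sp)))))))))))) s
      fun u _ => u ≤ 13 * X + 8 * F + 1 := by
  refine Run.loop_frame (by decide) (fun κ u s' => ∃ D E, κ = X - D.card ∧
    IsTraversal X F src tgt D E (s'.reg .sp) (s'.arr .stack) (s'.arr .count) ∧
    HasConstraints s' ∧ F ≤ s'.reg .fc ∧
    (∀ c < F, s'.arr .fsrc c = src c ∧ s'.arr .ftgt c = tgt c) ∧
    (∀ c < s'.reg .fc, F ≤ c → s'.arr .fsrc c ∈ D) ∧
    (s'.reg .prev ≠ 0 → s'.reg .prev - 1 ∈ D) ∧ u ≤ 8 * E.card + 13 * D.card) (k₀ := X) ?_ ?_ ?_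
  · exact ⟨∅, ∅, by simp, ht, hc, hF.ge, fun c _ => by simp [hsrc, htgt], fun c h h' => by omega,
      fun h => absurd hprev h, by simp⟩
  · rintro κ u s₁ hFr ⟨D, E, rfl, ht, hc, hF, horig, hadd, hprev, hu⟩ hlt
    simp only [Test.Holds, Exp.eval] at hlt
    have hX₁ : s₁.reg .xc = X := (hFr.reg .xc rfl).trans hX
    obtain ⟨r, hr⟩ : ∃ r, s₁.reg .sp = r + 1 := ⟨s₁.reg .sp - 1, by omega⟩
    rw [hr] at ht
    refine Run.set_seq (by decide) (Run.set_seq (by decide) ?_)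
    simp only [Exp.eval, hr, Nat.add_sub_cancel, Mem.setReg_reg, Mem.setReg_arr, if_true]
    set a := s₁.arr .stack r with ha
    have haX : a < X := ht.stack_lt r (by omega)
    have haD : a ∉ D := ht.stack_notMem r (by omega)
    have ht' := ht.pop
    rw [← ha] at ht'
    have hcard : (insert a D).card = D.card + 1 := Finset.card_insert_of_notMem haD
    have hcardX := ht'.card_popped_le
    set s₂ := (s₁.setReg .sp r).setReg .v a with hs₂
    have hc₂ : HasConstraints s₂ := hc.congr (by simp [hs₂]) (by simp [hs₂]) rfl rfl rfl rfl rfl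
    refine Run.bind (Q := fun u s' => u ≤ 7 ∧ HasConstraints s' ∧ F ≤ s'.reg .fc ∧
      (∀ c < F, s'.arr .fsrc c = src c ∧ s'.arr .ftgt c = tgt c) ∧
      (∀ c < s'.reg .fc, F ≤ c → s'.arr .fsrc c ∈ D)) ?_ ?_
    · have hfc₂ : s₂.reg .fc = s₁.reg .fc := by simp [hs₂]
      have hpr₂ : s₂.reg .prev = s₁.reg .prev := by simp [hs₂]
      refine Run.onlyIf (by decide) (fun hne => ?_) fun _ => ?_
      · simp only [Test.Holds, Exp.eval, hpr₂] at hne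
        have hpD := hprev hne
        refine (run_addConstraint (x := s₁.reg .prev - 1) (y := a) hc₂ (by decide) (by decide)
          (fun s' hf => by simp [hf.reg .prev rfl, hpr₂])
          (fun s' hf => by simp [hf.reg .v rfl, hs₂])
          (by have := ht.popped_lt _ hpD; simp [hs₂, hX₁, this]) (by simp [hs₂, hX₁, haX])).imp ?_
        rintro _ s₃ ⟨rfl, h1, h2, h3, h4⟩ -
        rw [hfc₂] at h1 h2 h3
        refine ⟨by omega, h4, by omega, fun c hc => ?_, fun c hc hFc => ?_⟩
        · rw [h2, h3, Function.update_of_ne (by omega), Function.update_of_ne (by omega)]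
          exact horig c hc
        · rw [h2]
          by_cases hcf : c = s₁.reg .fc
          · subst hcf; simpa using hpD
          · rw [Function.update_of_ne hcf]; exact hadd c (by omega) hFc
      · exact ⟨by omega, hc₂, by omega, horig, fun c hc => hadd c (by omega)⟩
    rintro u₃ s₃ ⟨hu₃, hc₃, hF₃, horig₃, hadd₃⟩ hf₃
    have hv₃ : s₃.reg .v = a := by simp [hf₃.reg .v rfl, hs₂]
    have hX₃ : s₃.reg .xc = X := by simp [hf₃.reg .xc rfl, hs₂, hX₁]
    have hsp₃ : s₃.reg .sp = r := by simp [hf₃.reg .sp rfl, hs₂]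
    have hst₃ : s₃.arr .stack = s₁.arr .stack := by simp [hf₃.arr .stack rfl, hs₂]
    have hco₃ : s₃.arr .count = s₁.arr .count := by simp [hf₃.arr .count rfl, hs₂]
    refine Run.set_seq (by decide) ?_
    simp only [Exp.eval, hv₃]
    set s₄ := s₃.setReg .prev (a + 1) with hs₄
    have hc₄ : HasConstraints s₄ := hc₃.congr (by simp [hs₄]) (by simp [hs₄]) rfl rfl rfl rfl rfl
    refine (run_countSuccessors (X := X) (F := F) (a := a) (src := src) (tgt := tgt)
      (D := insert a D) (E := E) hc₄ (by simp [hs₄, hX₃]) (by simpa [hs₄] using hF₃)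
      (fun c hc => by simpa [hs₄] using (horig₃ c hc).2)
      (by simpa [hs₄, hsp₃, hst₃, hco₃] using ht') (by simp [hs₄, hv₃]) (by simp)
      (hc₄.list a (by simp [hs₄, hX₃, haX])) ?_).imp ?_
    · intro c hc
      simp only [hs₄, Mem.setReg_reg, reduceCtorEq, if_false, Mem.setReg_arr, Finset.mem_filter,
        Finset.mem_range] at hc
      -- An added constraint would have its source in `D`, but `a` has only now been popped.
      have hcF : c < F := by
        by_contra hcF
        have := hadd₃ c hc.1 (by omega)
        rw [hc.2] at this
        exact haD this
      have hca : src c = a := by rw [← (horig₃ c hcF).1, hc.2]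
      exact ⟨hcF, fun hE => haD (by rw [← hca]; exact ht.counted_src c hE), hca⟩
    rintro u₅ s₅ ⟨E', hu₅, ht₅⟩ hf₅
    have hfc₅ : s₅.reg .fc = s₃.reg .fc := by simp [hf₅.reg .fc rfl, hs₄]
    have hsrc₅ : s₅.arr .fsrc = s₃.arr .fsrc := by simp [hf₅.arr .fsrc rfl, hs₄]
    have htgt₅ : s₅.arr .ftgt = s₃.arr .ftgt := by simp [hf₅.arr .ftgt rfl, hs₄]
    have hpr₅ : s₅.reg .prev = a + 1 := by simp [hf₅.reg .prev rfl, hs₄]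
    refine ⟨X - (insert a D).card, by omega, insert a D, E', rfl, ht₅, ?_, by omega, ?_, ?_, ?_,
      by omega⟩
    · exact hc₄.congr (hf₅.reg _ rfl) (hf₅.reg _ rfl) (hf₅.arr _ rfl) (hf₅.arr _ rfl)
        (hf₅.arr _ rfl) (hf₅.arr _ rfl) (hf₅.arr _ rfl)
    · rw [hsrc₅, htgt₅]; exact horig₃
    · rw [hfc₅, hsrc₅]
      exact fun c hc hFc => Finset.mem_insert_of_mem (hadd₃ c hc hFc)
    · rw [hpr₅]; simp
  · rintro κ u s₁ hFr ⟨D, E, rfl, ht, hc, hF, horig, hadd, hprev, hu⟩ hlt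
    have := ht.card_popped_le
    have := ht.card_counted_le
    omega

/-! ### The whole algorithm -/

/-- The traversal is linear in the numbers of elements and constraints; the latter are at most `200
* (n + m + 1)`, which at `8` units each accounts for most of `1900`. -/
theorem run_constructWTOBU {n m : ℕ} {s : Mem} (hg : HasGraph n m (s.setReg .lift 1)) :
    Run (plainAmortization n) constructWTOBU s fun u _ => u ≤ 1900 * (n + m + 1) := by
  refine Run.set_seq (by decide) ((run_constructWPOBU hg).bind ?_)
  rintro u₁ s₁ ⟨hu₁, hxc₁, hfc₁, hc₁⟩ -
  refine Run.set_seq (by decide) ?_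
  simp only [Exp.eval]
  set s₂ := s₁.setReg .sp 0 with hs₂
  have hc₂ : HasConstraints s₂ := hc₁.congr (by simp [hs₂]) (by simp [hs₂]) rfl rfl rfl rfl rfl
  refine (run_initTraversal (X := s₁.reg .xc) (F := s₁.reg .fc) hc₂ (by simp [hs₂])
    (by simp [hs₂]) (by simp [hs₂])).bind ?_
  rintro u₃ s₃ ⟨hu₃, ht₃⟩ hf₃
  have hc₃ : HasConstraints s₃ := hc₂.congr (hf₃.reg _ rfl) (hf₃.reg _ rfl) (hf₃.arr _ rfl)
    (hf₃.arr _ rfl) (hf₃.arr _ rfl) (hf₃.arr _ rfl) (hf₃.arr _ rfl)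
  refine Run.set_seq (by decide) ?_
  simp only [Exp.eval]
  set s₄ := s₃.setReg .prev 0 with hs₄
  have hc₄ : HasConstraints s₄ := hc₃.congr (by simp [hs₄]) (by simp [hs₄]) rfl rfl rfl rfl rfl
  refine (run_traverse (X := s₁.reg .xc) (F := s₁.reg .fc) (src := s₂.arr .fsrc)
    (tgt := s₂.arr .ftgt) hc₄ (by simp [hs₄, hf₃.reg .xc rfl, hs₂])
    (by simp [hs₄, hf₃.reg .fc rfl, hs₂]) (hf₃.arr .fsrc rfl) (hf₃.arr .ftgt rfl) (by simp [hs₄])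
    (by simpa [hs₄] using ht₃)).imp ?_
  rintro u₅ s₅ hu₅ -
  omega

/-! ### Depth-first forests -/

/-- At the end the stack is empty, so the finished vertices are a permutation of the discovered
ones, and both orders list every vertex once. -/
theorem DFSStep.invariant {V : Type} [DecidableEq V] {G : Digraph V} {S S' : DFSState V}
    (h : DFSStep G S S') (hS : (S.stack ++ S.finished).Perm S.discovered ∧ S.discovered.Nodup) :
    (S'.stack ++ S'.finished).Perm S'.discovered ∧ S'.discovered.Nodup := by
  obtain ⟨h1, h2⟩ := hS
  cases h with
  | root d f p v hv =>
    exact ⟨(h1.cons v).trans (List.perm_append_singleton v d).symm,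
      List.nodup_append.2 ⟨h2, by simp, by rintro a ha b hb rfl; simp at hb; exact hv (hb ▸ ha)⟩⟩
  | discover st d f p u v huv hv =>
    exact ⟨(h1.cons v).trans (List.perm_append_singleton v d).symm,
      List.nodup_append.2 ⟨h2, by simp, by rintro a ha b hb rfl; simp at hb; exact hv (hb ▸ ha)⟩⟩
  | finish st d f p u hu =>
    refine ⟨?_, h2⟩
    refine List.Perm.trans ?_ h1
    simp only [List.cons_append, ← List.append_assoc]
    exact List.perm_append_singleton u (st ++ f)

theorem isNumbering_idxOf {n : ℕ} {l : List (Fin n)} (hl : l.Nodup) (hm : ∀ v, v ∈ l) {f : ℕ → ℕ}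
    (hf : ∀ v : Fin n, f v = l.idxOf v) : IsNumbering n f := by
  have hlen : l.length = n := by
    have huniv : l.toFinset = Finset.univ :=
      Finset.eq_univ_iff_forall.2 fun v => by simpa using hm v
    rw [← List.toFinset_card_of_nodup hl, huniv]
    simp
  refine ⟨fun v hv => ?_, fun u hu v hv h => ?_, fun i hi => ?_⟩
  · have := List.idxOf_lt_length_of_mem (hm ⟨v, hv⟩)
    rw [← hf, hlen] at this
    exact this
  · have h1 := hf ⟨u, hu⟩
    have h2 := hf ⟨v, hv⟩
    simp only at h1 h2
    rw [h1, h2] at h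
    exact congrArg Fin.val ((List.idxOf_inj (hm _)).1 h)
  · refine ⟨l[i], (l[i]).2, ?_⟩
    rw [hf, hl.idxOf_getElem]

/-- The depth-first search makes DFN and post-DFN bijections onto the numbers below `n`. Hence the
loops over `ord` and `pord` visit each vertex exactly once. -/
theorem HoldsInput.hasGraph {n : ℕ} {G : Digraph (Fin n)} {edges : List (Fin n × Fin n)}
    {D : NumberedForest n} {s : Mem} (hD : IsDepthFirstForest G D) (hs : HoldsInput s edges D) :
    HasGraph n edges.length (s.setReg .lift 1) := by
  obtain ⟨d, f, hsteps, hmem, hdfn, hpost⟩ := hD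
  have hinv : ∀ S, Relation.ReflTransGen (DFSStep G) ⟨[], [], [], fun _ => none⟩ S →
      (S.stack ++ S.finished).Perm S.discovered ∧ S.discovered.Nodup := by
    intro S hS
    induction hS with
    | refl => simp
    | tail _ h ih => exact h.invariant ih
  obtain ⟨hp, hnd⟩ := hinv _ hsteps
  simp only [List.nil_append] at hp hnd
  obtain ⟨h1, h2, h3, h4, h5, h6, h7⟩ := hs
  refine ⟨by simpa using h1, by simpa using h2, by simp, fun e he => ?_, fun e he => ?_,
    fun v hv => ?_, ?_, ?_⟩
  · exact (h3 ⟨e, he⟩).trans_lt (edges.get ⟨e, he⟩).1.2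
  · exact (h4 ⟨e, he⟩).trans_lt (edges.get ⟨e, he⟩).2.2
  · refine (h5 ⟨v, hv⟩).trans_le ?_
    cases D.parent ⟨v, hv⟩ with
    | none => exact le_rfl
    | some w => exact w.2.le
  · exact isNumbering_idxOf hnd hmem fun v => (h6 v).trans (hdfn v)
  · exact isNumbering_idxOf (hp.nodup_iff.2 hnd) (fun v => hp.mem_iff.2 (hmem v)) fun v =>
      (h7 v).trans (hpost v)

end WTO

theorem mainTheorem7 :
    ∃ C : ℕ, ∀ (n : ℕ) (G : Digraph (Fin n)) (edges : List (Fin n × Fin n))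
      (D : WTO.NumberedForest n) (s : WTO.Mem),
      WTO.IsEdgeList G edges → WTO.IsDepthFirstForest G D → WTO.HoldsInput s edges D →
      ∃ (t : ℕ) (s' : WTO.Mem), WTO.Exec WTO.constructWTOBU s t s' ∧
        t ≤ C * (n + edges.length + 1) * (WTO.invAck n + 1) := by
  -- At most `1900 * (n + m + 1)` units are used, and a unit is `100 * (invAck n + 5) ≤ 500 *
  -- (invAck n + 1)` steps.
  refine ⟨500 * 1900, fun n G edges D s _ hD hs => ?_⟩
  obtain ⟨u, s', t, hx, ht, hu⟩ := WTO.run_constructWTOBU (hs.hasGraph hD)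
  refine ⟨t, s', hx, ?_⟩
  simp only [WTO.plainAmortization, WTO.setAmortization, add_zero, zero_add] at ht
  calc t ≤ 100 * (WTO.invAck n + 5) * u := ht
    _ ≤ 500 * (WTO.invAck n + 1) * (1900 * (n + edges.length + 1)) :=
      Nat.mul_le_mul (by omega) hu
    _ = 500 * 1900 * (n + edges.length + 1) * (WTO.invAck n + 1) := by ring
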